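/- Let $n$ be a non-negative integer and let $Y_n=Y(\mathfrak{gl}_n)$ be the Yangian over $\mathbb C$ in its RTT presentation: the unital associative $\mathbb C$-algebra on generators $T_{i,j}^{(r)}$ ($1\le i,j\le n$, $r\ge 1$), with $T_{i,j}^{(0)}:=\delta_{i,j}$, $T_{i,j}(u):=\sum_{r\ge 0}T_{i,j}^{(r)}u^{-r}$, $T(u):=\sum_{i,j} e_{i,j}\otimes T_{i,j}(u)$, subject to the relations given by $$R^{[1,2]}(u-v)\,T^{[1,3]}(u)\,T^{[2,3]}(v)=T^{[2,3]}(v)\,T^{[1,3]}(u)\,R^{[1,2]}(u-v),\qquad R(u)=u-\sum_{i,j=1}^n e_{i,j}\otimes e_{j,i},$$ where the superscripts indicate the tensor positions in $M_n\otimes M_n\otimes Y_n$. The matrix $T(u)$ over $Y_n[[u^{-1}]]$ has a unique Gauss factorization $T(u)=F(u)D(u)E(u)$ with $D(u)=\operatorname{diag}(D_1(u),\dots,D_n(u))$ diagonal, $E(u)$ upper unitriangular and $F(u)$ lower unitriangular, all with entries in $Y_n[[u^{-1}]]$. Write $D_i(u)=\sum_{r\ge0}D_i^{(r)}u^{-r}$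 and $\widetilde D_i(u)=\sum_{r\ge0}\widetilde D_i^{(r)}u^{-r}:=-D_i(u)^{-1}$ for $1\le i\le n$; for $1\le i<n$ let $E_i^{(r)}$ be the $u^{-r}$-coefficient of the $(i,i+1)$-entry of $E(u)$ and $F_i^{(r)}$ the $u^{-r}$-coefficient of the $(i+1,i)$-entry of $F(u)$. Then the algebra $Y_n$ is generated by the elements $\{D_i^{(r)},\widetilde D_i^{(r)}\}_{1\le i\le n,\,r\ge0}$ and $\{E_i^{(r)},F_i^{(r)}\}_{1\le i<n,\,r\ge1}$ subject only to the following relations, for all admissible $i,j,r,s,t$ (superscripts of $D$ and $\widetilde D$ being $\ge 0$, those of $E$ and $F$ being $\ge1$): \begin{align} D_i^{(0)}&=1,\\ \sum_{t=0}^r D_i^{(t)}\widetilde D_i^{(r-t)}&=-\delta_{r,0},\\ [D_i^{(r)},D_j^{(s)}]&=0,\\ [E_i^{(r)},F_j^{(s)}]&=\delta_{i,j}\sum_{t=0}^{r+s-1}\widetilde D_i^{(t)}D_{i+1}^{(r+s-1-t)},\\ [D_i^{(r)},E_j^{(s)}]&=(\delta_{i,j}-\delta_{i,j+1})\sum_{t=0}^{r-1}D_i^{(t)}E_j^{(r+s-1-t)},\\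 [D_i^{(r)},F_j^{(s)}]&=(\delta_{i,j+1}-\delta_{i,j})\sum_{t=0}^{r-1}F_j^{(r+s-1-t)}D_i^{(t)},\\ [E_i^{(r)},E_i^{(s)}]&=\sum_{t=1}^{s-1}E_i^{(t)}E_i^{(r+s-1-t)}-\sum_{t=1}^{r-1}E_i^{(t)}E_i^{(r+s-1-t)},\\ [F_i^{(r)},F_i^{(s)}]&=\sum_{t=1}^{r-1}F_i^{(r+s-1-t)}F_i^{(t)}-\sum_{t=1}^{s-1}F_i^{(r+s-1-t)}F_i^{(t)},\\ [E_i^{(r)},E_{i+1}^{(s+1)}]-[E_i^{(r+1)},E_{i+1}^{(s)}]&=-E_i^{(r)}E_{i+1}^{(s)},\\ [F_i^{(r+1)},F_{i+1}^{(s)}]-[F_i^{(r)},F_{i+1}^{(s+1)}]&=-F_{i+1}^{(s)}F_i^{(r)},\\ [E_i^{(r)},E_j^{(s)}]&=0\quad\text{if }|i-j|>1,\\ [F_i^{(r)},F_j^{(s)}]&=0\quad\text{if }|i-j|>1,\\ [E_i^{(r)},[E_i^{(s)},E_j^{(t)}]]+[E_i^{(s)},[E_i^{(r)},E_j^{(t)}]]&=0\quad\text{if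 }|i-j|=1,\\ [F_i^{(r)},[F_i^{(s)},F_j^{(t)}]]+[F_i^{(s)},[F_i^{(r)},F_j^{(t)}]]&=0\quad\text{if }|i-j|=1. \end{align} That is, the algebra defined by these generators and relations is isomorphic to $Y_n$ by an isomorphism that sends each generator to the element of $Y_n$ with the same name. -/

import Mathlib

open scoped Matrix Kronecker

noncomputable section

namespace YangianGL

/-! ### Yang's R-matrix and the RTT equation

Put `x = u⁻¹` and `y = v⁻¹`.  The ring of series in `x, y` over `A` is realised as
`A⟦y⟧⟦x⟧ = PowerSeries (PowerSeries A)`: the coefficient of `u⁻ʳ v⁻ˢ` of `f` is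
`coeff s (coeff r f)`.  All elements of `M_n ⊗ M_n ⊗ A⟦x, y⟧` are matrices indexed by
`Fin n × Fin n`. -/

section RTT

variable {A : Type*} [Ring A] {n : ℕ}

/-- The flip `∑ e_{i,j} ⊗ e_{j,i}` in `M_n ⊗ M_n`. -/
def flip (A : Type*) [Ring A] (n : ℕ) :
    Matrix (Fin n × Fin n) (Fin n × Fin n) (PowerSeries (PowerSeries A)) :=
  ∑ i : Fin n, ∑ j : Fin n, Matrix.single i j 1 ⊗ₖ Matrix.single j i 1

/-- The series `u⁻¹`. -/
def uInv (A : Type*) [Ring A] : PowerSeries (PowerSeries A) := PowerSeries.X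

/-- The series `v⁻¹`. -/
def vInv (A : Type*) [Ring A] : PowerSeries (PowerSeries A) := PowerSeries.C PowerSeries.X

/-- `u⁻¹ v⁻¹ R(u - v)`, where `R(u) = u - ∑ e_{i,j} ⊗ e_{j,i}` is Yang's R-matrix.  The central
unit `u⁻¹ v⁻¹` of the localization clears denominators, as
`u⁻¹ v⁻¹ (u - v) = v⁻¹ - u⁻¹`. -/
def rMatrix (A : Type*) [Ring A] (n : ℕ) :
    Matrix (Fin n × Fin n) (Fin n × Fin n) (PowerSeries (PowerSeries A)) :=
  (vInv A - uInv A) • (1 : Matrix (Fin n × Fin n) (Fin n × Fin n) (PowerSeries (PowerSeries A)))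
    - (uInv A * vInv A) • flip A n

/-- `T^{[1,3]}(u)`. -/
def tensorU (T : Matrix (Fin n) (Fin n) (PowerSeries A)) :
    Matrix (Fin n × Fin n) (Fin n × Fin n) (PowerSeries (PowerSeries A)) :=
  T.map (PowerSeries.map PowerSeries.C) ⊗ₖ 1

/-- `T^{[2,3]}(v)`. -/
def tensorV (T : Matrix (Fin n) (Fin n) (PowerSeries A)) :
    Matrix (Fin n × Fin n) (Fin n × Fin n) (PowerSeries (PowerSeries A)) :=
  1 ⊗ₖ T.map PowerSeries.C

/-- The left side `R^{[1,2]}(u-v) T^{[1,3]}(u) T^{[2,3]}(v)`, times `u⁻¹ v⁻¹`. -/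
def rttLeft (T : Matrix (Fin n) (Fin n) (PowerSeries A)) :
    Matrix (Fin n × Fin n) (Fin n × Fin n) (PowerSeries (PowerSeries A)) :=
  rMatrix A n * tensorU T * tensorV T

/-- The right side `T^{[2,3]}(v) T^{[1,3]}(u) R^{[1,2]}(u-v)`, times `u⁻¹ v⁻¹`. -/
def rttRight (T : Matrix (Fin n) (Fin n) (PowerSeries A)) :
    Matrix (Fin n × Fin n) (Fin n × Fin n) (PowerSeries (PowerSeries A)) :=
  tensorV T * tensorU T * rMatrix A n

end RTT

/-! ### The Yangian `Y_n` -/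

/-- The free algebra on the symbols `T_{i,j}^{(r)}`, `r ≥ 1`; the letter `(i, j, r)` stands for
`T_{i,j}^{(r+1)}`. -/
abbrev FreeT (n : ℕ) : Type := FreeAlgebra ℂ (Fin n × Fin n × ℕ)

/-- `T_{i,j}^{(r)}` for `r ≥ 0`, where `T_{i,j}^{(0)} = δ_{i,j}`. -/
def freeT {n : ℕ} (i j : Fin n) : ℕ → FreeT n
  | 0 => if i = j then 1 else 0
  | r + 1 => FreeAlgebra.ι ℂ (i, j, r)

/-- The matrix `T(u)` with entries `∑ T_{i,j}^{(r)} u⁻ʳ`, over the free algebra. -/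
def freeTMatrix (n : ℕ) : Matrix (Fin n) (Fin n) (PowerSeries (FreeT n)) :=
  Matrix.of fun i j => PowerSeries.mk (freeT i j)

/-- All the relations that are contained in the RTT equation: equality of the
`u⁻ʳ v⁻ˢ`-coefficients of the `(p, q)`-entries of its two sides. -/
inductive RTTRel (n : ℕ) : FreeT n → FreeT n → Prop
  | rtt (p q : Fin n × Fin n) (r s : ℕ) :
      RTTRel n
        (PowerSeries.coeff s (PowerSeries.coeff r (rttLeft (freeTMatrix n) p q)))
        (PowerSeries.coeff s (PowerSeries.coeff r (rttRight (freeTMatrix n) p q)))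

/-- The Yangian `Y_n = Y(gl_n)` over `ℂ`, in the RTT presentation. -/
abbrev Yangian (n : ℕ) : Type := RingQuot (RTTRel n)

/-- The element `T_{i,j}^{(r)}` of `Y_n`. -/
def genT {n : ℕ} (i j : Fin n) (r : ℕ) : Yangian n :=
  RingQuot.mkAlgHom ℂ (RTTRel n) (freeT i j r)

/-- The matrix `T(u)` over `Y_n⟦u⁻¹⟧`. -/
def tMatrix (n : ℕ) : Matrix (Fin n) (Fin n) (PowerSeries (Yangian n)) :=
  Matrix.of fun i j => PowerSeries.mk (genT i j)

/-! ### Gauss factorization -/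

/-- Candidates for the three factors of a Gauss factorization: two `n × n` matrices `F`, `E` and
the diagonal entries `D_1, …, D_n` of a diagonal matrix. -/
@[ext]
structure GaussFactors (n : ℕ) (B : Type*) where
  F : Matrix (Fin n) (Fin n) B
  D : Fin n → B
  E : Matrix (Fin n) (Fin n) B

/-- `T = F D E` with `F` lower unitriangular, `D` diagonal and `E` upper unitriangular. -/
structure GaussFactors.IsFactorizationOf {n : ℕ} {B : Type*} [Ring B]
    (G : GaussFactors n B) (T : Matrix (Fin n) (Fin n) B) : Prop where
  F_diag : ∀ i, G.F i i = 1
  F_upper : ∀ i j, i < j → G.F i j = 0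
  E_diag : ∀ i, G.E i i = 1
  E_lower : ∀ i j, j < i → G.E i j = 0
  eq_mul : T = G.F * Matrix.diagonal G.D * G.E

/-- The index `i`, for `1 ≤ i < n`, as an index in `1, …, n`. -/
def lo {n : ℕ} (i : Fin (n - 1)) : Fin n := ⟨i, by omega⟩

/-- The index `i + 1`, for `1 ≤ i < n`, as an index in `1, …, n`. -/
def hi {n : ℕ} (i : Fin (n - 1)) : Fin n := ⟨i + 1, by omega⟩

namespace GaussFactors

variable {n : ℕ} {A : Type*} [Ring A] (G : GaussFactors n (PowerSeries A))

/-- `D_i^{(r)}`, the coefficient of `u⁻ʳ` in `D_i(u)`. -/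
def coeffD (i : Fin n) (r : ℕ) : A := PowerSeries.coeff r (G.D i)

/-- `D̃_i^{(r)}`, the coefficient of `u⁻ʳ` in `D̃_i(u) = -D_i(u)⁻¹`. -/
def coeffDt (i : Fin n) (r : ℕ) : A := PowerSeries.coeff r (-Ring.inverse (G.D i))

/-- `E_i^{(r)}`, the coefficient of `u⁻ʳ` in `E_i(u) = E_{i,i+1}(u)`, the `(i, i+1)`-entry of
`E(u)`. -/
def coeffE (i : Fin (n - 1)) (r : ℕ) : A := PowerSeries.coeff r (G.E (lo i) (hi i))

/-- `F_i^{(r)}`, the coefficient of `u⁻ʳ` in `F_i(u) = F_{i,i+1}(u)`, the `(i+1, i)`-entry of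
`F(u)`. -/
def coeffF (i : Fin (n - 1)) (r : ℕ) : A := PowerSeries.coeff r (G.F (hi i) (lo i))

end GaussFactors

/-! ### The algebra with Drinfeld's generators and relations -/

/-- The generating symbols.  `D i r` and `Dt i r` stand for `D_i^{(r)}` and `D̃_i^{(r)}` with
`r ≥ 0`, whereas `E i r` and `F i r` stand for `E_i^{(r+1)}` and `F_i^{(r+1)}`. -/
inductive DrinfeldGen (n : ℕ) : Type
  | D (i : Fin n) (r : ℕ)
  | Dt (i : Fin n) (r : ℕ)
  | E (i : Fin (n - 1)) (r : ℕ)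
  | F (i : Fin (n - 1)) (r : ℕ)

/-- The free algebra on these symbols. -/
abbrev FreeDr (n : ℕ) : Type := FreeAlgebra ℂ (DrinfeldGen n)

/-- `D_i^{(r)}`, `r ≥ 0`. -/
def frD {n : ℕ} (i : Fin n) (r : ℕ) : FreeDr n := FreeAlgebra.ι ℂ (.D i r)

/-- `D̃_i^{(r)}`, `r ≥ 0`. -/
def frDt {n : ℕ} (i : Fin n) (r : ℕ) : FreeDr n := FreeAlgebra.ι ℂ (.Dt i r)

/-- `E_i^{(r)}`, used for `r ≥ 1` only (the value at `r = 0` is a dummy). -/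
def frE {n : ℕ} (i : Fin (n - 1)) : ℕ → FreeDr n
  | 0 => 0
  | r + 1 => FreeAlgebra.ι ℂ (.E i r)

/-- `F_i^{(r)}`, used for `r ≥ 1` only (the value at `r = 0` is a dummy). -/
def frF {n : ℕ} (i : Fin (n - 1)) : ℕ → FreeDr n
  | 0 => 0
  | r + 1 => FreeAlgebra.ι ℂ (.F i r)

/-- The Kronecker delta, as an integer. -/
def delta {α : Type*} [DecidableEq α] (a b : α) : ℤ := if a = b then 1 else 0

/-- Drinfeld's relations.  The bracket is the commutator `⁅a, b⁆ = a * b - b * a`. -/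
inductive DrinfeldRel (n : ℕ) : FreeDr n → FreeDr n → Prop
  | r0 (i : Fin n) : DrinfeldRel n (frD i 0) 1
  | r1 (i : Fin n) (r : ℕ) :
      DrinfeldRel n (∑ t ∈ Finset.Icc 0 r, frD i t * frDt i (r - t)) (-delta r 0 • 1)
  | r2 (i j : Fin n) (r s : ℕ) : DrinfeldRel n ⁅frD i r, frD j s⁆ 0
  | r3 (i j : Fin (n - 1)) (r s : ℕ) (hr : 1 ≤ r) (hs : 1 ≤ s) :
      DrinfeldRel n ⁅frE i r, frF j s⁆
        (delta i j • ∑ t ∈ Finset.Icc 0 (r + s - 1), frDt (lo i) t * frD (hi i) (r + s - 1 - t))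
  | r4 (i : Fin n) (j : Fin (n - 1)) (r s : ℕ) (hs : 1 ≤ s) :
      DrinfeldRel n ⁅frD i r, frE j s⁆
        ((delta i (lo j) - delta i (hi j)) •
          ∑ t ∈ Finset.range r, frD i t * frE j (r + s - 1 - t))
  | r5 (i : Fin n) (j : Fin (n - 1)) (r s : ℕ) (hs : 1 ≤ s) :
      DrinfeldRel n ⁅frD i r, frF j s⁆
        ((delta i (hi j) - delta i (lo j)) •
          ∑ t ∈ Finset.range r, frF j (r + s - 1 - t) * frD i t)
  | r6 (i : Fin (n - 1)) (r s : ℕ) (hr : 1 ≤ r) (hs : 1 ≤ s) :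
      DrinfeldRel n ⁅frE i r, frE i s⁆
        (∑ t ∈ Finset.Icc 1 (s - 1), frE i t * frE i (r + s - 1 - t)
          - ∑ t ∈ Finset.Icc 1 (r - 1), frE i t * frE i (r + s - 1 - t))
  | r7 (i : Fin (n - 1)) (r s : ℕ) (hr : 1 ≤ r) (hs : 1 ≤ s) :
      DrinfeldRel n ⁅frF i r, frF i s⁆
        (∑ t ∈ Finset.Icc 1 (r - 1), frF i (r + s - 1 - t) * frF i t
          - ∑ t ∈ Finset.Icc 1 (s - 1), frF i (r + s - 1 - t) * frF i t)
  | r8 (i j : Fin (n - 1)) (hij : (j : ℕ) = i + 1) (r s : ℕ) (hr : 1 ≤ r) (hs : 1 ≤ s) :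
      DrinfeldRel n (⁅frE i r, frE j (s + 1)⁆ - ⁅frE i (r + 1), frE j s⁆) (-(frE i r * frE j s))
  | r9 (i j : Fin (n - 1)) (hij : (j : ℕ) = i + 1) (r s : ℕ) (hr : 1 ≤ r) (hs : 1 ≤ s) :
      DrinfeldRel n (⁅frF i (r + 1), frF j s⁆ - ⁅frF i r, frF j (s + 1)⁆) (-(frF j s * frF i r))
  | r10 (i j : Fin (n - 1)) (hij : 1 < |(i : ℤ) - (j : ℤ)|) (r s : ℕ) (hr : 1 ≤ r) (hs : 1 ≤ s) :
      DrinfeldRel n ⁅frE i r, frE j s⁆ 0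
  | r11 (i j : Fin (n - 1)) (hij : 1 < |(i : ℤ) - (j : ℤ)|) (r s : ℕ) (hr : 1 ≤ r) (hs : 1 ≤ s) :
      DrinfeldRel n ⁅frF i r, frF j s⁆ 0
  | r12 (i j : Fin (n - 1)) (hij : |(i : ℤ) - (j : ℤ)| = 1) (r s t : ℕ)
      (hr : 1 ≤ r) (hs : 1 ≤ s) (ht : 1 ≤ t) :
      DrinfeldRel n (⁅frE i r, ⁅frE i s, frE j t⁆⁆ + ⁅frE i s, ⁅frE i r, frE j t⁆⁆) 0
  | r13 (i j : Fin (n - 1)) (hij : |(i : ℤ) - (j : ℤ)| = 1) (r s t : ℕ)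
      (hr : 1 ≤ r) (hs : 1 ≤ s) (ht : 1 ≤ t) :
      DrinfeldRel n (⁅frF i r, ⁅frF i s, frF j t⁆⁆ + ⁅frF i s, ⁅frF i r, frF j t⁆⁆) 0

/-- The associative unital algebra with Drinfeld's generators, subject only to Drinfeld's
relations. -/
abbrev DrinfeldYangian (n : ℕ) : Type := RingQuot (DrinfeldRel n)

/-- The quotient map from the free algebra. -/
def drMk (n : ℕ) : FreeDr n →ₐ[ℂ] DrinfeldYangian n := RingQuot.mkAlgHom ℂ (DrinfeldRel n)

end YangianGL

end

/-!
In both presentations the elements of degree one span an image of `gl_n`, acting by commutators.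
For each `r` this action turns the `T_{i,j}^{(r)}` into matrix units, so the RTT relations are
equivariant: they hold as soon as they hold for four quadruples of indices that involve only `1`
and `2`, where they amount to Drinfeld's relations between `D_1`, `D_2`, `E_1` and `F_1`.  Hence
equivariance extends `D_1(u)` to a matrix over Drinfeld's algebra that satisfies the RTT relations.

Conversely, the Schur complements of a matrix with RTT relations satisfy them again, and
`T(u) (T_{j,j+1}^{(1)} - e_{j+1,j}) = (T_{j,j+1}^{(1)} - e_{j+1,j}) T(u)`, conjugated by the
unitriangular Gauss factors, yields Drinfeld's relations with one factor of degree one.  These imply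
the others, since commutators with suitable polynomials in the `D_i^{(r)}` shift the degrees of the
`E_j^{(s)}`; transposition over the opposite ring carries the relations for `E` to those for `F`.

The resulting homomorphisms are mutually inverse, since both algebras are generated by the
`D_1^{(r)} = T_{1,1}^{(r)}`, `E_j^{(1)} = T_{j,j+1}^{(1)}` and `F_j^{(1)} = T_{j+1,j}^{(1)}`.
-/

noncomputable section

namespace YangianGL

/-! ### Root vectors of `gl_n` from Chevalley generators -/

section LieRing

variable {L : Type*} [LieRing L]

theorem lie_eq_zero_symm {x y : L} : ⁅x, y⁆ = 0 ↔ ⁅y, x⁆ = 0 := by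
  rw [← lie_skew, neg_eq_zero]

theorem lie_ite_zero (x y : L) (p : Prop) [Decidable p] :
    ⁅x, if p then y else 0⁆ = if p then ⁅x, y⁆ else 0 := by
  split_ifs <;> simp

/-- Both `⁅p, ⁅a, b⁆⁆ = ⁅⁅p, a⁆, b⁆` and the Jacobi identity express `⁅⁅p, a⁆, ⁅a, b⁆⁆` through
`⁅a, ⁅⁅p, a⁆, b⁆⁆`, with opposite signs. -/
theorem lie_lie_lie_eq_zero_of_serre (h2 : IsSMulRegular L 2) {p a b : L} (hpb : ⁅p, b⁆ = 0)
    (hap : ⁅a, ⁅p, a⁆⁆ = 0) (hab : ⁅a, ⁅a, b⁆⁆ = 0) : ⁅a, ⁅⁅p, a⁆, b⁆⁆ = 0 := by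
  have assoc : ⁅p, ⁅a, b⁆⁆ = ⁅⁅p, a⁆, b⁆ := by rw [leibniz_lie p, hpb, lie_zero, add_zero]
  have pos : ⁅a, ⁅⁅p, a⁆, b⁆⁆ = ⁅⁅p, a⁆, ⁅a, b⁆⁆ := by rw [leibniz_lie, hap, zero_lie, zero_add]
  have neg : ⁅⁅p, a⁆, ⁅a, b⁆⁆ = -⁅a, ⁅⁅p, a⁆, b⁆⁆ := by
    have jacobi := leibniz_lie p a ⁅a, b⁆
    rw [hab, lie_zero, assoc] at jacobi
    exact eq_neg_of_add_eq_zero_left jacobi.symm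
  refine h2.right_eq_zero_of_smul ?_
  rw [two_nsmul]
  nth_rewrite 1 [pos]
  rw [neg, neg_add_cancel]

/-- Elements of a Lie ring that satisfy the Chevalley–Serre relations of `gl_n`, numbered from `0`;
the families are indexed by all of `ℕ`, and only `⁅e i, f i⁆ = h i - h (i + 1)` is restricted to
the indices that occur in `gl_n`, so that families on `Fin n` may be extended by zero. -/
structure IsChevalleyFamily (n : ℕ) (e f h : ℕ → L) : Prop where
  lie_h_h : ∀ i j, ⁅h i, h j⁆ = 0
  lie_h_e : ∀ i j, ⁅h i, e j⁆ = (if i = j then e j else 0) - (if i = j + 1 then e j else 0)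
  lie_h_f : ∀ i j, ⁅h i, f j⁆ = (if i = j + 1 then f j else 0) - (if i = j then f j else 0)
  lie_e_f_of_ne : ∀ i j, i ≠ j → ⁅e i, f j⁆ = 0
  lie_e_f_self : ∀ i, i + 1 < n → ⁅e i, f i⁆ = h i - h (i + 1)
  lie_e_e : ∀ i j, i + 1 < j → ⁅e i, e j⁆ = 0
  lie_f_f : ∀ i j, i + 1 < j → ⁅f i, f j⁆ = 0
  serre_e_succ : ∀ i, ⁅e i, ⁅e i, e (i + 1)⁆⁆ = 0
  serre_e_pred : ∀ i, ⁅e (i + 1), ⁅e (i + 1), e i⁆⁆ = 0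
  serre_f_succ : ∀ i, ⁅f i, ⁅f i, f (i + 1)⁆⁆ = 0
  serre_f_pred : ∀ i, ⁅f (i + 1), ⁅f (i + 1), f i⁆⁆ = 0

/-- The root vector `e_{i, i+1+d}`, an iterated commutator of `e i, …, e (i + d)`. -/
def posRoot (e : ℕ → L) (i : ℕ) : ℕ → L
  | 0 => e i
  | d + 1 => ⁅posRoot e i d, e (i + 1 + d)⁆

theorem posRoot_zero (e : ℕ → L) (i : ℕ) : posRoot e i 0 = e i := rfl

theorem posRoot_succ (e : ℕ → L) (i d : ℕ) :
    posRoot e i (d + 1) = ⁅posRoot e i d, e (i + 1 + d)⁆ := rfl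

namespace IsChevalleyFamily

variable {n : ℕ} {e f h : ℕ → L}

theorem involution (H : IsChevalleyFamily n e f h) :
    IsChevalleyFamily n (fun i ↦ -f i) (fun i ↦ -e i) (fun i ↦ -h i) where
  lie_h_h i j := by simp [H.lie_h_h]
  lie_h_e i j := by simp only [neg_lie, lie_neg, neg_neg, H.lie_h_f]; split_ifs <;> simp
  lie_h_f i j := by simp only [neg_lie, lie_neg, neg_neg, H.lie_h_e]; split_ifs <;> simp
  lie_e_f_of_ne i j hij := by
    simpa using lie_eq_zero_symm.mp (H.lie_e_f_of_ne j i hij.symm)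
  lie_e_f_self i hi := by
    simp only [neg_lie, lie_neg, neg_neg]; rw [← lie_skew, H.lie_e_f_self i hi]; abel
  lie_e_e i j hij := by simp [H.lie_f_f i j hij]
  lie_f_f i j hij := by simp [H.lie_e_e i j hij]
  serre_e_succ i := by simp [H.serre_f_succ]
  serre_e_pred i := by simp [H.serre_f_pred]
  serre_f_succ i := by simp [H.serre_e_succ]
  serre_f_pred i := by simp [H.serre_e_pred]

variable (H : IsChevalleyFamily n e f h)
include H

theorem lie_e_e_of_far {i j : ℕ} (hij : i + 1 < j ∨ j + 1 < i) : ⁅e i, e j⁆ = 0 :=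
  hij.elim (H.lie_e_e i j) fun hji ↦ lie_eq_zero_symm.mp (H.lie_e_e j i hji)

theorem lie_f_e_of_ne {i j : ℕ} (hij : i ≠ j) : ⁅f i, e j⁆ = 0 :=
  lie_eq_zero_symm.mp (H.lie_e_f_of_ne j i hij.symm)

theorem lie_f_e_self {i : ℕ} (hi : i + 1 < n) : ⁅f i, e i⁆ = h (i + 1) - h i := by
  rw [← lie_skew, H.lie_e_f_self i hi, neg_sub]

theorem lie_e_posRoot_of_far {k i d : ℕ} (hk : k + 1 < i ∨ i + 1 + d < k) :
    ⁅e k, posRoot e i d⁆ = 0 := by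
  induction d with
  | zero => exact H.lie_e_e_of_far (by omega)
  | succ d ih =>
    rw [posRoot_succ, leibniz_lie, ih (by omega), H.lie_e_e_of_far (i := k) (by omega), zero_lie,
      lie_zero, add_zero]

theorem lie_e_posRoot_succ (i d : ℕ) : ⁅e i, posRoot e (i + 1) d⁆ = posRoot e i (d + 1) := by
  induction d with
  | zero => rfl
  | succ d ih =>
    rw [posRoot_succ, leibniz_lie, ih, H.lie_e_e_of_far (i := i) (by omega), lie_zero, add_zero,
      posRoot_succ e i (d + 1), show i + 1 + 1 + d = i + 1 + (d + 1) by omega]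

theorem lie_e_posRoot_first (i d : ℕ) : ⁅e i, posRoot e i d⁆ = 0 := by
  match d with
  | 0 => exact lie_self _
  | 1 => exact H.serre_e_succ i
  | d + 2 =>
    rw [posRoot_succ, leibniz_lie, lie_e_posRoot_first i (d + 1),
      H.lie_e_e_of_far (i := i) (by omega), zero_lie, lie_zero, add_zero]

theorem lie_e_posRoot_last (i d : ℕ) : ⁅e (i + d), posRoot e i d⁆ = 0 := by
  match d with
  | 0 => exact lie_self _
  | 1 =>
    rw [posRoot_succ, posRoot_zero, ← lie_skew (e i), lie_neg, neg_eq_zero]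
    exact H.serre_e_pred i
  | d + 2 =>
    have ih := lie_e_posRoot_last (i + 1) (d + 1)
    rw [show i + 1 + (d + 1) = i + (d + 2) by omega] at ih
    rw [← H.lie_e_posRoot_succ, leibniz_lie, ih, H.lie_e_e_of_far (by omega), zero_lie, lie_zero,
      add_zero]

theorem lie_e_posRoot_penultimate (h2 : IsSMulRegular L 2) (i d : ℕ) :
    ⁅e (i + 1 + d), posRoot e i (d + 2)⁆ = 0 := by
  refine lie_lie_lie_eq_zero_of_serre h2 ?_ ?_ (H.serre_e_succ (i + 1 + d))
  · exact lie_eq_zero_symm.mp (H.lie_e_posRoot_of_far (by omega))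
  · simpa only [posRoot_succ, show i + (d + 1) = i + 1 + d by omega] using
      H.lie_e_posRoot_last i (d + 1)

theorem lie_e_posRoot_of_mem (h2 : IsSMulRegular L 2) {k i d : ℕ} (hik : i ≤ k) (hkd : k ≤ i + d) :
    ⁅e k, posRoot e i d⁆ = 0 := by
  induction d with
  | zero =>
    obtain rfl : k = i := by omega
    exact H.lie_e_posRoot_first _ _
  | succ d ih =>
    obtain rfl | first := eq_or_lt_of_le hik
    · exact H.lie_e_posRoot_first _ _
    obtain rfl | last := eq_or_lt_of_le hkd
    · exact H.lie_e_posRoot_last _ _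
    by_cases penultimate : k = i + d
    · obtain ⟨m, rfl⟩ : ∃ m, d = m + 1 := ⟨d - 1, by omega⟩
      obtain rfl : k = i + 1 + m := by omega
      exact H.lie_e_posRoot_penultimate h2 i m
    · rw [posRoot_succ, leibniz_lie, ih (by omega), H.lie_e_e_of_far (i := k) (by omega), zero_lie,
        lie_zero, add_zero]

theorem lie_e_posRoot (h2 : IsSMulRegular L 2) (k i d : ℕ) : ⁅e k, posRoot e i d⁆ =
    (if k + 1 = i then posRoot e k (d + 1) else 0) -
      (if i + 1 + d = k then posRoot e i (d + 1) else 0) := by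
  by_cases before : k + 1 = i
  · subst before
    rw [H.lie_e_posRoot_succ, if_pos rfl, if_neg (by omega), sub_zero]
  by_cases after : i + 1 + d = k
  · subst after
    rw [if_neg before, if_pos rfl, posRoot_succ, ← lie_skew, zero_sub]
  rw [if_neg before, if_neg after, sub_zero]
  by_cases inside : i ≤ k ∧ k ≤ i + d
  · exact H.lie_e_posRoot_of_mem h2 inside.1 inside.2
  · exact H.lie_e_posRoot_of_far (by omega)

theorem lie_h_posRoot (k i d : ℕ) : ⁅h k, posRoot e i d⁆ =
    (if k = i then posRoot e i d else 0) - (if k = i + 1 + d then posRoot e i d else 0) := by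
  induction d with
  | zero => exact H.lie_h_e k i
  | succ d ih =>
    rw [posRoot_succ, leibniz_lie, ih, H.lie_h_e]
    split_ifs <;> first | omega | simp only [zero_sub, sub_zero, sub_self, neg_lie, zero_lie,
      lie_zero, lie_neg, add_zero, zero_add]
    rw [← lie_skew, neg_add_cancel]

theorem lie_f_posRoot_one {k i : ℕ} (hk : k + 1 < n) : ⁅f k, posRoot e i 1⁆ =
    (if k = i then e (i + 1) else 0) - (if k = i + 1 then e i else 0) := by
  rw [posRoot_succ, posRoot_zero, Nat.add_zero, leibniz_lie]
  obtain rfl | first := eq_or_ne k i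
  · rw [H.lie_f_e_self hk, H.lie_f_e_of_ne (by omega), sub_lie, H.lie_h_e, H.lie_h_e]; simp; omega
  obtain rfl | last := eq_or_ne k (i + 1)
  · rw [H.lie_f_e_of_ne first, H.lie_f_e_self hk, lie_sub, ← lie_skew (e i), ← lie_skew (e i),
      H.lie_h_e, H.lie_h_e]
    simp; omega
  · simp [H.lie_f_e_of_ne first, H.lie_f_e_of_ne last, first, last]

theorem lie_f_posRoot_succ {k : ℕ} (i d : ℕ) (hk : k + 1 < n) : ⁅f k, posRoot e i (d + 1)⁆ =
    (if k = i then posRoot e (i + 1) d else 0) - (if k = i + 1 + d then posRoot e i d else 0) := by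
  induction d with
  | zero => exact H.lie_f_posRoot_one hk
  | succ d ih =>
    rw [posRoot_succ, leibniz_lie, ih]
    obtain rfl | first := eq_or_ne k i
    · rw [H.lie_f_e_of_ne (by omega), if_pos rfl, if_pos rfl, if_neg (by omega), if_neg (by omega)]
      simp [posRoot_succ, show k + 1 + 1 + d = k + 1 + (d + 1) by omega]
    rw [if_neg first, if_neg first]
    obtain penultimate | penultimate := eq_or_ne k (i + 1 + d)
    · rw [H.lie_f_e_of_ne (by omega), if_pos penultimate, if_neg (by omega), zero_sub, neg_lie,
        ← lie_skew, H.lie_e_posRoot_of_far (by omega)]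
      simp
    rw [if_neg penultimate]
    obtain rfl | last := eq_or_ne k (i + 1 + (d + 1))
    · rw [H.lie_f_e_self hk, ← lie_skew (posRoot e i (d + 1)), sub_lie _ _ (posRoot e i (d + 1)),
        H.lie_h_posRoot, H.lie_h_posRoot, if_neg (by omega), if_neg (by omega),
        if_neg (by omega), if_pos (by omega)]
      simp
    · simp [H.lie_f_e_of_ne last, last]

end IsChevalleyFamily

/-- The matrix unit `e_{i,j}` of `gl_n`, built from Chevalley generators. -/
def glRoot (e f h : ℕ → L) (i j : ℕ) : L :=
  if i < j then posRoot e i (j - i - 1) else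
    if i = j then h i else -posRoot (fun k ↦ -f k) j (i - j - 1)

theorem exists_eq_add_one_add {i j : ℕ} (hij : i < j) : ∃ d, j = i + 1 + d :=
  ⟨j - i - 1, by omega⟩

section glRoot

variable (e f h : ℕ → L)

theorem glRoot_of_lt (i d : ℕ) : glRoot e f h i (i + 1 + d) = posRoot e i d := by
  rw [glRoot, if_pos (by omega), show i + 1 + d - i - 1 = d by omega]

theorem glRoot_self (i : ℕ) : glRoot e f h i i = h i := by simp [glRoot]

theorem glRoot_of_gt (j d : ℕ) : glRoot e f h (j + 1 + d) j = -posRoot (fun k ↦ -f k) j d := by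
  rw [glRoot, if_neg (by omega), if_neg (by omega), show j + 1 + d - j - 1 = d by omega]

theorem glRoot_succ_right (i : ℕ) : glRoot e f h i (i + 1) = e i :=
  glRoot_of_lt e f h i 0

theorem glRoot_succ_left (i : ℕ) : glRoot e f h (i + 1) i = f i :=
  (glRoot_of_gt e f h i 0).trans (neg_neg _)

theorem glRoot_involution (i j : ℕ) :
    glRoot (fun k ↦ -f k) (fun k ↦ -e k) (fun k ↦ -h k) i j = -glRoot e f h j i := by
  obtain hij | rfl | hij := lt_trichotomy i j
  · obtain ⟨d, rfl⟩ := exists_eq_add_one_add hij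
    rw [glRoot_of_lt, glRoot_of_gt, neg_neg]
  · rw [glRoot_self, glRoot_self]
  · obtain ⟨d, rfl⟩ := exists_eq_add_one_add hij
    simp only [glRoot_of_lt, glRoot_of_gt, neg_neg]

end glRoot

section ActsAsUnit

variable {ι : Type*} [DecidableEq ι] {x y : L} {a b c : ι} {M : ι → ι → L}

/-- The element `x` acts on the family `M` as the matrix unit `e_{a,b}` acts on matrix units:
`⁅e_{a,b}, e_{i,j}⁆ = δ_{b,i} e_{a,j} - δ_{j,a} e_{i,b}`. -/
def ActsAsUnit (x : L) (a b : ι) (M : ι → ι → L) : Prop :=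
  ∀ i j, ⁅x, M i j⁆ = (if b = i then M a j else 0) - (if j = a then M i b else 0)

theorem ActsAsUnit.lie (hx : ActsAsUnit x a b M) (hy : ActsAsUnit y b c M) (hac : a ≠ c) :
    ActsAsUnit ⁅x, y⁆ a c M := by
  intro i j
  rw [lie_lie, hy i j, hx i j]
  simp only [lie_sub, lie_ite_zero, hx _ _, hy _ _, if_neg hac.symm, if_true]
  split_ifs <;> abel

theorem ActsAsUnit.neg_transpose (hx : ActsAsUnit x a b M) :
    ActsAsUnit (-x) b a (fun i j ↦ -M j i) := by
  intro i j
  rw [neg_lie, lie_neg, neg_neg, hx j i]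
  simp only [eq_comm (a := a), eq_comm (a := j)]
  split_ifs <;> abel

end ActsAsUnit

theorem actsAsUnit_posRoot {n : ℕ} {e : ℕ → L} {M : Fin n → Fin n → L}
    (he : ∀ k (hk : k + 1 < n), ActsAsUnit (e k) ⟨k, by omega⟩ ⟨k + 1, hk⟩ M) (a d : ℕ)
    (had : a + 1 + d < n) :
    ActsAsUnit (posRoot e a d) ⟨a, by omega⟩ ⟨a + 1 + d, had⟩ M := by
  induction d with
  | zero => exact he a had
  | succ d ih =>
    exact (ih (by omega)).lie (he (a + 1 + d) (by omega)) (by rw [Ne, Fin.mk.injEq]; omega)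

theorem actsAsUnit_glRoot {n : ℕ} {e f h : ℕ → L} {M : Fin n → Fin n → L}
    (he : ∀ k (hk : k + 1 < n), ActsAsUnit (e k) ⟨k, by omega⟩ ⟨k + 1, hk⟩ M)
    (hf : ∀ k (hk : k + 1 < n), ActsAsUnit (f k) ⟨k + 1, hk⟩ ⟨k, by omega⟩ M)
    (hh : ∀ k : Fin n, ActsAsUnit (h k) k k M) (a b : Fin n) :
    ActsAsUnit (glRoot e f h a b) a b M := by
  obtain ⟨a, ha⟩ := a
  obtain ⟨b, hb⟩ := b
  obtain hab | rfl | hab := lt_trichotomy a b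
  · obtain ⟨d, rfl⟩ := exists_eq_add_one_add hab
    exact glRoot_of_lt e f h a d ▸ actsAsUnit_posRoot he a d hb
  · exact glRoot_self e f h a ▸ hh ⟨a, ha⟩
  · obtain ⟨d, rfl⟩ := exists_eq_add_one_add hab
    have transposed := (actsAsUnit_posRoot (e := fun k ↦ -f k)
      (fun k hk ↦ (hf k hk).neg_transpose) b d ha).neg_transpose
    simpa only [glRoot_of_gt, neg_neg] using transposed

namespace IsChevalleyFamily

variable {n : ℕ} {e f h : ℕ → L} (H : IsChevalleyFamily n e f h)
include H

theorem lie_e_negRoot {k : ℕ} (j d : ℕ) (hk : k + 1 < n) : ⁅e k, glRoot e f h (j + 1 + d) j⁆ =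
    (if k + 1 = j + 1 + d then glRoot e f h k j else 0) -
      (if j = k then glRoot e f h (j + 1 + d) (k + 1) else 0) := by
  rw [glRoot_of_gt]
  obtain _ | d := d
  · rw [posRoot_zero, neg_neg]
    obtain rfl | hkj := eq_or_ne k j
    · rw [H.lie_e_f_self k hk]; simp [glRoot_self]
    · rw [H.lie_e_f_of_ne k j hkj]; simp [hkj, hkj.symm]
  have lie_posRoot := H.involution.lie_f_posRoot_succ j d hk
  rw [neg_lie] at lie_posRoot
  rw [lie_neg, lie_posRoot, show j + 1 + (d + 1) = j + 1 + 1 + d by omega]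
  obtain rfl | hkj := eq_or_ne k j
  · rw [if_pos rfl, if_neg (by omega), if_neg (by omega), if_pos rfl, glRoot_of_gt]; simp
  rw [if_neg hkj, if_neg hkj.symm]
  by_cases last : k = j + 1 + d
  · subst last
    rw [if_pos rfl, if_pos (by omega), glRoot_of_gt]; simp
  · rw [if_neg last, if_neg (by omega)]

theorem lie_e_glRoot (h2 : IsSMulRegular L 2) {k : ℕ} (i j : ℕ) (hk : k + 1 < n) :
    ⁅e k, glRoot e f h i j⁆ =
      (if k + 1 = i then glRoot e f h k j else 0) -
        (if j = k then glRoot e f h i (k + 1) else 0) := by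
  obtain hij | rfl | hij := lt_trichotomy i j
  · obtain ⟨d, rfl⟩ := exists_eq_add_one_add hij
    rw [glRoot_of_lt, H.lie_e_posRoot h2]
    congr 1
    · refine ite_congr rfl (fun hki ↦ ?_) fun _ ↦ rfl
      rw [← hki, show k + 1 + 1 + d = k + 1 + (d + 1) by omega, glRoot_of_lt]
    · refine ite_congr rfl (fun hki ↦ ?_) fun _ ↦ rfl
      rw [← hki, show i + 1 + d + 1 = i + 1 + (d + 1) by omega, glRoot_of_lt]
  · rw [glRoot_self, ← lie_skew, H.lie_h_e]
    obtain rfl | hik := eq_or_ne i k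
    · simp [glRoot_succ_right]
    obtain rfl | hik' := eq_or_ne i (k + 1)
    · simp [glRoot_succ_right]
    · simp [hik, hik', hik'.symm]
  · obtain ⟨d, rfl⟩ := exists_eq_add_one_add hij
    exact H.lie_e_negRoot j d hk

theorem lie_f_glRoot (h2 : IsSMulRegular L 2) {k : ℕ} (i j : ℕ) (hk : k + 1 < n) :
    ⁅f k, glRoot e f h i j⁆ =
      (if k = i then glRoot e f h (k + 1) j else 0) -
        (if j = k + 1 then glRoot e f h i k else 0) := by
  have lie_neg_f := H.involution.lie_e_glRoot h2 j i hk
  simp only [glRoot_involution, neg_lie, lie_neg, neg_neg] at lie_neg_f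
  rw [lie_neg_f]
  simp only [eq_comm (a := k), eq_comm (a := k + 1)]
  split_ifs <;> abel

theorem lie_h_glRoot_of_lt (k i d : ℕ) : ⁅h k, glRoot e f h i (i + 1 + d)⁆ =
    (if k = i then glRoot e f h i (i + 1 + d) else 0) -
      (if k = i + 1 + d then glRoot e f h i (i + 1 + d) else 0) := by
  rw [glRoot_of_lt, H.lie_h_posRoot]

theorem lie_h_glRoot (k i j : ℕ) : ⁅h k, glRoot e f h i j⁆ =
    (if k = i then glRoot e f h k j else 0) - (if j = k then glRoot e f h i k else 0) := by
  obtain hij | rfl | hij := lt_trichotomy i j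
  · obtain ⟨d, rfl⟩ := exists_eq_add_one_add hij
    rw [H.lie_h_glRoot_of_lt]
    exact congrArg₂ _ (ite_congr rfl (fun hk ↦ by rw [hk]) fun _ ↦ rfl)
      (ite_congr (propext eq_comm) (fun hk ↦ by rw [hk]) fun _ ↦ rfl)
  · rw [glRoot_self, H.lie_h_h]
    split_ifs <;> first | omega | simp_all
  · obtain ⟨d, rfl⟩ := exists_eq_add_one_add hij
    have lie_neg_h := H.involution.lie_h_glRoot_of_lt k j d
    simp only [glRoot_involution, neg_lie, lie_neg, neg_neg] at lie_neg_h
    rw [lie_neg_h]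
    obtain rfl | hkj := eq_or_ne k j
    · rw [if_pos rfl, if_pos rfl, if_neg hij.ne, if_neg hij.ne]; abel
    obtain rfl | hkd := eq_or_ne k (j + 1 + d)
    · rw [if_neg hkj, if_neg hkj.symm, if_pos rfl, if_pos rfl]; abel
    · simp [hkj, hkd, hkj.symm]

theorem actsAsUnit_glRoot (h2 : IsSMulRegular L 2) (a b : Fin n) :
    ActsAsUnit (glRoot e f h a b) a b (fun i j : Fin n ↦ glRoot e f h i j) := by
  apply YangianGL.actsAsUnit_glRoot
  · intro k hk i j; simpa [Fin.ext_iff] using H.lie_e_glRoot h2 i j hk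
  · intro k hk i j; simpa [Fin.ext_iff] using H.lie_f_glRoot h2 i j hk
  · intro k i j; simpa [Fin.ext_iff] using H.lie_h_glRoot k i j

end IsChevalleyFamily

end LieRing

/-! ### The adjoint family generated by one element -/

section AdjointFamily

variable {L : Type*} [LieRing L] {ι : Type*} [DecidableEq ι]

/-- Invariance of `D` under the Levi subalgebra `gl_1 × gl_{n-1}` of `gl_n` that is singled out by
the index `o`. -/
structure IsLeviInvariant (g : ι → ι → L) (o : ι) (D : L) : Prop where
  corner : ⁅g o o, D⁆ = 0
  block : ∀ a b, a ≠ o → b ≠ o → ⁅g a b, D⁆ = 0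

/-- The image of the matrix units under the `gl_n`-equivariant map that sends the matrix unit at
`(o, o)` to `D`. -/
def adjFamily (g : ι → ι → L) (o : ι) (D : L) (i j : ι) : L :=
  if i = o then (if j = o then D else ⁅D, g o j⁆)
  else if j = o then ⁅g i o, D⁆ else ⁅g i o, ⁅D, g o j⁆⁆ + if i = j then D else 0

section

variable (g : ι → ι → L) (o : ι) (D : L)

theorem adjFamily_self_self : adjFamily g o D o o = D := by simp [adjFamily]

theorem adjFamily_self_left {j : ι} (hj : j ≠ o) : adjFamily g o D o j = ⁅D, g o j⁆ := by
  simp [adjFamily, hj]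

theorem adjFamily_self_right {i : ι} (hi : i ≠ o) : adjFamily g o D i o = ⁅g i o, D⁆ := by
  simp [adjFamily, hi]

theorem adjFamily_of_ne {i j : ι} (hi : i ≠ o) (hj : j ≠ o) :
    adjFamily g o D i j = ⁅g i o, ⁅D, g o j⁆⁆ + if i = j then D else 0 := by
  simp [adjFamily, hi, hj]

end

theorem neg_lie_neg_lie_neg (x y z : L) : ⁅-x, ⁅-z, -y⁆⁆ = ⁅x, ⁅y, z⁆⁆ := by
  rw [← lie_skew y, lie_neg, neg_lie, lie_neg, neg_lie, lie_neg, neg_neg]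

namespace IsLeviInvariant

variable {g : ι → ι → L} {o : ι} {D : L}

omit [DecidableEq ι] in
theorem neg_transpose (hD : IsLeviInvariant g o D) :
    IsLeviInvariant (fun i j ↦ -g j i) o (-D) where
  corner := by simp [hD.corner]
  block a b ha hb := by simp [hD.block b a hb ha]

variable (hg : ∀ a b, ActsAsUnit (g a b) a b g) (hD : IsLeviInvariant g o D)
include hg hD

theorem lie_corner_row {c : ι} (hc : c ≠ o) : ⁅g o o, ⁅D, g o c⁆⁆ = ⁅D, g o c⁆ := by
  rw [leibniz_lie, hD.corner, hg o o]; simp [hc]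

theorem lie_corner_column {c : ι} (hc : c ≠ o) : ⁅g o o, ⁅g c o, D⁆⁆ = -⁅g c o, D⁆ := by
  rw [leibniz_lie, hD.corner, hg o o]; simp [hc.symm]

theorem lie_block_row {a b c : ι} (ha : a ≠ o) (hb : b ≠ o) :
    ⁅g a b, ⁅D, g o c⁆⁆ = -if c = a then ⁅D, g o b⁆ else 0 := by
  rw [leibniz_lie, hD.block a b ha hb, hg a b]
  split_ifs <;> simp_all

theorem lie_block_column {a b c : ι} (ha : a ≠ o) (hb : b ≠ o) :
    ⁅g a b, ⁅g c o, D⁆⁆ = if b = c then ⁅g a o, D⁆ else 0 := by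
  rw [leibniz_lie, hD.block a b ha hb, hg a b]
  split_ifs <;> simp_all

theorem lie_lie_row_eq_lie_column_lie {i j : ι} (hi : i ≠ o) (hj : j ≠ o) :
    ⁅g i o, ⁅D, g o j⁆⁆ = ⁅⁅g i o, D⁆, g o j⁆ := by
  have invariant : ⁅D, ⁅g i o, g o j⁆⁆ = 0 := by
    rw [hg i o, if_pos rfl, lie_sub, ← lie_skew, hD.block i j hi hj, lie_ite_zero, ← lie_skew,
      hD.corner]
    simp
  rw [leibniz_lie, invariant, add_zero]

theorem adjFamily_neg_transpose (i j : ι) :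
    adjFamily (fun i j ↦ -g j i) o (-D) i j = -adjFamily g o D j i := by
  by_cases hi : i = o <;> by_cases hj : j = o
  · simp [adjFamily, hi, hj]
  · simp [adjFamily, hi, hj]
  · simp [adjFamily, hi, hj]
  · rw [adjFamily_of_ne _ _ _ hi hj, adjFamily_of_ne _ _ _ hj hi,
      hD.lie_lie_row_eq_lie_column_lie hg hj hi, neg_lie_neg_lie_neg, ← lie_skew ⁅g j o, D⁆]
    simp only [eq_comm (a := j)]
    split_ifs <;> abel

omit hD in
theorem lie_row_row_comm {b c : ι} (hb : b ≠ o) (hc : c ≠ o) :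
    ⁅g o b, ⁅D, g o c⁆⁆ = ⁅g o c, ⁅D, g o b⁆⁆ := by
  have commute : ⁅g o b, g o c⁆ = 0 := by simp [hg o b _ _, hb, hc]
  rw [← lie_skew D, lie_neg, leibniz_lie, commute, zero_lie, zero_add, ← lie_neg, lie_skew]

theorem lie_block_row_row {a b c d : ι} (ha : a ≠ o) (hb : b ≠ o) :
    ⁅g a b, ⁅g o c, ⁅D, g o d⁆⁆⁆ = -(if c = a then ⁅g o b, ⁅D, g o d⁆⁆ else 0) -
      (if d = a then ⁅g o c, ⁅D, g o b⁆⁆ else 0) := by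
  rw [leibniz_lie, hD.lie_block_row hg ha hb, hg a b, if_neg hb]
  split_ifs <;> simp only [neg_lie, zero_lie, lie_neg, lie_zero, neg_zero, zero_add, add_zero,
    sub_eq_add_neg]

theorem lie_row_row_eq_zero (h2 : IsSMulRegular L 2) {p : ι} (hp : p ≠ o)
    (hpp : ⁅g o p, ⁅D, g o p⁆⁆ = 0) {b c : ι} (hb : b ≠ o) (hc : c ≠ o) :
    ⁅g o b, ⁅D, g o c⁆⁆ = 0 := by
  have row_p : ∀ c, c ≠ o → ⁅g o p, ⁅D, g o c⁆⁆ = 0 := by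
    intro c hc
    have act := hD.lie_block_row_row hg (c := p) (d := p) hp hc
    rw [hpp, lie_zero, if_pos rfl, if_pos rfl, lie_row_row_comm hg hc hp, ← neg_add',
      ← two_nsmul, eq_comm, neg_eq_zero] at act
    exact h2.right_eq_zero_of_smul act
  obtain rfl | hcp := eq_or_ne c p
  · rw [lie_row_row_comm hg hb hc, row_p b hb]
  · have act := hD.lie_block_row_row hg (c := p) (d := c) hp hb
    rw [row_p c hc, lie_zero, if_pos rfl, if_neg hcp, sub_zero] at act
    exact neg_eq_zero.mp act.symm

theorem actsAsUnit_adjFamily_corner : ActsAsUnit (g o o) o o (adjFamily g o D) := by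
  intro i j
  by_cases hi : i = o <;> by_cases hj : j = o
  · simp [hi, hj, adjFamily_self_self, hD.corner]
  · rw [hi, adjFamily_self_left _ _ _ hj, hD.lie_corner_row hg hj]; simp [hj]
  · rw [hj, adjFamily_self_right _ _ _ hi, hD.lie_corner_column hg hi]; simp [Ne.symm hi]
  · rw [adjFamily_of_ne _ _ _ hi hj, lie_add, leibniz_lie, hD.lie_corner_row hg hj, hg o o,
      lie_ite_zero, hD.corner, ite_self, add_zero, if_pos rfl, if_neg (Ne.symm hi), zero_sub,
      neg_lie, neg_add_cancel, if_neg hj, if_neg (Ne.symm hi), sub_zero]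

theorem actsAsUnit_adjFamily_block {a b : ι} (ha : a ≠ o) (hb : b ≠ o) :
    ActsAsUnit (g a b) a b (adjFamily g o D) := by
  intro i j
  by_cases hi : i = o <;> by_cases hj : j = o
  · simp [hi, hj, adjFamily_self_self, hD.block a b ha hb, hb, Ne.symm ha]
  · rw [hi, adjFamily_self_left _ _ _ hj, hD.lie_block_row hg ha hb, adjFamily_self_left _ _ _ hb]
    simp [hb]
  · rw [hj, adjFamily_self_right _ _ _ hi, hD.lie_block_column hg ha hb,
      adjFamily_self_right _ _ _ ha]
    simp [Ne.symm ha]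
  · rw [adjFamily_of_ne _ _ _ hi hj, lie_add, leibniz_lie, hD.lie_block_row hg ha hb, hg a b,
      lie_ite_zero, hD.block a b ha hb, adjFamily_of_ne _ _ _ ha hj, adjFamily_of_ne _ _ _ hi hb]
    simp only [if_neg ha.symm, ite_self, add_zero, sub_zero, eq_comm (a := i), eq_comm (a := a)]
    split_ifs <;> simp only [zero_sub, sub_zero, zero_lie, lie_neg, lie_zero, neg_zero,
      zero_add, add_zero]; abel

theorem actsAsUnit_adjFamily_row (row : ∀ b c, b ≠ o → c ≠ o → ⁅g o b, ⁅D, g o c⁆⁆ = 0) {b : ι}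
    (hb : b ≠ o) : ActsAsUnit (g o b) o b (adjFamily g o D) := by
  intro i j
  by_cases hi : i = o <;> by_cases hj : j = o
  · rw [hi, hj, adjFamily_self_self, adjFamily_self_left _ _ _ hb, ← lie_skew]; simp [hb]
  · rw [hi, adjFamily_self_left _ _ _ hj, row b j hb hj]; simp [hj, hb]
  · have split : ⁅⁅g o b, g i o⁆, D⁆ = 0 := by
      rw [hg o b, if_pos rfl, sub_lie, hD.block i b hi hb]; split_ifs <;> simp [hD.corner]
    rw [hj, adjFamily_self_right _ _ _ hi, leibniz_lie, split, ← lie_skew (g o b) D, lie_neg,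
      adjFamily_of_ne _ _ _ hi hb, adjFamily_self_self, if_pos rfl]
    simp only [eq_comm (a := b)]
    abel
  · have split : ⁅⁅g o b, g i o⁆, ⁅D, g o j⁆⁆ =
        (if b = i then ⁅D, g o j⁆ else 0) + if j = i then ⁅D, g o b⁆ else 0 := by
      rw [hg o b, if_pos rfl, sub_lie, hD.lie_block_row hg hi hb, sub_neg_eq_add]
      split_ifs <;> simp [hD.lie_corner_row hg hj]
    rw [adjFamily_of_ne _ _ _ hi hj, lie_add, leibniz_lie, split, row b j hb hj, lie_zero, add_zero,
      lie_ite_zero, ← lie_skew (g o b) D, adjFamily_self_left _ _ _ hj, if_neg hj]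
    simp only [eq_comm (a := j)]
    split_ifs <;> abel

theorem actsAsUnit_adjFamily (row : ∀ b c, b ≠ o → c ≠ o → ⁅g o b, ⁅D, g o c⁆⁆ = 0)
    (column : ∀ b c, b ≠ o → c ≠ o → ⁅g b o, ⁅g c o, D⁆⁆ = 0) (a b : ι) :
    ActsAsUnit (g a b) a b (adjFamily g o D) := by
  by_cases ha : a = o <;> by_cases hb : b = o
  · rw [ha, hb]; exact hD.actsAsUnit_adjFamily_corner hg
  · rw [ha]; exact hD.actsAsUnit_adjFamily_row hg row hb
  · have transposed := (hD.neg_transpose.actsAsUnit_adjFamily_row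
      (fun a b ↦ (hg b a).neg_transpose)
      (fun b c hb hc ↦ (neg_lie_neg_lie_neg _ _ _).trans (column b c hb hc)) ha).neg_transpose
    simpa only [hD.adjFamily_neg_transpose hg, neg_neg, hb] using transposed
  · exact hD.actsAsUnit_adjFamily_block hg ha hb

theorem actsAsUnit_adjFamily_of_serre (h2 : IsSMulRegular L 2) {p : ι} (hp : p ≠ o)
    (row : ⁅g o p, ⁅D, g o p⁆⁆ = 0) (column : ⁅g p o, ⁅g p o, D⁆⁆ = 0) (a b : ι) :
    ActsAsUnit (g a b) a b (adjFamily g o D) := by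
  refine hD.actsAsUnit_adjFamily hg (fun b c ↦ hD.lie_row_row_eq_zero hg h2 hp row) ?_ a b
  intro b c hb hc
  rw [← neg_lie_neg_lie_neg] at column ⊢
  exact hD.neg_transpose.lie_row_row_eq_zero (fun a b ↦ (hg b a).neg_transpose) h2 hp column hb hc

end IsLeviInvariant

end AdjointFamily

/-! ### The RTT relations in components -/

section Components

attribute [local instance] LieRing.ofAssociativeRing

variable {A : Type*} [Ring A] {ι : Type*} [DecidableEq ι]

/-- The defining relations of the Yangian, for coefficients `T i j r` of `u⁻ʳ`. -/
structure IsRTT (T : ι → ι → ℕ → A) : Prop where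
  zero : ∀ i j, T i j 0 = if i = j then 1 else 0
  rel : ∀ i j k l r s, ⁅T i j (r + 1), T k l s⁆ - ⁅T i j r, T k l (s + 1)⁆ =
    T k j r * T i l s - T k j s * T i l r

/-- The difference of the two sides of an RTT relation. -/
def rttDefect (T : ι → ι → ℕ → A) (r s : ℕ) (i j k l : ι) : A :=
  ⁅T i j (r + 1), T k l s⁆ - ⁅T i j r, T k l (s + 1)⁆ - (T k j r * T i l s - T k j s * T i l r)

theorem lie_mul_eq (x y z : A) : ⁅x, y * z⁆ = ⁅x, y⁆ * z + y * ⁅x, z⁆ := by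
  simp only [Ring.lie_def]; noncomm_ring

theorem lie_rttDefect {T : ι → ι → ℕ → A} {x : A} {a b : ι}
    (hx : ∀ r, ActsAsUnit x a b (fun i j ↦ T i j r)) (r s : ℕ) (i j k l : ι) :
    ⁅x, rttDefect T r s i j k l⁆ =
      (if b = i then rttDefect T r s a j k l else 0) -
        (if j = a then rttDefect T r s i b k l else 0) +
      (if b = k then rttDefect T r s i j a l else 0) -
        (if l = a then rttDefect T r s i j k b else 0) := by
  have act : ∀ r i j, ⁅x, T i j r⁆ = (if b = i then T a j r else 0) - (if j = a then T i b r else 0)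
    := hx
  simp only [rttDefect, Ring.lie_def (T _ _ _) (T _ _ _), lie_sub, lie_mul_eq, act]
  split_ifs <;> noncomm_ring

/-- Closure of the zero set of a 4-tensor under the action of the matrix units of `gl_n`. -/
def IsUnitStable (X : ι → ι → ι → ι → A) : Prop :=
  ∀ a b i j k l, X i j k l = 0 →
    (if b = i then X a j k l else 0) - (if j = a then X i b k l else 0) +
      (if b = k then X i j a l else 0) - (if l = a then X i j k b else 0) = 0

theorem isUnitStable_rttDefect {T : ι → ι → ℕ → A} {g : ι → ι → A}
    (hg : ∀ a b r, ActsAsUnit (g a b) a b (fun i j ↦ T i j r)) (r s : ℕ) :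
    IsUnitStable (rttDefect T r s) := by
  intro a b i j k l hX
  rw [← lie_rttDefect (hg a b) r s i j k l, hX, lie_zero]

namespace IsUnitStable

variable {X : ι → ι → ι → ι → A} {o p : ι} (act : IsUnitStable X) (hp : p ≠ o)
include act

include hp in
theorem eq_zero_right (hoo : X o o o o = 0) (hop : X o o o p = 0) (c : ι) : X o o o c = 0 := by
  obtain rfl | _ := eq_or_ne c p
  · exact hop
  obtain rfl | hco := eq_or_ne c o
  · exact hoo
  · simpa [hp, hp.symm, hco, hco.symm] using act p c o o o p hop

include hp in
theorem eq_zero_right' (hpo : X o o p o = 0) (hpp : X o o p p = 0) (c : ι) : X o o p c = 0 := by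
  obtain rfl | hc := eq_or_ne c p
  · exact hpp
  obtain rfl | hco := eq_or_ne c o
  · exact hpo
  · simpa [hp, hp.symm, hc, hco] using act p c o o p p hpp

theorem eq_zero_columns (ho : ∀ c, X o o o c = 0) (b c : ι) : X o b o c = 0 := by
  obtain rfl | hb := eq_or_ne b o
  · exact ho c
  obtain rfl | hc := eq_or_ne c o
  · simpa [hb, ho] using act c b c c c c (ho c)
  · simpa [hb, hc] using act o b o o o c (ho c)

theorem eq_zero_columns' (ho : ∀ c, X o o o c = 0) (hpo : ∀ c, X o o p c = 0) (b c : ι) :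
    X o b p c = 0 := by
  obtain rfl | hb := eq_or_ne b o
  · exact hpo c
  obtain rfl | hc := eq_or_ne c o
  · simpa [hb, hpo, ho] using act c b c c p c (hpo c)
  · simpa [hb, hc, ho] using act o b o o p c (hpo c)

include hp in
theorem eq_zero (hoo : X o o o o = 0) (hop : X o o o p = 0) (hpo : X o o p o = 0)
    (hpp : X o o p p = 0) (i j k l : ι) : X i j k l = 0 := by
  have right := act.eq_zero_right hp hoo hop
  have columns := act.eq_zero_columns right
  have columns' := act.eq_zero_columns' right (act.eq_zero_right' hp hpo hpp)
  have first : ∀ j k l, X o j k l = 0 := by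
    intro j k l
    obtain rfl | _ := eq_or_ne k p
    · exact columns' j l
    obtain rfl | _ := eq_or_ne k o
    · exact columns j l
    · simpa [hp, columns'] using act k p o j p l (columns' j l)
  obtain rfl | hk := eq_or_ne k o
  · obtain rfl | _ := eq_or_ne i k
    · exact first j i l
    · simpa [first] using act i k k j k l (first j k l)
  · simpa [first, hk.symm] using act i o o j k l (first j k l)

end IsUnitStable

end Components

/-! ### Series in two variables -/

section TwoVariables

variable {A B : Type*} [Ring A] [Ring B]

/-- A series in `u⁻¹`, viewed in two variables. -/
def inU : PowerSeries A →+* PowerSeries (PowerSeries A) := PowerSeries.map PowerSeries.C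

/-- A series in `v⁻¹`, viewed in two variables. -/
def inV : PowerSeries A →+* PowerSeries (PowerSeries A) := PowerSeries.C

/-- The coefficient of `u⁻ʳ v⁻ˢ`. -/
def coeff₂ (r s : ℕ) (f : PowerSeries (PowerSeries A)) : A :=
  PowerSeries.coeff s (PowerSeries.coeff r f)

theorem ext₂ {f g : PowerSeries (PowerSeries A)} (h : ∀ r s, coeff₂ r s f = coeff₂ r s g) :
    f = g := by
  ext r s; exact h r s

@[simp] theorem coeff₂_sub (r s : ℕ) (f g : PowerSeries (PowerSeries A)) :
    coeff₂ r s (f - g) = coeff₂ r s f - coeff₂ r s g := by simp [coeff₂]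

@[simp] theorem coeff₂_zero (r s : ℕ) : coeff₂ r s (0 : PowerSeries (PowerSeries A)) = 0 := by
  simp [coeff₂]

@[simp] theorem coeff₂_inU_mul_inV (r s : ℕ) (f g : PowerSeries A) :
    coeff₂ r s (inU f * inV g) = PowerSeries.coeff r f * PowerSeries.coeff s g := by
  simp [coeff₂, inU, inV]

@[simp] theorem coeff₂_inV_mul_inU (r s : ℕ) (f g : PowerSeries A) :
    coeff₂ r s (inV g * inU f) = PowerSeries.coeff s g * PowerSeries.coeff r f := by
  simp [coeff₂, inU, inV]

theorem coeff₂_inU (r s : ℕ) (f : PowerSeries A) :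
    coeff₂ r s (inU f) = if s = 0 then PowerSeries.coeff r f else 0 := by
  simp [coeff₂, inU, PowerSeries.coeff_C]

theorem coeff₂_map (f : A →+* B) (r s : ℕ) (x : PowerSeries (PowerSeries A)) :
    coeff₂ r s (PowerSeries.map (PowerSeries.map f) x) = f (coeff₂ r s x) := by simp [coeff₂]

theorem map_inU (f : A →+* B) (x : PowerSeries A) :
    PowerSeries.map (PowerSeries.map f) (inU x) = inU (PowerSeries.map f x) := by
  ext r : 1; simp [inU]

theorem map_inV (f : A →+* B) (x : PowerSeries A) :
    PowerSeries.map (PowerSeries.map f) (inV x) = inV (PowerSeries.map f x) := by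
  simp [inV]

theorem map_uInv (f : A →+* B) :
    PowerSeries.map (PowerSeries.map f) (uInv A) = uInv B := by simp [uInv]

theorem map_vInv (f : A →+* B) :
    PowerSeries.map (PowerSeries.map f) (vInv A) = vInv B := by simp [vInv]

theorem uInv_mul_comm (f : PowerSeries (PowerSeries A)) : uInv A * f = f * uInv A :=
  PowerSeries.X_mul

theorem vInv_mul_comm (f : PowerSeries (PowerSeries A)) : vInv A * f = f * vInv A := by
  ext r : 1; simp [vInv, PowerSeries.X_mul]

theorem vInv_sub_uInv_mul_comm (f : PowerSeries (PowerSeries A)) :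
    (vInv A - uInv A) * f = f * (vInv A - uInv A) := by
  rw [sub_mul, mul_sub, uInv_mul_comm, vInv_mul_comm]

theorem uInv_mul_vInv_mul_comm (f : PowerSeries (PowerSeries A)) :
    uInv A * vInv A * f = f * (uInv A * vInv A) := by
  rw [mul_assoc, vInv_mul_comm, ← mul_assoc, uInv_mul_comm, mul_assoc, uInv_mul_comm]

@[simp] theorem coeff₂_uInv_mul_zero (s : ℕ) (f : PowerSeries (PowerSeries A)) :
    coeff₂ 0 s (uInv A * f) = 0 := by simp [coeff₂, uInv]

@[simp] theorem coeff₂_uInv_mul_succ (r s : ℕ) (f : PowerSeries (PowerSeries A)) :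
    coeff₂ (r + 1) s (uInv A * f) = coeff₂ r s f := by
  simp [coeff₂, uInv, PowerSeries.coeff_succ_X_mul]

@[simp] theorem coeff₂_vInv_mul_zero (r : ℕ) (f : PowerSeries (PowerSeries A)) :
    coeff₂ r 0 (vInv A * f) = 0 := by simp [coeff₂, vInv]

@[simp] theorem coeff₂_vInv_mul_succ (r s : ℕ) (f : PowerSeries (PowerSeries A)) :
    coeff₂ r (s + 1) (vInv A * f) = coeff₂ r s f := by
  simp [coeff₂, vInv, PowerSeries.coeff_succ_X_mul]

/-- The equation `(u - v) P = Q`, multiplied by `u⁻¹ v⁻¹`, in terms of coefficients. -/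
theorem vInv_sub_uInv_mul_eq_iff (P Q : PowerSeries (PowerSeries A)) :
    (vInv A - uInv A) * P = uInv A * vInv A * Q ↔
      (∀ s, coeff₂ 0 s P = 0) ∧ (∀ r, coeff₂ r 0 P = 0) ∧
        ∀ r s, coeff₂ (r + 1) s P - coeff₂ r (s + 1) P = coeff₂ r s Q := by
  constructor
  · intro h
    have coeff_eq : ∀ r s,
        coeff₂ r s ((vInv A - uInv A) * P) = coeff₂ r s (uInv A * vInv A * Q) := by simp [h]
    simp only [sub_mul, mul_assoc, coeff₂_sub] at coeff_eq
    refine ⟨fun s ↦ ?_, fun r ↦ ?_, fun r s ↦ ?_⟩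
    · simpa using coeff_eq 0 (s + 1)
    · simpa using coeff_eq (r + 1) 0
    · simpa using coeff_eq (r + 1) (s + 1)
  · rintro ⟨row_zero, column_zero, coeff_eq⟩
    refine ext₂ fun r s ↦ ?_
    simp only [sub_mul, mul_assoc, coeff₂_sub]
    rcases r with _ | r <;> rcases s with _ | s <;> simp [row_zero, column_zero, coeff_eq]

theorem eq_zero_of_vInv_sub_uInv_mul_eq_zero {P : PowerSeries (PowerSeries A)}
    (hP : (vInv A - uInv A) * P = 0) : P = 0 := by
  obtain ⟨row_zero, -, coeff_eq⟩ := (vInv_sub_uInv_mul_eq_iff P 0).mp (by rw [hP, mul_zero])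
  refine ext₂ fun r ↦ ?_
  induction r with
  | zero => simpa using row_zero
  | succ r ih => intro s; simpa [ih (s + 1)] using coeff_eq r s

theorem eq_zero_of_vInv_sub_uInv_mul_eq_self {P : PowerSeries (PowerSeries A)}
    (hP : (vInv A - uInv A) * P = uInv A * vInv A * P) : P = 0 := by
  obtain ⟨row_zero, -, coeff_eq⟩ := (vInv_sub_uInv_mul_eq_iff P P).mp hP
  refine ext₂ fun r ↦ ?_
  induction r with
  | zero => simpa using row_zero
  | succ r ih => intro s; simpa [ih] using coeff_eq r s

theorem inU_mul_inV_comm {f g : PowerSeries A}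
    (h : ∀ r s, PowerSeries.coeff r f * PowerSeries.coeff s g =
      PowerSeries.coeff s g * PowerSeries.coeff r f) : inU f * inV g = inV g * inU f :=
  ext₂ fun r s ↦ by simp [h]

end TwoVariables

/-! ### The RTT equation in components -/

section Entries

attribute [local instance] LieRing.ofAssociativeRing

variable {A B : Type*} [Ring A] [Ring B] {n : ℕ}

theorem flip_apply (i k j l : Fin n) :
    flip A n (i, k) (j, l) = if i = l ∧ k = j then 1 else 0 := by
  simp only [flip, Matrix.sum_apply, Matrix.kroneckerMap_apply, Matrix.single_apply]
  rw [Finset.sum_eq_single i (by simp +contextual) (by simp),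
    Finset.sum_eq_single k (by simp +contextual) (by simp)]
  by_cases hil : i = l <;> by_cases hkj : k = j <;> simp [hil, hkj]

theorem flip_mul_apply (M : Matrix (Fin n × Fin n) (Fin n × Fin n) (PowerSeries (PowerSeries A)))
    (i k : Fin n) (q : Fin n × Fin n) : (flip A n * M) (i, k) q = M (k, i) q := by
  rw [Matrix.mul_apply, Finset.sum_eq_single (k, i)]
  · simp [flip_apply]
  · rintro ⟨a, b⟩ - hab
    rw [flip_apply, if_neg (by rintro ⟨rfl, rfl⟩; exact hab rfl), zero_mul]
  · simp

theorem mul_flip_apply (M : Matrix (Fin n × Fin n) (Fin n × Fin n) (PowerSeries (PowerSeries A)))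
    (p : Fin n × Fin n) (j l : Fin n) : (M * flip A n) p (j, l) = M p (l, j) := by
  rw [Matrix.mul_apply, Finset.sum_eq_single (l, j)]
  · simp [flip_apply]
  · rintro ⟨a, b⟩ - hab
    rw [flip_apply, if_neg (by rintro ⟨rfl, rfl⟩; exact hab rfl), mul_zero]
  · simp

theorem tensorU_mul_tensorV_apply (T : Matrix (Fin n) (Fin n) (PowerSeries A)) (i k j l : Fin n) :
    (tensorU T * tensorV T) (i, k) (j, l) = inU (T i j) * inV (T k l) := by
  rw [Matrix.mul_apply, Finset.sum_eq_single (j, k)]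
  · simp [tensorU, tensorV, inU, inV]
  · rintro ⟨a, b⟩ - hab
    have ne_or_ne : a ≠ j ∨ k ≠ b := by
      contrapose! hab
      rw [hab.1, hab.2]
    rcases ne_or_ne with haj | hkb <;> simp [tensorU, tensorV, Matrix.one_apply, *]
  · simp

theorem tensorV_mul_tensorU_apply (T : Matrix (Fin n) (Fin n) (PowerSeries A)) (i k j l : Fin n) :
    (tensorV T * tensorU T) (i, k) (j, l) = inV (T k l) * inU (T i j) := by
  rw [Matrix.mul_apply, Finset.sum_eq_single (i, l)]
  · simp [tensorU, tensorV, inU, inV]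
  · rintro ⟨a, b⟩ - hab
    have ne_or_ne : i ≠ a ∨ b ≠ l := by
      contrapose! hab
      rw [hab.1, hab.2]
    rcases ne_or_ne with hia | hbl <;> simp [tensorU, tensorV, Matrix.one_apply, *]
  · simp

theorem rttLeft_apply (T : Matrix (Fin n) (Fin n) (PowerSeries A)) (i k j l : Fin n) :
    rttLeft T (i, k) (j, l) = (vInv A - uInv A) * (inU (T i j) * inV (T k l)) -
      uInv A * vInv A * (inU (T k j) * inV (T i l)) := by
  rw [rttLeft, mul_assoc, rMatrix, sub_mul, Matrix.smul_mul, Matrix.smul_mul, one_mul,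
    Matrix.sub_apply, Matrix.smul_apply, Matrix.smul_apply, flip_mul_apply,
    tensorU_mul_tensorV_apply, tensorU_mul_tensorV_apply, smul_eq_mul, smul_eq_mul]

theorem mul_smul_of_central {ι R : Type*} [Fintype ι] [Ring R] {c : R} (hc : ∀ x, c * x = x * c)
    (M N : Matrix ι ι R) : M * (c • N) = c • (M * N) := by
  ext p q
  simp only [Matrix.mul_apply, Matrix.smul_apply, smul_eq_mul, Finset.mul_sum]
  exact Finset.sum_congr rfl fun x _ ↦ by rw [← mul_assoc, ← hc, mul_assoc]

theorem rttRight_apply (T : Matrix (Fin n) (Fin n) (PowerSeries A)) (i k j l : Fin n) :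
    rttRight T (i, k) (j, l) = (vInv A - uInv A) * (inV (T k l) * inU (T i j)) -
      uInv A * vInv A * (inV (T k j) * inU (T i l)) := by
  rw [rttRight, rMatrix, mul_sub, mul_smul_of_central vInv_sub_uInv_mul_comm,
    mul_smul_of_central uInv_mul_vInv_mul_comm, mul_one, Matrix.sub_apply, Matrix.smul_apply,
    Matrix.smul_apply, mul_flip_apply, tensorV_mul_tensorU_apply, tensorV_mul_tensorU_apply,
    smul_eq_mul, smul_eq_mul]

/-- The matrix of series in `u⁻¹` with coefficients `T i j r`. -/
def seriesMatrix {ι : Type*} (T : ι → ι → ℕ → A) : Matrix ι ι (PowerSeries A) :=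
  Matrix.of fun i j ↦ PowerSeries.mk (T i j)

@[simp] theorem coeff_seriesMatrix {ι : Type*} (T : ι → ι → ℕ → A) (i j : ι) (r : ℕ) :
    PowerSeries.coeff r (seriesMatrix T i j) = T i j r := by simp [seriesMatrix]

theorem isRTT_iff_series {ι : Type*} [DecidableEq ι] {T : ι → ι → ℕ → A}
    (hT : ∀ i j, T i j 0 = if i = j then 1 else 0) :
    IsRTT T ↔ ∀ i j k l, (vInv A - uInv A) *
      (inU (seriesMatrix T i j) * inV (seriesMatrix T k l) -
        inV (seriesMatrix T k l) * inU (seriesMatrix T i j)) =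
      uInv A * vInv A * (inU (seriesMatrix T k j) * inV (seriesMatrix T i l) -
        inV (seriesMatrix T k j) * inU (seriesMatrix T i l)) := by
  simp only [vInv_sub_uInv_mul_eq_iff, coeff₂_sub, coeff₂_inU_mul_inV, coeff₂_inV_mul_inU,
    coeff_seriesMatrix]
  constructor
  · intro h i j k l
    refine ⟨fun s ↦ ?_, fun r ↦ ?_, h.rel i j k l⟩
    all_goals rw [hT]; split_ifs <;> simp
  · exact fun h ↦ ⟨hT, fun i j k l ↦ (h i j k l).2.2⟩

theorem rttLeft_eq_rttRight_iff {T : Fin n → Fin n → ℕ → A}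
    (hT : ∀ i j, T i j 0 = if i = j then 1 else 0) :
    (∀ p q, rttLeft (seriesMatrix T) p q = rttRight (seriesMatrix T) p q) ↔ IsRTT T := by
  rw [isRTT_iff_series hT]
  simp only [Prod.forall, rttLeft_apply, rttRight_apply, mul_sub]
  constructor
  · intro h i j k l
    rw [sub_eq_iff_eq_add.mp (h i k j l)]
    abel
  · intro h i k j l
    rw [sub_eq_iff_eq_add.mp (h i j k l)]
    abel

theorem map_rttLeft (f : A →+* B) (T : Matrix (Fin n) (Fin n) (PowerSeries A))
    (p q : Fin n × Fin n) :
    PowerSeries.map (PowerSeries.map f) (rttLeft T p q) =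
      rttLeft (T.map (PowerSeries.map f)) p q := by
  obtain ⟨i, k⟩ := p
  obtain ⟨j, l⟩ := q
  simp only [rttLeft_apply, map_sub, map_mul, map_inU, map_inV, map_uInv, map_vInv,
    Matrix.map_apply]

theorem map_rttRight (f : A →+* B) (T : Matrix (Fin n) (Fin n) (PowerSeries A))
    (p q : Fin n × Fin n) :
    PowerSeries.map (PowerSeries.map f) (rttRight T p q) =
      rttRight (T.map (PowerSeries.map f)) p q := by
  obtain ⟨i, k⟩ := p
  obtain ⟨j, l⟩ := q
  simp only [rttRight_apply, map_sub, map_mul, map_inU, map_inV, map_uInv, map_vInv,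
    Matrix.map_apply]

theorem isRTT_genT (n : ℕ) : IsRTT (fun i j r ↦ (genT i j r : Yangian n)) := by
  have genT_zero : ∀ i j, (genT i j 0 : Yangian n) = if i = j then 1 else 0 := by
    intro i j; simp only [genT, freeT]; split_ifs <;> simp
  rw [← rttLeft_eq_rttRight_iff genT_zero]
  intro p q
  let quotient : FreeT n →+* Yangian n := (RingQuot.mkAlgHom ℂ (RTTRel n)).toRingHom
  have map_freeTMatrix : seriesMatrix (fun i j r ↦ (genT i j r : Yangian n)) =
      (freeTMatrix n).map (PowerSeries.map quotient) := by
    ext i j r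
    rw [coeff_seriesMatrix, Matrix.map_apply, PowerSeries.coeff_map, freeTMatrix, Matrix.of_apply,
      PowerSeries.coeff_mk]
    rfl
  rw [map_freeTMatrix, ← map_rttLeft, ← map_rttRight]
  refine ext₂ fun r s ↦ ?_
  rw [coeff₂_map, coeff₂_map]
  exact RingQuot.mkAlgHom_rel ℂ (RTTRel.rtt p q r s)

theorem exists_yangian_lift [Algebra ℂ A] {T : Fin n → Fin n → ℕ → A} (hT : IsRTT T) :
    ∃ f : Yangian n →ₐ[ℂ] A, ∀ i j r, f (genT i j r) = T i j r := by
  let lift : FreeT n →ₐ[ℂ] A := FreeAlgebra.lift ℂ fun x ↦ T x.1 x.2.1 (x.2.2 + 1)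
  have lift_freeT : ∀ i j r, lift (freeT i j r) = T i j r := by
    rintro i j (_ | r)
    · rw [hT.zero, freeT]; split_ifs <;> simp
    · simp [lift, freeT]
  have map_freeTMatrix : (freeTMatrix n).map (PowerSeries.map lift.toRingHom) = seriesMatrix T := by
    ext i j r
    simp [freeTMatrix, lift_freeT]
  refine ⟨RingQuot.liftAlgHom ℂ ⟨lift, ?_⟩, fun i j r ↦ ?_⟩
  · rintro _ _ ⟨p, q, r, s⟩
    have left := coeff₂_map lift.toRingHom r s (rttLeft (freeTMatrix n) p q)
    have right := coeff₂_map lift.toRingHom r s (rttRight (freeTMatrix n) p q)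
    rw [map_rttLeft, map_freeTMatrix, (rttLeft_eq_rttRight_iff hT.zero).mpr hT] at left
    rw [map_rttRight, map_freeTMatrix] at right
    exact left.symm.trans right
  · rw [genT, RingQuot.liftAlgHom_mkAlgHom_apply, lift_freeT]

end Entries

/-! ### Gauss factorizations -/

section Triangular

variable {n : ℕ} {B : Type*} [Ring B]

/-- Lower triangular matrices with unit diagonal. -/
structure IsLowerUni (M : Matrix (Fin n) (Fin n) B) : Prop where
  diag : ∀ i, M i i = 1
  upper : ∀ i j, i < j → M i j = 0

/-- Upper triangular matrices with unit diagonal. -/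
structure IsUpperUni (M : Matrix (Fin n) (Fin n) B) : Prop where
  diag : ∀ i, M i i = 1
  lower : ∀ i j, j < i → M i j = 0

theorem pow_apply_eq_zero_of_strictlyLower {Z : Matrix (Fin n) (Fin n) B}
    (hZ : ∀ i j, i ≤ j → Z i j = 0) (k : ℕ) {i j : Fin n} (hij : (i : ℕ) < j + k) :
    (Z ^ k) i j = 0 := by
  induction k generalizing j with
  | zero => rw [pow_zero, Matrix.one_apply_ne (Fin.lt_def.mpr (by simpa using hij)).ne]
  | succ k ih =>
    rw [pow_succ, Matrix.mul_apply]
    refine Finset.sum_eq_zero fun m _ ↦ ?_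
    rcases le_or_gt m j with hmj | hjm
    · rw [hZ m j hmj, mul_zero]
    · rw [ih (by have := Fin.lt_def.mp hjm; omega), zero_mul]

theorem IsLowerUni.exists_inverse {M : Matrix (Fin n) (Fin n) B} (hM : IsLowerUni M) :
    ∃ N, IsLowerUni N ∧ M * N = 1 ∧ N * M = 1 := by
  obtain ⟨Z, rfl⟩ : ∃ Z, M = 1 - Z := ⟨1 - M, by simp⟩
  have hZ : ∀ i j, i ≤ j → Z i j = 0 := fun i j hij ↦ by
    rcases hij.eq_or_lt with rfl | hij
    · simpa using hM.diag i
    · simpa [hij.ne] using hM.upper i j hij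
  have nilpotent : Z ^ n = 0 := by
    ext i j
    exact pow_apply_eq_zero_of_strictlyLower hZ n (by omega)
  refine ⟨∑ k ∈ Finset.range n, Z ^ k, ⟨fun i ↦ ?_, fun i j hij ↦ ?_⟩, ?_, ?_⟩
  · rw [Matrix.sum_apply, Finset.sum_eq_single 0]
    · simp
    · exact fun k _ hk ↦ pow_apply_eq_zero_of_strictlyLower hZ k (by omega)
    · exact fun h ↦ absurd (Finset.mem_range.mpr i.pos) h
  · rw [Matrix.sum_apply]
    exact Finset.sum_eq_zero fun k _ ↦
      pow_apply_eq_zero_of_strictlyLower hZ k (by have := Fin.lt_def.mp hij; omega)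
  · rw [mul_neg_geom_sum, nilpotent, sub_zero]
  · rw [geom_sum_mul_neg, nilpotent, sub_zero]

theorem IsLowerUni.mul {M N : Matrix (Fin n) (Fin n) B} (hM : IsLowerUni M) (hN : IsLowerUni N) :
    IsLowerUni (M * N) where
  diag i := by
    rw [Matrix.mul_apply, Fintype.sum_eq_single i, hM.diag, hN.diag, one_mul]
    intro m hm
    rcases lt_or_gt_of_ne hm with hmi | him
    · rw [hN.upper _ _ hmi, mul_zero]
    · rw [hM.upper _ _ him, zero_mul]
  upper i j hij := by
    rw [Matrix.mul_apply]
    refine Finset.sum_eq_zero fun m _ ↦ ?_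
    rcases lt_or_ge i m with him | hmi
    · rw [hM.upper _ _ him, zero_mul]
    · rw [hN.upper _ _ (hmi.trans_lt hij), mul_zero]

/-- The automorphism of the matrix ring that reverses the order of rows and columns; it exchanges
lower and upper triangular matrices. -/
def reverse : Matrix (Fin n) (Fin n) B ≃ₐ[ℤ] Matrix (Fin n) (Fin n) B :=
  Matrix.reindexAlgEquiv ℤ B Fin.revPerm

theorem reverse_apply (M : Matrix (Fin n) (Fin n) B) (i j : Fin n) :
    reverse M i j = M i.rev j.rev := rfl

theorem reverse_reverse (M : Matrix (Fin n) (Fin n) B) : reverse (reverse M) = M := by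
  ext i j
  simp only [reverse_apply, Fin.rev_rev]

theorem isLowerUni_reverse_iff {M : Matrix (Fin n) (Fin n) B} :
    IsLowerUni (reverse M) ↔ IsUpperUni M := by
  refine ⟨fun h ↦ ⟨fun i ↦ ?_, fun i j hji ↦ ?_⟩, fun h ↦ ⟨fun i ↦ h.diag _, fun i j hij ↦
    h.lower _ _ (Fin.rev_lt_rev.mpr hij)⟩⟩
  · simpa [reverse_apply] using h.diag i.rev
  · simpa [reverse_apply] using h.upper i.rev j.rev (Fin.rev_lt_rev.mpr hji)

theorem IsUpperUni.exists_inverse {M : Matrix (Fin n) (Fin n) B} (hM : IsUpperUni M) :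
    ∃ N, IsUpperUni N ∧ M * N = 1 ∧ N * M = 1 := by
  obtain ⟨N, hN, hMN, hNM⟩ := (isLowerUni_reverse_iff.mpr hM).exists_inverse
  refine ⟨reverse N, isLowerUni_reverse_iff.mp (by rwa [reverse_reverse]), ?_, ?_⟩ <;>
    apply reverse.injective <;> simpa only [map_mul, reverse_reverse, map_one]

theorem IsUpperUni.mul {M N : Matrix (Fin n) (Fin n) B} (hM : IsUpperUni M) (hN : IsUpperUni N) :
    IsUpperUni (M * N) := by
  rw [← isLowerUni_reverse_iff] at hM hN ⊢
  rw [map_mul]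
  exact hM.mul hN

theorem eq_one_of_isLowerUni_of_isUpperUni {L U : Matrix (Fin n) (Fin n) B} {D D' : Fin n → B}
    (hL : IsLowerUni L) (hU : IsUpperUni U) (hD' : ∀ i, IsUnit (D' i))
    (h : L * Matrix.diagonal D = Matrix.diagonal D' * U) : D = D' ∧ L = 1 ∧ U = 1 := by
  have entry : ∀ i j, L i j * D j = D' i * U i j := fun i j ↦ by
    simpa [Matrix.mul_diagonal, Matrix.diagonal_mul] using congr_fun₂ h i j
  have hD : D = D' := by
    ext i
    simpa [hL.diag, hU.diag] using entry i i
  refine ⟨hD, ?_, ?_⟩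
  · ext i j
    rcases lt_trichotomy i j with hij | rfl | hji
    · rw [hL.upper i j hij, Matrix.one_apply_ne hij.ne]
    · rw [hL.diag, Matrix.one_apply_eq]
    · rw [Matrix.one_apply_ne hji.ne', ← (hD' j).mul_left_eq_zero, ← hD, entry,
        hU.lower i j hji, mul_zero]
  · ext i j
    rcases lt_trichotomy i j with hij | rfl | hji
    · rw [Matrix.one_apply_ne hij.ne, ← (hD' i).mul_right_eq_zero, ← entry, hL.upper i j hij,
        zero_mul]
    · rw [hU.diag, Matrix.one_apply_eq]
    · rw [hU.lower i j hji, Matrix.one_apply_ne hji.ne']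

variable {G G₁ G₂ : GaussFactors n B} {T : Matrix (Fin n) (Fin n) B}

theorem GaussFactors.IsFactorizationOf.lowerUni (h : G.IsFactorizationOf T) : IsLowerUni G.F :=
  ⟨h.F_diag, h.F_upper⟩

theorem GaussFactors.IsFactorizationOf.upperUni (h : G.IsFactorizationOf T) : IsUpperUni G.E :=
  ⟨h.E_diag, h.E_lower⟩

theorem GaussFactors.mul_apply (G : GaussFactors n B) (i j : Fin n) :
    (G.F * Matrix.diagonal G.D * G.E) i j = ∑ m, G.F i m * G.D m * G.E m j := by
  simp only [Matrix.mul_apply (M := _ * _), Matrix.mul_diagonal]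

theorem GaussFactors.IsFactorizationOf.unique (h₁ : G₁.IsFactorizationOf T)
    (h₂ : G₂.IsFactorizationOf T) (hu : ∀ i, IsUnit (G₂.D i)) : G₁ = G₂ := by
  obtain ⟨F', hF', hFF', hF'F⟩ := h₂.lowerUni.exists_inverse
  obtain ⟨E', hE', hEE', hE'E⟩ := h₁.upperUni.exists_inverse
  have lower_eq_upper :
      F' * G₁.F * Matrix.diagonal G₁.D = Matrix.diagonal G₂.D * (G₂.E * E') := by
    calc F' * G₁.F * Matrix.diagonal G₁.D
        = F' * (G₁.F * Matrix.diagonal G₁.D * G₁.E) * E' := by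
          rw [← mul_assoc, mul_assoc _ G₁.E, hEE', mul_one, mul_assoc]
      _ = F' * (G₂.F * Matrix.diagonal G₂.D * G₂.E) * E' := by rw [← h₁.eq_mul, h₂.eq_mul]
      _ = Matrix.diagonal G₂.D * (G₂.E * E') := by
          rw [mul_assoc G₂.F, ← mul_assoc, hF'F, one_mul, mul_assoc]
  obtain ⟨hD, hF, hE⟩ := eq_one_of_isLowerUni_of_isUpperUni (hF'.mul h₁.lowerUni)
    (h₂.upperUni.mul hE') hu lower_eq_upper
  refine GaussFactors.ext ?_ hD ?_
  · calc G₁.F = G₂.F * F' * G₁.F := by rw [hFF', one_mul]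
      _ = G₂.F := by rw [mul_assoc, hF, mul_one]
  · calc G₁.E = G₂.E * E' * G₁.E := by rw [hE, one_mul]
      _ = G₂.E := by rw [mul_assoc, hE'E, mul_one]

/-- Gauss factors for a matrix with corner `a`, first column `c i * a` and first row `a * r j`,
built from Gauss factors `G` for the Schur complement of the corner. -/
def GaussFactors.cons (a : B) (c r : Fin n → B) (G : GaussFactors n B) :
    GaussFactors (n + 1) B where
  F := Matrix.of (Fin.cons (Fin.cons 1 0) fun i ↦ Fin.cons (c i) (G.F i))
  D := Fin.cons a G.D
  E := Matrix.of (Fin.cons (Fin.cons 1 r) fun i ↦ Fin.cons 0 (G.E i))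

theorem GaussFactors.IsFactorizationOf.cons {T : Matrix (Fin (n + 1)) (Fin (n + 1)) B} {a : B}
    {c r : Fin n → B} (corner : T 0 0 = a) (column : ∀ i, T (Fin.succ i) 0 = c i * a)
    (row : ∀ j, T 0 (Fin.succ j) = a * r j)
    (hG : G.IsFactorizationOf (.of fun i j ↦ T (Fin.succ i) (Fin.succ j) - c i * a * r j)) :
    (G.cons a c r).IsFactorizationOf T where
  F_diag := Fin.cases (by simp [GaussFactors.cons]) fun i ↦ by
    simpa [GaussFactors.cons] using hG.F_diag i
  F_upper := Fin.cases (Fin.cases (by simp) (by simp [GaussFactors.cons])) fun i ↦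
    Fin.cases (by simp) fun j hij ↦ by
      simpa [GaussFactors.cons] using hG.F_upper i j (Fin.succ_lt_succ_iff.mp hij)
  E_diag := Fin.cases (by simp [GaussFactors.cons]) fun i ↦ by
    simpa [GaussFactors.cons] using hG.E_diag i
  E_lower := Fin.cases (Fin.cases (by simp) (by simp)) fun i ↦
    Fin.cases (by simp [GaussFactors.cons]) fun j hji ↦ by
      simpa [GaussFactors.cons] using hG.E_lower i j (Fin.succ_lt_succ_iff.mp hji)
  eq_mul := by
    refine Matrix.ext fun i j ↦ ?_
    rw [GaussFactors.mul_apply, Fin.sum_univ_succ]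
    refine Fin.cases ?_ (fun i ↦ ?_) i <;> refine Fin.cases ?_ (fun j ↦ ?_) j
    · simp [GaussFactors.cons, corner]
    · simp [GaussFactors.cons, row]
    · simp [GaussFactors.cons, column]
    · have schur := congr_fun₂ hG.eq_mul i j
      rw [GaussFactors.mul_apply, Matrix.of_apply, sub_eq_iff_eq_add'] at schur
      simpa [GaussFactors.cons] using schur

end Triangular

section GaussSeries

variable {A : Type*} [Ring A]

theorem isUnit_of_constantCoeff_eq_one {f : PowerSeries A}
    (h : PowerSeries.constantCoeff f = 1) : IsUnit f := by
  rw [PowerSeries.isUnit_iff_constantCoeff, h]; exact isUnit_one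

theorem exists_gauss {n : ℕ} (T : Matrix (Fin n) (Fin n) (PowerSeries A))
    (hT : ∀ i j, PowerSeries.constantCoeff (T i j) = if i = j then 1 else 0) :
    ∃ G : GaussFactors n (PowerSeries A), G.IsFactorizationOf T ∧
      ∀ i, PowerSeries.constantCoeff (G.D i) = 1 := by
  induction n with
  | zero => exact ⟨⟨1, 1, 1⟩, ⟨nofun, nofun, nofun, nofun, Matrix.ext nofun⟩, nofun⟩
  | succ n ih =>
    obtain ⟨a, ha⟩ := isUnit_of_constantCoeff_eq_one (f := T 0 0) (by simp [hT])
    obtain ⟨G, hG, hD⟩ := ih (.of fun i j ↦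
      T (Fin.succ i) (Fin.succ j) - T (Fin.succ i) 0 * ↑a⁻¹ * a * (↑a⁻¹ * T 0 (Fin.succ j)))
      fun i j ↦ by simp [hT, Fin.succ_ne_zero]
    refine ⟨G.cons a _ _, hG.cons ha.symm (fun i ↦ ?_) (fun j ↦ ?_), ?_⟩
    · rw [Units.inv_mul_cancel_right]
    · rw [Units.mul_inv_cancel_left]
    · exact Fin.cases (by simp [GaussFactors.cons, ha, hT]) hD

theorem existsUnique_gauss {n : ℕ} (T : Matrix (Fin n) (Fin n) (PowerSeries A))
    (hT : ∀ i j, PowerSeries.constantCoeff (T i j) = if i = j then 1 else 0) :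
    ∃! G : GaussFactors n (PowerSeries A), G.IsFactorizationOf T := by
  obtain ⟨G, hG, hD⟩ := exists_gauss T hT
  exact ⟨G, hG, fun G' hG' ↦ hG'.unique hG fun i ↦ isUnit_of_constantCoeff_eq_one (hD i)⟩

variable {n : ℕ} {T : Matrix (Fin n) (Fin n) (PowerSeries A)} {G : GaussFactors n (PowerSeries A)}

theorem GaussFactors.IsFactorizationOf.constantCoeff_D (hG : G.IsFactorizationOf T)
    (hT : ∀ i j, PowerSeries.constantCoeff (T i j) = if i = j then 1 else 0) (i : Fin n) :
    PowerSeries.constantCoeff (G.D i) = 1 := by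
  obtain ⟨G', hG', hD'⟩ := exists_gauss T hT
  rw [hG.unique hG' fun i ↦ isUnit_of_constantCoeff_eq_one (hD' i), hD']

theorem GaussFactors.IsFactorizationOf.constantCoeff_eq_one (hG : G.IsFactorizationOf T)
    (hT : ∀ i j, PowerSeries.constantCoeff (T i j) = if i = j then 1 else 0) :
    (∀ i j, PowerSeries.constantCoeff (G.F i j) = if i = j then 1 else 0) ∧
      ∀ i j, PowerSeries.constantCoeff (G.E i j) = if i = j then 1 else 0 := by
  let G₀ : GaussFactors n A := ⟨G.F.map PowerSeries.constantCoeff,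
    fun i ↦ PowerSeries.constantCoeff (G.D i), G.E.map PowerSeries.constantCoeff⟩
  have hG₀ : G₀.IsFactorizationOf 1 := by
    refine ⟨fun i ↦ by simp [G₀, hG.F_diag], fun i j h ↦ by simp [G₀, hG.F_upper i j h],
      fun i ↦ by simp [G₀, hG.E_diag], fun i j h ↦ by simp [G₀, hG.E_lower i j h], ?_⟩
    refine Matrix.ext fun i j ↦ ?_
    rw [GaussFactors.mul_apply, Matrix.one_apply, ← hT, hG.eq_mul, GaussFactors.mul_apply]
    simp [G₀]
  have hone : (⟨1, fun _ ↦ 1, 1⟩ : GaussFactors n A).IsFactorizationOf 1 :=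
    ⟨fun i ↦ by simp, fun i j h ↦ by simp [h.ne], fun i ↦ by simp, fun i j h ↦ by simp [h.ne'],
      by simp⟩
  have G₀_eq_one := hG₀.unique hone fun _ ↦ isUnit_one
  constructor <;> intro i j
  · simpa [G₀, Matrix.one_apply] using congr_fun₂ (congr_arg GaussFactors.F G₀_eq_one) i j
  · simpa [G₀, Matrix.one_apply] using congr_fun₂ (congr_arg GaussFactors.E G₀_eq_one) i j

theorem coeff_one_mul_eq (f g : PowerSeries A) : PowerSeries.coeff 1 (f * g) =
    PowerSeries.constantCoeff f * PowerSeries.coeff 1 g +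
      PowerSeries.coeff 1 f * PowerSeries.constantCoeff g := by
  rw [PowerSeries.coeff_mul, Finset.Nat.antidiagonal_succ]
  simp

theorem GaussFactors.IsFactorizationOf.coeff_one (hG : G.IsFactorizationOf T)
    (hT : ∀ i j, PowerSeries.constantCoeff (T i j) = if i = j then 1 else 0) (i j : Fin n) :
    PowerSeries.coeff 1 (T i j) = PowerSeries.coeff 1 (G.F i j) +
      (if i = j then PowerSeries.coeff 1 (G.D i) else 0) + PowerSeries.coeff 1 (G.E i j) := by
  obtain ⟨hF, hE⟩ := hG.constantCoeff_eq_one hT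
  have hD := hG.constantCoeff_D hT
  nth_rewrite 1 [hG.eq_mul]
  rw [GaussFactors.mul_apply, map_sum]
  simp only [coeff_one_mul_eq, map_mul, hF, hE, hD, mul_one, one_mul, ite_mul, mul_ite, zero_mul,
    mul_zero, Finset.sum_add_distrib, Finset.sum_ite_eq, Finset.sum_ite_eq', Finset.mem_univ,
    if_true]
  by_cases hij : i = j
  · subst hij; simp only [if_true]; abel
  · simp only [if_neg hij]; abel

end GaussSeries

/-! ### RTT relations for inverse matrices and Schur complements -/

section InverseRTT

variable {B : Type*} [Ring B] {κ : Type*}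

/-- The relation `α [t_{ij}, t'_{kl}] = β (t_{kj} t'_{il} - t'_{kj} t_{il})` between the entries of
two matrices, together with the one obtained by exchanging the two matrices and the sign of
`α`. -/
structure RTTPair (α β : B) (t t' : Matrix κ κ B) : Prop where
  rel : ∀ i j k l, α * (t i j * t' k l - t' k l * t i j) = β * (t k j * t' i l - t' k j * t i l)
  swap : ∀ i j k l, α * (t i j * t' k l - t' k l * t i j) = β * (t' i l * t k j - t i l * t' k j)

theorem RTTPair.submatrix {α β : B} {t t' : Matrix κ κ B} (h : RTTPair α β t t') {κ' : Type*}
    (e : κ' → κ) : RTTPair α β (t.submatrix e e) (t'.submatrix e e) :=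
  ⟨fun _ _ _ _ ↦ h.rel _ _ _ _, fun _ _ _ _ ↦ h.swap _ _ _ _⟩

variable [Fintype κ] [DecidableEq κ]

theorem conj_commutator {α β : B} (hα : ∀ x, α * x = x * α) (hβ : ∀ x, β * x = x * β)
    {t s : Matrix κ κ B} (hts : t * s = 1) (hst : s * t = 1) {x : B} {p p' q q' : κ → B}
    (h : ∀ k l, α * (x * t k l - t k l * x) = β * (p k * q l - p' k * q' l)) (a b : κ) :
    α * (s a b * x - x * s a b) =
      β * ((s *ᵥ p) a * (q ᵥ* s) b - (s *ᵥ p') a * (q' ᵥ* s) b) := by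
  let X : Matrix κ κ B := Matrix.diagonal fun _ ↦ x
  have commutator_eq : α • (X * t - t * X) =
      β • (Matrix.vecMulVec p q - Matrix.vecMulVec p' q') := by
    ext k l
    simpa [X, Matrix.vecMulVec_apply] using h k l
  have conj_left : s * (α • (X * t - t * X)) * s = α • (s * X - X * s) := by
    rw [mul_smul_of_central hα, Matrix.smul_mul, mul_sub, sub_mul]
    congr 2
    · rw [← mul_assoc, mul_assoc _ t s, hts, mul_one]
    · rw [← mul_assoc, hst, one_mul]
  have conj_right : s * (β • (Matrix.vecMulVec p q - Matrix.vecMulVec p' q')) * s =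
      β • (Matrix.vecMulVec (s *ᵥ p) (q ᵥ* s) - Matrix.vecMulVec (s *ᵥ p') (q' ᵥ* s)) := by
    rw [mul_smul_of_central hβ, Matrix.smul_mul, mul_sub, sub_mul, Matrix.mul_vecMulVec,
      Matrix.mul_vecMulVec, Matrix.vecMulVec_mul, Matrix.vecMulVec_mul]
  rw [commutator_eq, conj_right] at conj_left
  simpa [X, Matrix.vecMulVec_apply] using (congr_fun₂ conj_left a b).symm

variable {α β : B} {t t' s s' : Matrix κ κ B}

theorem mixed_relation (hα : ∀ x, α * x = x * α) (hβ : ∀ x, β * x = x * β)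
    (h : ∀ i j k l, α * (t i j * t' k l - t' k l * t i j) =
      β * (t k j * t' i l - t' k j * t i l))
    (hts' : t' * s' = 1) (hst' : s' * t' = 1) (i j a b : κ) :
    α * (s' a b * t i j - t i j * s' a b) =
      β * ((if i = b then (s' * t) a j else 0) - (if a = j then (t * s') i b else 0)) := by
  rw [conj_commutator hα hβ hts' hst' (p := fun k ↦ t k j) (p' := fun k ↦ t' k j)
    (q := fun l ↦ t' i l) (q' := fun l ↦ t i l) (h i j) a b]
  change β * ((s' * t) a j * (t' * s') i b - (s' * t') a j * (t * s') i b) = _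
  simp [hts', hst', Matrix.one_apply]

theorem inverse_relation (hα : ∀ x, α * x = x * α) (hβ : ∀ x, β * x = x * β)
    (h : ∀ i j k l, α * (t i j * t' k l - t' k l * t i j) =
      β * (t k j * t' i l - t' k j * t i l))
    (hts : t * s = 1) (hst : s * t = 1) (hts' : t' * s' = 1) (hst' : s' * t' = 1) (i j k l : κ) :
    α * (s i j * s' k l - s' k l * s i j) = β * (s i l * s' k j - s' i l * s k j) := by
  rw [conj_commutator hα hβ hts hst (p := Pi.single l 1) (p' := fun i ↦ (t * s') i l)
    (q := fun j ↦ (s' * t) k j) (q' := Pi.single k 1) (fun a b ↦ by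
      rw [mixed_relation hα hβ h hts' hst' a b k l]
      simp [Pi.single_apply, eq_comm (a := b)]) i j]
  change β * (_ * (s' * t * s) k j - (s * (t * s')) i l * _) = _
  rw [mul_assoc s' t s, hts, mul_one, ← mul_assoc, hst, one_mul]
  simp

theorem RTTPair.inverse (hα : ∀ x, α * x = x * α) (hβ : ∀ x, β * x = x * β)
    (h : RTTPair α β t t') (hts : t * s = 1) (hst : s * t = 1) (hts' : t' * s' = 1)
    (hst' : s' * t' = 1) : RTTPair α (-β) s s' where
  rel i j k l := by
    have hα' : ∀ x, -α * x = x * -α := fun x ↦ by rw [neg_mul, hα, mul_neg]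
    have swapped := inverse_relation hα' hβ (t := t') (t' := t) (fun i j k l ↦ by
      rw [neg_mul, ← mul_neg, neg_sub, h.swap k l i j]) hts' hst' hts hst k l i j
    rw [neg_mul, ← mul_neg, neg_sub] at swapped
    rw [swapped, neg_mul, ← mul_neg, neg_sub]
  swap i j k l := by
    rw [inverse_relation hα hβ h.rel hts hst hts' hst', neg_mul, ← mul_neg, neg_sub]

end InverseRTT

section Tail

variable {n : ℕ} {B : Type*} [Ring B]

/-- The lower right block with indices `≥ i`. -/
def tail (i : Fin n) (M : Matrix (Fin n) (Fin n) B) : Matrix {k // i ≤ k} {k // i ≤ k} B :=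
  M.submatrix (↑) (↑)

theorem tail_one (i : Fin n) : tail i (1 : Matrix (Fin n) (Fin n) B) = 1 := by
  ext a b; simp [tail, Matrix.one_apply, Subtype.ext_iff]

theorem sum_tail {i : Fin n} {f : Fin n → B} (h : ∀ m, m < i → f m = 0) :
    ∑ m, f m = ∑ m : {k // i ≤ k}, f m := by
  rw [← Finset.sum_subtype (Finset.univ.filter (i ≤ ·)) (by simp) f, eq_comm]
  refine Finset.sum_subset (Finset.subset_univ _) fun m _ hm ↦ h m ?_
  simpa using hm

theorem tail_mul_of_left (i : Fin n) {U M : Matrix (Fin n) (Fin n) B}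
    (h : ∀ k m, m < k → U k m = 0) : tail i (U * M) = tail i U * tail i M := by
  ext a b
  exact sum_tail (f := fun m ↦ U a m * M m b) fun m hm ↦ by
    rw [h _ _ (hm.trans_le a.2), zero_mul]

theorem tail_mul_of_right (i : Fin n) {M L : Matrix (Fin n) (Fin n) B}
    (h : ∀ k m, k < m → L k m = 0) : tail i (M * L) = tail i M * tail i L := by
  ext a b
  exact sum_tail (f := fun m ↦ M a m * L m b) fun m hm ↦ by
    rw [h _ _ (hm.trans_le b.2), mul_zero]

theorem exists_inverse_diagonal {d : Fin n → B} (hd : ∀ i, IsUnit (d i)) :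
    ∃ d', Matrix.diagonal d * Matrix.diagonal d' = 1 ∧
      Matrix.diagonal d' * Matrix.diagonal d = 1 := by
  choose u hu using hd
  refine ⟨fun i ↦ ↑(u i)⁻¹, ?_, ?_⟩ <;> simp [Matrix.diagonal_mul_diagonal, ← hu]

theorem mul_mul_mul_mul_mul_eq_one {M : Type*} [Monoid M] {f d e f' d' e' : M}
    (hf : f * f' = 1) (hd : d * d' = 1) (he : e * e' = 1) :
    f * d * e * (e' * d' * f') = 1 := by
  calc f * d * e * (e' * d' * f') = f * (d * (e * e') * d') * f' := by simp only [mul_assoc]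
    _ = 1 := by rw [he, mul_one, hd, mul_one, hf]

variable {G : GaussFactors n B} {T : Matrix (Fin n) (Fin n) B}

/-- The iterated Schur complement of `T` on the indices `≥ i`. -/
def schur (G : GaussFactors n B) (i : Fin n) : Matrix {k // i ≤ k} {k // i ≤ k} B :=
  tail i G.F * tail i (Matrix.diagonal G.D) * tail i G.E

theorem exists_inverse_schur (hG : G.IsFactorizationOf T) (hu : ∀ i, IsUnit (G.D i)) :
    ∃ S : Matrix (Fin n) (Fin n) B, T * S = 1 ∧ S * T = 1 ∧
      ∀ i, tail i S * schur G i = 1 ∧ schur G i * tail i S = 1 := by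
  obtain ⟨F', hF', hFF', hF'F⟩ := hG.lowerUni.exists_inverse
  obtain ⟨E', hE', hEE', hE'E⟩ := hG.upperUni.exists_inverse
  obtain ⟨D', hDD', hD'D⟩ := exists_inverse_diagonal hu
  have diagonal_lower : ∀ d : Fin n → B, ∀ k m, m < k → Matrix.diagonal d k m = 0 :=
    fun d k m h ↦ Matrix.diagonal_apply_ne _ h.ne'
  refine ⟨E' * Matrix.diagonal D' * F', ?_, ?_, fun i ↦ ?_⟩
  · rw [hG.eq_mul]; exact mul_mul_mul_mul_mul_eq_one hFF' hDD' hEE'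
  · rw [hG.eq_mul]; exact mul_mul_mul_mul_mul_eq_one hE'E hD'D hF'F
  · rw [tail_mul_of_right i hF'.upper, tail_mul_of_left i hE'.lower, schur]
    constructor <;> apply mul_mul_mul_mul_mul_eq_one
    · rw [← tail_mul_of_left i hE'.lower, hE'E, tail_one]
    · rw [← tail_mul_of_left i (diagonal_lower _), hD'D, tail_one]
    · rw [← tail_mul_of_right i hG.F_upper, hF'F, tail_one]
    · rw [← tail_mul_of_right i hF'.upper, hFF', tail_one]
    · rw [← tail_mul_of_left i (diagonal_lower _), hDD', tail_one]
    · rw [← tail_mul_of_left i hG.E_lower, hEE', tail_one]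

theorem schur_apply (G : GaussFactors n B) (i : Fin n) (a b : {k // i ≤ k}) :
    schur G i a b = ∑ m : {k // i ≤ k}, G.F a m * G.D m * G.E m b := by
  have tail_diagonal : tail i (Matrix.diagonal G.D) =
      Matrix.diagonal fun m : {k // i ≤ k} ↦ G.D m := by
    ext a b : 2; simp [tail, Matrix.diagonal_apply, Subtype.ext_iff]
  rw [schur, tail_diagonal, Matrix.mul_apply]
  simp [Matrix.mul_diagonal, tail]

theorem schur_row (hG : G.IsFactorizationOf T) (i : Fin n) (b : {k // i ≤ k}) :
    schur G i ⟨i, le_rfl⟩ b = G.D i * G.E i b := by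
  rw [schur_apply, Fintype.sum_eq_single ⟨i, le_rfl⟩]
  · simp [hG.F_diag]
  · intro m hm
    rw [hG.F_upper i m (lt_of_le_of_ne m.2 fun h ↦ hm (Subtype.ext h.symm)), zero_mul, zero_mul]

theorem schur_corner (hG : G.IsFactorizationOf T) (i : Fin n) :
    schur G i ⟨i, le_rfl⟩ ⟨i, le_rfl⟩ = G.D i := by
  rw [schur_row hG, hG.E_diag, mul_one]

theorem map_mul_eq_one {κ B B' : Type*} [Fintype κ] [DecidableEq κ] [Ring B] [Ring B']
    (f : B →+* B') {M N : Matrix κ κ B} (h : M * N = 1) : M.map f * N.map f = 1 := by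
  rw [← Matrix.map_mul, h, Matrix.map_one _ (map_zero f) (map_one f)]

variable {B' : Type*} [Ring B'] {f g : B →+* B'} {α β : B'}

theorem RTTPair.schur (h : RTTPair α β (T.map f) (T.map g)) (hα : ∀ x, α * x = x * α)
    (hβ : ∀ x, β * x = x * β) (hG : G.IsFactorizationOf T) (hu : ∀ i, IsUnit (G.D i))
    (i : Fin n) : RTTPair α β ((schur G i).map f) ((schur G i).map g) := by
  obtain ⟨S, hTS, hST, hS⟩ := exists_inverse_schur hG hu
  have hβ' : ∀ x, -β * x = x * -β := fun x ↦ by rw [neg_mul, hβ, mul_neg]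
  have tail_inverse : RTTPair α (-β) ((tail i S).map f) ((tail i S).map g) :=
    (h.inverse hα hβ (map_mul_eq_one f hTS) (map_mul_eq_one f hST) (map_mul_eq_one g hTS)
      (map_mul_eq_one g hST)).submatrix (fun k : {k // i ≤ k} ↦ (k : Fin n))
  simpa only [neg_neg] using tail_inverse.inverse hα hβ'
    (map_mul_eq_one f (hS i).1) (map_mul_eq_one f (hS i).2)
    (map_mul_eq_one g (hS i).1) (map_mul_eq_one g (hS i).2)

theorem RTTPair.commute_D (h : RTTPair α β (T.map f) (T.map g)) (hα : ∀ x, α * x = x * α)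
    (hβ : ∀ x, β * x = x * β) (hG : G.IsFactorizationOf T) (hu : ∀ i, IsUnit (G.D i))
    (α_regular : ∀ x, α * x = 0 → x = 0) {i j : Fin n} (hij : i < j) :
    f (G.D i) * g (G.D j) = g (G.D j) * f (G.D i) := by
  obtain ⟨S, -, -, hS⟩ := exists_inverse_schur hG hu
  have commute_inverse : ∀ a b : {k // j ≤ k}, f (G.D i) * g (S a b) = g (S a b) * f (G.D i) := by
    intro a b
    have ha : i < a := hij.trans_le a.2
    have hb : i < b := hij.trans_le b.2
    have commutator := mixed_relation hα hβ (h.schur hα hβ hG hu i).rel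
      (map_mul_eq_one g (hS i).2) (map_mul_eq_one g (hS i).1) ⟨i, le_rfl⟩ ⟨i, le_rfl⟩
      ⟨a, ha.le⟩ ⟨b, hb.le⟩
    rw [if_neg (fun h ↦ hb.ne (congr_arg Subtype.val h)),
      if_neg (fun h ↦ ha.ne' (congr_arg Subtype.val h)), sub_zero, mul_zero] at commutator
    simp only [Matrix.map_apply, schur_corner hG] at commutator
    exact (sub_eq_zero.mp (α_regular _ commutator)).symm
  have commutator := conj_commutator (α := 1) (β := 0) (by simp) (by simp)
    (map_mul_eq_one g (hS j).1) (map_mul_eq_one g (hS j).2) (x := f (G.D i))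
    (p := 0) (p' := 0) (q := 0) (q' := 0) (fun k l ↦ by
      rw [zero_mul, one_mul, sub_eq_zero]
      exact commute_inverse k l) ⟨j, le_rfl⟩ ⟨j, le_rfl⟩
  rw [zero_mul, one_mul, sub_eq_zero, Matrix.map_apply, schur_corner hG] at commutator
  exact commutator.symm

end Tail

section GaussRelations

attribute [local instance] LieRing.ofAssociativeRing

variable {n : ℕ} {A : Type*} [Ring A] {T : Fin n → Fin n → ℕ → A}
  {G : GaussFactors n (PowerSeries A)}

theorem IsRTT.constantCoeff {ι : Type*} [DecidableEq ι] {T : ι → ι → ℕ → A} (hT : IsRTT T)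
    (i j : ι) : PowerSeries.constantCoeff (seriesMatrix T i j) = if i = j then 1 else 0 := by
  rw [← PowerSeries.coeff_zero_eq_constantCoeff_apply, coeff_seriesMatrix, hT.zero]

theorem IsRTT.rttPair {ι : Type*} [DecidableEq ι] {T : ι → ι → ℕ → A} (hT : IsRTT T) :
    RTTPair (vInv A - uInv A) (uInv A * vInv A)
      ((seriesMatrix T).map inU) ((seriesMatrix T).map inV) where
  rel := (isRTT_iff_series hT.zero).mp hT
  swap i j k l := by
    obtain ⟨row_zero, column_zero, -⟩ :=
      (vInv_sub_uInv_mul_eq_iff _ _).mp ((isRTT_iff_series hT.zero).mp hT i j k l)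
    refine (vInv_sub_uInv_mul_eq_iff _ _).mpr ⟨row_zero, column_zero, fun r s ↦ ?_⟩
    simp only [Matrix.map_apply, coeff₂_sub, coeff₂_inU_mul_inV, coeff₂_inV_mul_inU,
      coeff_seriesMatrix, ← hT.rel k l i j s r, Ring.lie_def]
    abel

variable (hT : IsRTT T) (hG : G.IsFactorizationOf (seriesMatrix T))
include hT hG

theorem GaussFactors.IsFactorizationOf.isUnit_D (i : Fin n) : IsUnit (G.D i) :=
  isUnit_of_constantCoeff_eq_one (hG.constantCoeff_D hT.constantCoeff i)

theorem rttPair_schur (i : Fin n) : RTTPair (vInv A - uInv A) (uInv A * vInv A)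
    ((schur G i).map inU) ((schur G i).map inV) :=
  hT.rttPair.schur vInv_sub_uInv_mul_comm uInv_mul_vInv_mul_comm hG (hG.isUnit_D hT) i

theorem inU_D_mul_inV_D (i j : Fin n) :
    inU (G.D i) * inV (G.D j) = inV (G.D j) * inU (G.D i) := by
  have comm_of_lt : ∀ i j, i < j → inU (G.D i) * inV (G.D j) = inV (G.D j) * inU (G.D i) :=
    fun i j hij ↦ hT.rttPair.commute_D vInv_sub_uInv_mul_comm uInv_mul_vInv_mul_comm hG
      (hG.isUnit_D hT) (fun x hx ↦ eq_zero_of_vInv_sub_uInv_mul_eq_zero hx) hij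
  rcases lt_trichotomy i j with hij | rfl | hji
  · exact comm_of_lt i j hij
  · have corner := (rttPair_schur hT hG i).rel ⟨i, le_rfl⟩ ⟨i, le_rfl⟩ ⟨i, le_rfl⟩ ⟨i, le_rfl⟩
    simp only [Matrix.map_apply, schur_corner hG] at corner
    exact sub_eq_zero.mp (eq_zero_of_vInv_sub_uInv_mul_eq_self corner)
  · refine ext₂ fun r s ↦ ?_
    simpa using (congr_arg (coeff₂ s r) (comm_of_lt j i hji)).symm

theorem coeff_D_comm (i j : Fin n) (r s : ℕ) :
    ⁅PowerSeries.coeff r (G.D i), PowerSeries.coeff s (G.D j)⁆ = 0 := by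
  rw [Ring.lie_def, sub_eq_zero]
  simpa using congr_arg (coeff₂ r s) (inU_D_mul_inV_D hT hG i j)

theorem D_E_relation {i j : Fin n} (hij : i ≤ j) :
    (vInv A - uInv A) * (inU (G.D i) * inV (G.E i j) - inV (G.E i j) * inU (G.D i)) =
      uInv A * vInv A * (inU (G.D i) * inV (G.E i j) - inU (G.D i) * inU (G.E i j)) := by
  have corner_row := (rttPair_schur hT hG i).rel ⟨i, le_rfl⟩ ⟨i, le_rfl⟩ ⟨i, le_rfl⟩ ⟨j, hij⟩
  simp only [Matrix.map_apply, schur_corner hG, schur_row hG i ⟨j, hij⟩, map_mul] at corner_row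
  have D_comm := inU_D_mul_inV_D hT hG i i
  apply ((hG.isUnit_D hT i).map inV).mul_left_cancel
  rw [← mul_assoc, ← vInv_sub_uInv_mul_comm, mul_assoc, ← mul_assoc (inV (G.D i)),
    ← uInv_mul_vInv_mul_comm, mul_assoc]
  convert corner_row using 2 <;> rw [mul_sub, ← mul_assoc, ← mul_assoc, ← mul_assoc, D_comm]

theorem coeff_D_E {i j : Fin n} (hij : i < j) (r : ℕ) {s : ℕ} (hs : 1 ≤ s) :
    ⁅PowerSeries.coeff r (G.D i), PowerSeries.coeff s (G.E i j)⁆ =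
      ∑ t ∈ Finset.range r, PowerSeries.coeff t (G.D i) *
        PowerSeries.coeff (r + s - 1 - t) (G.E i j) := by
  obtain ⟨row_zero, -, coeff_eq⟩ :=
    (vInv_sub_uInv_mul_eq_iff _ _).mp (D_E_relation hT hG hij.le)
  induction r generalizing s with
  | zero => simpa [Ring.lie_def] using row_zero s
  | succ r ih =>
    have step := coeff_eq r s
    simp only [← map_mul, coeff₂_sub, coeff₂_inU_mul_inV, coeff₂_inV_mul_inU, coeff₂_inU,
      if_neg (Nat.one_le_iff_ne_zero.mp hs), sub_zero] at step
    rw [← Ring.lie_def, ← Ring.lie_def] at step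
    rw [sub_eq_iff_eq_add'.mp step, ih (Nat.le_add_left 1 s), Finset.sum_range_succ,
      show r + 1 + s - 1 - r = s by omega]
    simp only [show r + (s + 1) - 1 = r + 1 + s - 1 by omega]

end GaussRelations

/-! ### The action of `gl_n` on the Gauss factors -/

section Covariance

variable {n : ℕ} {B : Type*} [Ring B]

theorem diagonal_sub_single_mul_apply (d : Fin n → B) (i j : Fin n) (x : B)
    (M : Matrix (Fin n) (Fin n) B) (a b : Fin n) :
    ((Matrix.diagonal d - Matrix.single i j x) * M) a b =
      d a * M a b - if a = i then x * M j b else 0 := by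
  rw [sub_mul, Matrix.sub_apply, Matrix.diagonal_mul]
  split_ifs with h
  · rw [h, Matrix.single_mul_apply_same]
  · rw [Matrix.single_mul_apply_of_ne _ _ _ _ _ h]

theorem mul_diagonal_sub_single_apply (d : Fin n → B) (i j : Fin n) (x : B)
    (M : Matrix (Fin n) (Fin n) B) (a b : Fin n) :
    (M * (Matrix.diagonal d - Matrix.single i j x)) a b =
      M a b * d b - if b = j then M a i * x else 0 := by
  rw [mul_sub, Matrix.sub_apply, Matrix.mul_diagonal]
  split_ifs with h
  · rw [h, Matrix.mul_single_apply_same]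
  · rw [Matrix.mul_single_apply_of_ne _ _ _ _ _ h]

theorem mul_single_one_mul_apply (M N : Matrix (Fin n) (Fin n) B) (i j a b : Fin n) :
    (M * Matrix.single i j (1 : B) * N) a b = M a i * N j b := by
  rw [Matrix.mul_apply, Fintype.sum_eq_single j, Matrix.mul_single_apply_same, mul_one]
  exact fun m hm ↦ by rw [Matrix.mul_single_apply_of_ne _ _ _ _ _ hm, zero_mul]

theorem IsLowerUni.mul_diagonal_mul_apply {M N : Matrix (Fin n) (Fin n) B} (hM : IsLowerUni M)
    (hN : IsLowerUni N) (d : Fin n → B) {a b : Fin n} (hab : a ≤ b) :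
    (M * Matrix.diagonal d * N) a b = Matrix.diagonal d a b := by
  rw [Matrix.mul_apply, Fintype.sum_eq_single a, Matrix.mul_diagonal, hM.diag, one_mul]
  · rcases hab.eq_or_lt with rfl | hab
    · rw [hN.diag, mul_one, Matrix.diagonal_apply_eq]
    · rw [hN.upper _ _ hab, mul_zero, Matrix.diagonal_apply_ne _ hab.ne]
  · intro m hm
    rcases lt_or_gt_of_ne hm with hma | ham
    · rw [hN.upper _ _ (hma.trans_le hab), mul_zero]
    · rw [Matrix.mul_diagonal, hM.upper _ _ ham, zero_mul, zero_mul]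

theorem IsUpperUni.mul_diagonal_mul_apply {M N : Matrix (Fin n) (Fin n) B} (hM : IsUpperUni M)
    (hN : IsUpperUni N) (d : Fin n → B) {a b : Fin n} (hba : b ≤ a) :
    (M * Matrix.diagonal d * N) a b = Matrix.diagonal d a b := by
  rw [Matrix.mul_apply, Fintype.sum_eq_single a, Matrix.mul_diagonal, hM.diag, one_mul]
  · rcases hba.eq_or_lt with rfl | hba
    · rw [hN.diag, mul_one, Matrix.diagonal_apply_eq]
    · rw [hN.lower _ _ hba, mul_zero, Matrix.diagonal_apply_ne _ hba.ne']
  · intro m hm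
    rcases lt_or_gt_of_ne hm with hma | ham
    · rw [Matrix.mul_diagonal, hM.lower _ _ hma, zero_mul, zero_mul]
    · rw [hN.lower _ _ (hba.trans_lt ham), mul_zero]

/-- The matrix `c - e_{j',j}`. If `c` acts on the entries of `T` as the simple root vector of
`gl_n` attached to `j` and `j' = j + 1`, then this matrix commutes with `T`. -/
def simpleRootMatrix (c : B) (j j' : Fin n) : Matrix (Fin n) (Fin n) B :=
  Matrix.diagonal (fun _ ↦ c) - Matrix.single j' j 1

/-- The diagonal of `E * simpleRootMatrix c j j' * E⁻¹` for `E` upper unitriangular. -/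
def conjDiag (E : Matrix (Fin n) (Fin n) B) (c : B) (j j' a : Fin n) : B :=
  c - ((if a = j then E j j' else 0) - (if a = j' then E j j' else 0))

variable {c : B} {j j' : Fin n}

theorem commute_simpleRootMatrix {T : Matrix (Fin n) (Fin n) B}
    (hc : ∀ k l, c * T k l - T k l * c =
      (if j' = k then T j l else 0) - (if l = j then T k j' else 0)) :
    simpleRootMatrix c j j' * T = T * simpleRootMatrix c j j' := by
  ext a b
  rw [simpleRootMatrix, diagonal_sub_single_mul_apply, mul_diagonal_sub_single_apply, one_mul,
    mul_one, sub_eq_sub_iff_sub_eq_sub]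
  simpa only [eq_comm (a := j')] using hc a b

theorem IsLowerUni.conj_simpleRootMatrix_apply {F F' : Matrix (Fin n) (Fin n) B}
    (hF' : IsLowerUni F') (hF : IsLowerUni F) (hj : j < j') {a b : Fin n} (hab : a ≤ b) :
    (F' * simpleRootMatrix c j j' * F) a b = Matrix.diagonal (fun _ ↦ c) a b := by
  rw [simpleRootMatrix, mul_sub, sub_mul, Matrix.sub_apply, hF'.mul_diagonal_mul_apply hF _ hab,
    mul_single_one_mul_apply, sub_eq_self]
  rcases lt_or_ge a j' with haj' | hj'a
  · rw [hF'.upper _ _ haj', zero_mul]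
  · rw [hF.upper _ _ (hj.trans_le (hj'a.trans hab)), mul_zero]

theorem IsUpperUni.inverse_apply_succ {E E' : Matrix (Fin n) (Fin n) B} (hE : IsUpperUni E)
    (hE' : IsUpperUni E') (hEE' : E * E' = 1) (hj : (j' : ℕ) = j + 1) : E' j j' = -E j j' := by
  have hjj' : j < j' := Fin.lt_def.mpr (by omega)
  have entry := congr_fun (congr_fun hEE' j) j'
  rw [Matrix.mul_apply, Fintype.sum_eq_add j j' hjj'.ne, hE.diag, hE'.diag, one_mul, mul_one,
    Matrix.one_apply_ne hjj'.ne] at entry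
  · exact eq_neg_of_add_eq_zero_left entry
  · rintro m ⟨hmj, hmj'⟩
    rcases lt_or_gt_of_ne hmj with h | h
    · rw [hE.lower _ _ h, zero_mul]
    · rw [hE'.lower, mul_zero]
      exact lt_of_le_of_ne (Fin.le_def.mpr (by have := Fin.lt_def.mp h; omega)) hmj'.symm

theorem IsUpperUni.conj_simpleRootMatrix_diag {E E' : Matrix (Fin n) (Fin n) B}
    (hE : IsUpperUni E) (hE' : IsUpperUni E') (hEE' : E * E' = 1) (hj : (j' : ℕ) = j + 1)
    (a : Fin n) : (E * simpleRootMatrix c j j' * E') a a = conjDiag E c j j' a := by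
  have hjj' : j < j' := Fin.lt_def.mpr (by omega)
  rw [simpleRootMatrix, mul_sub, sub_mul, Matrix.sub_apply,
    hE.mul_diagonal_mul_apply hE' _ le_rfl, Matrix.diagonal_apply_eq, mul_single_one_mul_apply,
    conjDiag]
  congr 1
  rcases lt_trichotomy a j with haj | rfl | hja
  · rw [hE'.lower _ _ haj, if_neg haj.ne, if_neg (haj.trans hjj').ne, mul_zero, sub_zero]
  · rw [hE'.diag, if_pos rfl, if_neg hjj'.ne, mul_one, sub_zero]
  · have hj'a : j' ≤ a := Fin.le_def.mpr (by have := Fin.lt_def.mp hja; omega)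
    rcases hj'a.eq_or_lt with rfl | hj'a
    · rw [hE.diag, if_neg hja.ne', if_pos rfl, one_mul, zero_sub, hE.inverse_apply_succ hE' hEE' hj]
    · rw [hE.lower _ _ hj'a, if_neg hja.ne', if_neg hj'a.ne', zero_mul, sub_zero]

theorem IsUpperUni.conj_simpleRootMatrix_lower {E E' : Matrix (Fin n) (Fin n) B}
    (hE : IsUpperUni E) (hE' : IsUpperUni E') (hj : (j' : ℕ) = j + 1) {a b : Fin n}
    (hba : b < a) : (E * simpleRootMatrix c j j' * E') a b = -Matrix.single j' j (1 : B) a b := by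
  rw [simpleRootMatrix, mul_sub, sub_mul, Matrix.sub_apply,
    hE.mul_diagonal_mul_apply hE' _ hba.le, Matrix.diagonal_apply_ne _ hba.ne',
    mul_single_one_mul_apply, zero_sub, neg_inj]
  by_cases h : j' = a ∧ j = b
  · obtain ⟨rfl, rfl⟩ := h
    rw [hE.diag, hE'.diag, Matrix.single_apply_same, one_mul]
  · rw [Matrix.single_apply_of_ne _ _ _ _ _ h]
    rcases lt_or_ge j' a with hj'a | haj'
    · rw [hE.lower _ _ hj'a, zero_mul]
    · rw [hE'.lower, mul_zero]
      simp only [Fin.lt_def, Fin.le_def, Fin.ext_iff] at *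
      omega

variable {G : GaussFactors n B} {T : Matrix (Fin n) (Fin n) B}

section

variable (hj : (j' : ℕ) = j + 1) (hG : G.IsFactorizationOf T) (hu : ∀ i, IsUnit (G.D i))
  (hc : ∀ k l, c * T k l - T k l * c =
    (if j' = k then T j l else 0) - (if l = j then T k j' else 0))
include hj hG hu hc

/- Conjugating `T K = K T` by the unitriangular factors gives `D * (E K E⁻¹) = (F⁻¹ K F) * D`,
whose left side is known on and below the diagonal and whose right side is known above it. -/
theorem GaussFactors.exists_conj_simpleRootMatrix :
    ∃ P Q : Matrix (Fin n) (Fin n) B, G.E * simpleRootMatrix c j j' = P * G.E ∧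
      simpleRootMatrix c j j' * G.F = G.F * Q ∧
      (∀ a b, G.D a * P a b = Q a b * G.D b) ∧
      P = Matrix.diagonal (conjDiag G.E c j j') - Matrix.single j' j 1 ∧
      ∀ a b, a ≤ b → Q a b = Matrix.diagonal (fun _ ↦ c) a b := by
  have hjj' : j < j' := Fin.lt_def.mpr (by omega)
  obtain ⟨F', hF', hFF', hF'F⟩ := hG.lowerUni.exists_inverse
  obtain ⟨E', hE', hEE', hE'E⟩ := hG.upperUni.exists_inverse
  set K := simpleRootMatrix c j j'
  have intertwine : ∀ a b, G.D a * (G.E * K * E') a b = (F' * K * G.F) a b * G.D b := by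
    intro a b
    rw [← Matrix.diagonal_mul, ← Matrix.mul_diagonal]
    refine congr_fun (congr_fun ?_ a) b
    calc Matrix.diagonal G.D * (G.E * K * E')
        = F' * (T * K) * E' := by rw [hG.eq_mul]; simp only [← mul_assoc, hF'F, one_mul]
      _ = F' * (K * T) * E' := by rw [commute_simpleRootMatrix hc]
      _ = F' * K * G.F * Matrix.diagonal G.D := by
          rw [hG.eq_mul]; simp only [mul_assoc, hEE', mul_one]
  have Q_upper : ∀ a b, a ≤ b → (F' * K * G.F) a b = Matrix.diagonal (fun _ ↦ c) a b :=
    fun a b hab ↦ hF'.conj_simpleRootMatrix_apply hG.lowerUni hjj' hab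
  refine ⟨G.E * K * E', F' * K * G.F, by rw [mul_assoc _ E', hE'E, mul_one],
    by rw [← mul_assoc, ← mul_assoc, hFF', one_mul], intertwine, Matrix.ext fun a b ↦ ?_, Q_upper⟩
  rw [Matrix.sub_apply]
  rcases lt_trichotomy a b with hab | rfl | hba
  · apply (hu a).mul_left_cancel
    rw [intertwine, Q_upper a b hab.le, Matrix.diagonal_apply_ne _ hab.ne,
      Matrix.diagonal_apply_ne _ hab.ne, Matrix.single_apply_of_ne, zero_mul, sub_zero, mul_zero]
    rintro ⟨rfl, rfl⟩
    exact hab.not_gt hjj'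
  · rw [hG.upperUni.conj_simpleRootMatrix_diag hE' hEE' hj, Matrix.diagonal_apply_eq,
      Matrix.single_apply_of_ne, sub_zero]
    rintro ⟨rfl, h⟩
    exact hjj'.ne h
  · rw [hG.upperUni.conj_simpleRootMatrix_lower hE' hj hba, Matrix.diagonal_apply_ne _ hba.ne',
      zero_sub]

theorem GaussFactors.simpleRoot_lie_D (a : Fin n) : c * G.D a - G.D a * c =
    (if a = j' then G.D a * G.E j j' else 0) - (if a = j then G.D a * G.E j j' else 0) := by
  obtain ⟨P, Q, -, -, intertwine, rfl, hQ⟩ := G.exists_conj_simpleRootMatrix hj hG hu hc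
  have hjj' : ¬(j' = a ∧ j = a) := by rintro ⟨h, h'⟩; rw [h, h'] at hj; omega
  have diag := intertwine a a
  rw [hQ a a le_rfl, Matrix.sub_apply, Matrix.single_apply_of_ne _ _ _ _ _ hjj',
    Matrix.diagonal_apply_eq, Matrix.diagonal_apply_eq, sub_zero, conjDiag] at diag
  rw [← diag, mul_sub, mul_sub, mul_ite, mul_ite, mul_zero]
  abel

theorem GaussFactors.simpleRoot_lie_E (a b : Fin n) : c * G.E a b - G.E a b * c =
    ((if a = j then G.E j j' else 0) - (if a = j' then G.E j j' else 0)) * G.E a b +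
      (if a = j' then G.E j b else 0) - (if b = j then G.E a j' else 0) := by
  obtain ⟨P, Q, hP, -, -, rfl, -⟩ := G.exists_conj_simpleRootMatrix hj hG hu hc
  have entry := congr_fun (congr_fun hP a) b
  rw [simpleRootMatrix, mul_diagonal_sub_single_apply, diagonal_sub_single_mul_apply, one_mul,
    mul_one, conjDiag, sub_mul, sub_eq_iff_eq_add] at entry
  rw [entry]
  abel

theorem GaussFactors.simpleRoot_lie_F (a b : Fin n) : c * G.F a b - G.F a b * c =
    (if a = j' then G.F j b else 0) -
      (if b = j then G.F a j' * G.D j' * Ring.inverse (G.D j) else 0) := by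
  obtain ⟨P, Q, -, hQ, intertwine, rfl, Q_upper⟩ := G.exists_conj_simpleRootMatrix hj hG hu hc
  have hQ' : Q = Matrix.diagonal (fun _ ↦ c) -
      Matrix.single j' j (G.D j' * Ring.inverse (G.D j)) := by
    ext a b
    have hjj' : j < j' := Fin.lt_def.mpr (by omega)
    rw [Matrix.sub_apply]
    rcases le_or_gt a b with hab | hba
    · rw [Q_upper a b hab, Matrix.single_apply_of_ne, sub_zero]
      rintro ⟨rfl, rfl⟩
      exact hab.not_gt hjj'
    · apply (hu b).mul_right_cancel
      rw [← intertwine, Matrix.sub_apply, Matrix.diagonal_apply_ne _ hba.ne',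
        Matrix.diagonal_apply_ne _ hba.ne', zero_sub, zero_sub, mul_neg, neg_mul, neg_inj]
      by_cases h : j' = a ∧ j = b
      · obtain ⟨rfl, rfl⟩ := h
        rw [Matrix.single_apply_same, Matrix.single_apply_same, mul_one, mul_assoc,
          Ring.inverse_mul_cancel _ (hu j), mul_one]
      · rw [Matrix.single_apply_of_ne _ _ _ _ _ h, Matrix.single_apply_of_ne _ _ _ _ _ h, mul_zero,
          zero_mul]
  have entry := congr_fun (congr_fun hQ a) b
  rw [hQ', simpleRootMatrix, diagonal_sub_single_mul_apply, mul_diagonal_sub_single_apply, one_mul,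
    sub_eq_iff_eq_add] at entry
  rw [entry, mul_assoc]
  abel

end

end Covariance

/-! ### Drinfeld's relations from those of lowest degree -/

section LieShift

variable {L : Type*} [LieRing L]

theorem eq_zero_of_lie_shift {f : ℕ → L} {h : L} (one : f 1 = 0)
    (shift : ∀ r, 1 ≤ r → ⁅h, f r⁆ = f (r + 1)) {r : ℕ} (hr : 1 ≤ r) : f r = 0 := by
  induction r, hr using Nat.le_induction with
  | base => exact one
  | succ r hr ih => rw [← shift r hr, ih, lie_zero]

/-- On the level `r + s = N + 2` the first shift gives `S (r + 1) s = -S r (s + 1)`, so `S r s` is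
determined up to sign by its level, and the second gives `S (N + 2) 0 = -S N 2`.  As also
`S (N + 2) 0 = -S (N + 1) 1 = S N 2`, this corner vanishes. -/
theorem eq_zero_of_symm_of_lie_shift (h2 : IsSMulRegular L 2) {S : ℕ → ℕ → L} {h k : L}
    (symm : ∀ r s, S r s = S s r) (zero : S 0 0 = 0)
    (shift_one : ∀ r s, ⁅h, S r s⁆ = S (r + 1) s + S r (s + 1))
    (shift_two : ∀ r s, ⁅k, S r s⁆ = S (r + 2) s + S r (s + 2)) (r s : ℕ) : S r s = 0 := by
  induction hN : r + s using Nat.strong_induction_on generalizing r s with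
  | _ N ih =>
    have alternate : ∀ r s, r + s + 1 = N → S (r + 1) s = -S r (s + 1) := fun r s h ↦ by
      rw [eq_neg_iff_add_eq_zero, ← shift_one, ih _ (by lia) r s rfl, lie_zero]
    have corner : S N 0 = 0 := by
      match N, ih, alternate with
      | 0, _, _ => exact zero
      | 1, _, alternate =>
        have double : S 1 0 + S 1 0 = 0 := by
          nth_rewrite 1 [alternate 0 0 rfl]
          rw [symm 0, neg_add_cancel]
        exact h2.right_eq_zero_of_smul (by rwa [two_nsmul])
      | N + 2, ih, alternate =>
        have twice : S (N + 2) 0 = S N 2 := by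
          rw [alternate (N + 1) 0 rfl, alternate N 1 rfl, neg_neg]
        have sum : S (N + 2) 0 + S N 2 = 0 := by
          rw [← shift_two, ih N (by lia) N 0 rfl, lie_zero]
        rw [← twice] at sum
        exact h2.right_eq_zero_of_smul (by rwa [two_nsmul])
    clear ih
    induction s generalizing r with
    | zero => rwa [show r = N by lia]
    | succ s ih => rw [← neg_eq_zero, ← alternate r s (by lia), ih _ (by lia)]

end LieShift

section Shift

attribute [local instance] LieRing.ofAssociativeRing

variable {A : Type*} [Ring A]

theorem mul_lie_eq (x y z : A) : ⁅x * y, z⁆ = x * ⁅y, z⁆ + ⁅x, z⁆ * y := by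
  simp only [Ring.lie_def]
  noncomm_ring

variable [Algebra ℂ A]

theorem isSMulRegular_two : IsSMulRegular A 2 := by
  intro x y hxy
  have cast : (2 : ℂ) • x = (2 : ℂ) • y := by simpa only [two_smul] using hxy
  exact smul_right_injective A (two_ne_zero (α := ℂ)) cast

/-- The element whose commutator raises the degree of `E` by one, if `D` acts on `E` with
sign `ε` (see `IsCartanAction`): a correction of `ε • D 2`. -/
def shiftOne (ε : ℂ) (D : ℕ → A) : A :=
  (ε / 2) • ((2 : ℂ) • D 2 - D 1 * D 1 - ε • D 1)

/-- The element whose commutator raises the degree of `E` by two, if `D` acts on `E` with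
sign `ε` (see `IsCartanAction`): a correction of `ε • D 3`. -/
def shiftTwo (ε : ℂ) (D : ℕ → A) : A :=
  (ε / 3) • ((3 : ℂ) • D 3 - (3 : ℂ) • (D 1 * D 2) + D 1 * D 1 * D 1 - (3 : ℂ) • shiftOne ε D - D 1)

theorem shiftOne_lie_eq_zero (ε : ℂ) {D : ℕ → A} {x : A} (hx : ∀ r, ⁅D r, x⁆ = 0) :
    ⁅shiftOne ε D, x⁆ = 0 := by
  simp only [shiftOne, smul_lie, sub_lie, mul_lie_eq, hx, mul_zero, zero_mul, add_zero, smul_zero,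
    sub_zero]

theorem shiftTwo_lie_eq_zero (ε : ℂ) {D : ℕ → A} {x : A} (hx : ∀ r, ⁅D r, x⁆ = 0) :
    ⁅shiftTwo ε D, x⁆ = 0 := by
  simp only [shiftTwo, smul_lie, sub_lie, add_lie, mul_lie_eq, hx, shiftOne_lie_eq_zero ε hx,
    mul_zero, zero_mul, add_zero, smul_zero, sub_zero]

/-- The relation between some `D_i^{(r)}` and `E_j^{(s)}`, with `ε = ±1`, where `i ∈ {j, j + 1}`. -/
structure IsCartanAction (ε : ℂ) (D E : ℕ → A) : Prop where
  sign_mul_self : ε * ε = 1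
  zero : D 0 = 1
  lie : ∀ r s, 1 ≤ s → ⁅D r, E s⁆ = ε • ∑ t ∈ Finset.range r, D t * E (r + s - 1 - t)

namespace IsCartanAction

variable {ε : ℂ} {D E : ℕ → A} (H : IsCartanAction ε D E) {s : ℕ} (hs : 1 ≤ s)
include H hs

theorem lie_one : ⁅D 1, E s⁆ = ε • E s := by
  rw [H.lie 1 s hs, Finset.sum_range_one, H.zero, one_mul, show 1 + s - 1 - 0 = s by lia]

theorem lie_two : ⁅D 2, E s⁆ = ε • (E (s + 1) + D 1 * E s) := by
  rw [H.lie 2 s hs, Finset.sum_range_succ, Finset.sum_range_one, H.zero, one_mul,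
    show 2 + s - 1 - 0 = s + 1 by lia, show 2 + s - 1 - 1 = s by lia]

theorem lie_three : ⁅D 3, E s⁆ = ε • (E (s + 2) + D 1 * E (s + 1) + D 2 * E s) := by
  rw [H.lie 3 s hs, Finset.sum_range_succ, Finset.sum_range_succ, Finset.sum_range_one, H.zero,
    one_mul, show 3 + s - 1 - 0 = s + 2 by lia, show 3 + s - 1 - 1 = s + 1 by lia,
    show 3 + s - 1 - 2 = s by lia]

theorem mul_D_one : E s * D 1 = D 1 * E s - ε • E s := by
  rw [← H.lie_one hs, Ring.lie_def]
  abel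

theorem mul_D_two : E s * D 2 = D 2 * E s - ε • (E (s + 1) + D 1 * E s) := by
  rw [← H.lie_two hs, Ring.lie_def]
  abel

theorem D_one_sq_lie : ⁅D 1 * D 1, E s⁆ = (2 * ε) • (D 1 * E s) - E s := by
  rw [mul_lie_eq, H.lie_one hs, smul_mul_assoc, H.mul_D_one hs, mul_smul_comm, smul_sub, smul_smul,
    H.sign_mul_self]
  module

theorem D_one_cube_lie : ⁅D 1 * D 1 * D 1, E s⁆ =
    (3 * ε) • (D 1 * (D 1 * E s)) - (3 : ℂ) • (D 1 * E s) + ε • E s := by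
  rw [mul_lie_eq, H.D_one_sq_lie hs, H.lie_one hs, sub_mul, smul_mul_assoc, mul_assoc, mul_assoc,
    H.mul_D_one hs, mul_sub, mul_smul_comm, mul_smul_comm, smul_sub, smul_smul, mul_assoc 2 ε ε,
    H.sign_mul_self]
  module

theorem D_one_mul_D_two_lie : ⁅D 1 * D 2, E s⁆ =
    ε • (D 1 * E (s + 1) + D 1 * (D 1 * E s)) + ε • (D 2 * E s) - (E (s + 1) + D 1 * E s) := by
  rw [mul_lie_eq, H.lie_one hs, H.lie_two hs, smul_mul_assoc, H.mul_D_two hs, mul_smul_comm,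
    mul_add, smul_sub, smul_smul, H.sign_mul_self, one_smul]
  abel

theorem shiftOne_lie : ⁅shiftOne ε D, E s⁆ = E (s + 1) := by
  have unscaled : ⁅(2 : ℂ) • D 2 - D 1 * D 1 - ε • D 1, E s⁆ = (2 * ε) • E (s + 1) := by
    rw [sub_lie, sub_lie, smul_lie, smul_lie, H.lie_one hs, H.lie_two hs, H.D_one_sq_lie hs,
      smul_smul ε ε, H.sign_mul_self]
    module
  rw [shiftOne, smul_lie, unscaled, smul_smul, show ε / 2 * (2 * ε) = ε * ε by ring,
    H.sign_mul_self, one_smul]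

theorem shiftTwo_lie : ⁅shiftTwo ε D, E s⁆ = E (s + 2) := by
  have unscaled : ⁅(3 : ℂ) • D 3 - (3 : ℂ) • (D 1 * D 2) + D 1 * D 1 * D 1
      - (3 : ℂ) • shiftOne ε D - D 1, E s⁆ = (3 * ε) • E (s + 2) := by
    rw [sub_lie, sub_lie, add_lie, sub_lie, smul_lie, smul_lie, smul_lie, H.shiftOne_lie hs,
      H.D_one_mul_D_two_lie hs, H.D_one_cube_lie hs, H.lie_one hs, H.lie_three hs]
    module
  rw [shiftTwo, smul_lie, unscaled, smul_smul, show ε / 3 * (3 * ε) = ε * ε by ring,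
    H.sign_mul_self, one_smul]

end IsCartanAction

end Shift

section HalfSeed

attribute [local instance] LieRing.ofAssociativeRing

theorem lo_ne_hi {n : ℕ} (j : Fin (n - 1)) : lo j ≠ hi j := by
  simp [lo, hi]

variable {A : Type*} [Ring A]

/-- Those of Drinfeld's relations between the `D_i^{(r)}` and the `E_j^{(s)}` that imply all the
others between them; apart from the `D_i`, they are of lowest degree. -/
structure IsHalfSeed {n : ℕ} (D : Fin n → ℕ → A) (E : Fin (n - 1) → ℕ → A) : Prop where
  D_zero : ∀ i, D i 0 = 1
  D_D : ∀ i j r s, ⁅D i r, D j s⁆ = 0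
  D_lo_E : ∀ j r s, 1 ≤ s →
    ⁅D (lo j) r, E j s⁆ = ∑ t ∈ Finset.range r, D (lo j) t * E j (r + s - 1 - t)
  D_E_one : ∀ i j r, ⁅D i r, E j 1⁆ =
    (delta i (lo j) - delta i (hi j)) • ∑ t ∈ Finset.range r, D i t * E j (r + 1 - 1 - t)
  E_E_self : ∀ j s, 1 ≤ s → ⁅E j 1, E j s⁆ = ∑ t ∈ Finset.Icc 1 (s - 1), E j t * E j (s - t)
  E_E_far : ∀ i j : Fin (n - 1), 1 < |(i : ℤ) - (j : ℤ)| → ⁅E i 1, E j 1⁆ = 0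
  E_E_next : ∀ i j : Fin (n - 1), (j : ℕ) = i + 1 →
    ⁅E i 1, E j 2⁆ - ⁅E i 2, E j 1⁆ = -(E i 1 * E j 1)
  serre : ∀ i j : Fin (n - 1), |(i : ℤ) - (j : ℤ)| = 1 → ⁅E i 1, ⁅E i 1, E j 1⁆⁆ = 0

theorem sum_Icc_one {M : Type*} [AddCommMonoid M] (f : ℕ → M) (m : ℕ) :
    ∑ t ∈ Finset.Icc 1 m, f t = ∑ t ∈ Finset.range m, f (t + 1) := by
  rw [Finset.range_eq_Ico, Finset.sum_Ico_add' f 0 m 1]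
  rfl

theorem lie_sum_mul_of_lie_shift {h : A} {e : ℕ → A} (shift : ∀ s, 1 ≤ s → ⁅h, e s⁆ = e (s + 1))
    {m p : ℕ} (hp : p < m) :
    ⁅h, ∑ t ∈ Finset.Icc 1 p, e t * e (m - t)⁆ + e 1 * e m =
      ∑ t ∈ Finset.Icc 1 (p + 1), e t * e (m + 1 - t)
        + ∑ t ∈ Finset.Icc 1 p, e t * e (m + 1 - t) := by
  rw [lie_sum, sum_Icc_one, sum_Icc_one, sum_Icc_one, Finset.sum_range_succ', add_right_comm,
    ← Finset.sum_add_distrib]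
  refine congrArg₂ _ (Finset.sum_congr rfl fun t ht ↦ ?_) rfl
  have ht := Finset.mem_range.1 ht
  rw [lie_mul_eq, shift _ (by lia), shift _ (by lia), show m - (t + 1) + 1 = m + 1 - (t + 1) by lia,
    show m - (t + 1) = m + 1 - (t + 1 + 1) by lia]

namespace IsHalfSeed

variable [Algebra ℂ A] {n : ℕ} {D : Fin n → ℕ → A} {E : Fin (n - 1) → ℕ → A} (H : IsHalfSeed D E)
include H

theorem isCartanAction_lo (j : Fin (n - 1)) : IsCartanAction 1 (D (lo j)) (E j) :=
  ⟨one_mul 1, H.D_zero _, fun r s hs ↦ by rw [H.D_lo_E j r s hs, one_smul]⟩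

theorem lie_D_E (i : Fin n) (j : Fin (n - 1)) (r : ℕ) {s : ℕ} (hs : 1 ≤ s) : ⁅D i r, E j s⁆ =
    (delta i (lo j) - delta i (hi j)) • ∑ t ∈ Finset.range r, D i t * E j (r + s - 1 - t) := by
  have lie_D : ∀ r, ⁅shiftOne 1 (D (lo j)), D i r⁆ = 0 := fun r ↦
    shiftOne_lie_eq_zero _ fun t ↦ H.D_D _ _ _ _
  have lie_E {s : ℕ} (hs : 1 ≤ s) : ⁅shiftOne 1 (D (lo j)), E j s⁆ = E j (s + 1) :=
    (H.isCartanAction_lo j).shiftOne_lie hs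
  induction s, hs using Nat.le_induction with
  | base => exact H.D_E_one i j r
  | succ s hs ih =>
    have leibniz := leibniz_lie (shiftOne 1 (D (lo j))) (D i r) (E j s)
    rw [lie_D, zero_lie, zero_add, lie_E hs, ih, lie_zsmul, lie_sum] at leibniz
    rw [← leibniz]
    refine congrArg _ (Finset.sum_congr rfl fun t ht ↦ ?_)
    have ht := Finset.mem_range.1 ht
    rw [lie_mul_eq, lie_D, zero_mul, zero_add, lie_E (by lia),
      show r + s - 1 - t + 1 = r + (s + 1) - 1 - t by lia]

theorem isCartanAction_hi (j : Fin (n - 1)) : IsCartanAction (-1) (D (hi j)) (E j) :=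
  ⟨by norm_num, H.D_zero _, fun r s hs ↦ by
    rw [H.lie_D_E _ j r hs]; simp [delta, (lo_ne_hi j).symm]⟩

theorem exists_isCartanAction {i j : Fin (n - 1)} (hij : i ≠ j) :
    ∃ (a : Fin n) (ε : ℂ), a ≠ lo j ∧ a ≠ hi j ∧ IsCartanAction ε (D a) (E i) := by
  rw [ne_eq, Fin.ext_iff] at hij
  by_cases h : (i : ℕ) = j + 1
  · refine ⟨hi i, -1, ?_, ?_, H.isCartanAction_hi i⟩ <;> simp only [lo, hi, ne_eq, Fin.mk.injEq] <;>
      lia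
  · refine ⟨lo i, 1, ?_, ?_, H.isCartanAction_lo i⟩ <;> simp only [lo, hi, ne_eq, Fin.mk.injEq] <;>
      lia

theorem exists_lie_shift {i j : Fin (n - 1)} (hij : i ≠ j) : ∃ h k : A,
    (∀ s, 1 ≤ s → ⁅h, E i s⁆ = E i (s + 1)) ∧ (∀ s, 1 ≤ s → ⁅k, E i s⁆ = E i (s + 2)) ∧
    (∀ s, 1 ≤ s → ⁅h, E j s⁆ = 0) ∧ ∀ s, 1 ≤ s → ⁅k, E j s⁆ = 0 := by
  obtain ⟨a, ε, ne_lo, ne_hi, act⟩ := H.exists_isCartanAction hij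
  have lie_D_E_j {s : ℕ} (hs : 1 ≤ s) (r : ℕ) : ⁅D a r, E j s⁆ = 0 := by
    rw [H.lie_D_E _ _ _ hs]
    simp [delta, ne_lo, ne_hi]
  exact ⟨shiftOne ε (D a), shiftTwo ε (D a), fun s ↦ act.shiftOne_lie, fun s ↦ act.shiftTwo_lie,
    fun s hs ↦ shiftOne_lie_eq_zero _ (lie_D_E_j hs),
    fun s hs ↦ shiftTwo_lie_eq_zero _ (lie_D_E_j hs)⟩

theorem lie_E_E_self (j : Fin (n - 1)) {r s : ℕ} (hr : 1 ≤ r) (hs : 1 ≤ s) : ⁅E j r, E j s⁆ =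
    ∑ t ∈ Finset.Icc 1 (s - 1), E j t * E j (r + s - 1 - t)
      - ∑ t ∈ Finset.Icc 1 (r - 1), E j t * E j (r + s - 1 - t) := by
  have shift : ∀ s, 1 ≤ s → ⁅shiftOne 1 (D (lo j)), E j s⁆ = E j (s + 1) :=
    fun s ↦ (H.isCartanAction_lo j).shiftOne_lie
  induction r, hr using Nat.le_induction generalizing s with
  | base => simp [H.E_E_self j s hs]
  | succ r hr ih =>
    have leibniz := leibniz_lie (shiftOne 1 (D (lo j))) (E j r) (E j s)
    rw [shift r hr, shift s hs, ih hs, ih (s := s + 1) (by lia), lie_sub] at leibniz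
    have upper := lie_sum_mul_of_lie_shift shift (show s - 1 < r + s - 1 by lia)
    have lower := lie_sum_mul_of_lie_shift shift (show r - 1 < r + s - 1 by lia)
    simp only [show s - 1 + 1 = s by lia, show r - 1 + 1 = r by lia, Nat.add_sub_cancel,
      show r + s - 1 + 1 = r + s by lia, show r + 1 + s - 1 = r + s by lia,
      show r + (s + 1) - 1 = r + s by lia] at upper lower leibniz ⊢
    linear_combination (norm := abel) upper - lower - leibniz

theorem lie_E_E_of_far {i j : Fin (n - 1)} (hij : 1 < |(i : ℤ) - (j : ℤ)|) {r s : ℕ} (hr : 1 ≤ r)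
    (hs : 1 ≤ s) : ⁅E i r, E j s⁆ = 0 := by
  have hne : i ≠ j := by rintro rfl; simp at hij
  obtain ⟨h, -, h_i, -, h_j, -⟩ := H.exists_lie_shift hne
  obtain ⟨k, -, k_j, -, k_i, -⟩ := H.exists_lie_shift hne.symm
  have first : ⁅E i 1, E j s⁆ = 0 :=
    eq_zero_of_lie_shift (f := fun s ↦ ⁅E i 1, E j s⁆) (h := k) (H.E_E_far i j hij)
      (fun s hs ↦ by rw [leibniz_lie, k_j s hs, k_i 1 le_rfl, zero_lie, zero_add]) hs
  exact eq_zero_of_lie_shift (f := fun r ↦ ⁅E i r, E j s⁆) (h := h) first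
    (fun r hr ↦ by rw [leibniz_lie, h_i r hr, h_j s hs, lie_zero, add_zero]) hr

theorem lie_E_E_of_next {i j : Fin (n - 1)} (hij : (j : ℕ) = i + 1) {r s : ℕ} (hr : 1 ≤ r)
    (hs : 1 ≤ s) : ⁅E i r, E j (s + 1)⁆ - ⁅E i (r + 1), E j s⁆ = -(E i r * E j s) := by
  have hne : i ≠ j := by rintro rfl; lia
  obtain ⟨h, -, h_i, -, h_j, -⟩ := H.exists_lie_shift hne
  obtain ⟨k, -, k_j, -, k_i, -⟩ := H.exists_lie_shift hne.symm
  let f (r s : ℕ) : A := ⁅E i r, E j (s + 1)⁆ - ⁅E i (r + 1), E j s⁆ + E i r * E j s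
  have first : f 1 s = 0 := by
    refine eq_zero_of_lie_shift (f := f 1) (h := k) ?_ (fun s hs ↦ ?_) hs
    · rw [← neg_eq_iff_add_eq_zero.1 (H.E_E_next i j hij).symm, add_comm]
    · simp only [f, lie_add, lie_sub, leibniz_lie k, lie_mul_eq, k_j s hs, k_j (s + 1) (by lia),
        k_i 1 le_rfl, k_i (1 + 1) (by lia), zero_lie, zero_mul, zero_add]
  rw [← sub_eq_zero, sub_neg_eq_add]
  refine eq_zero_of_lie_shift (f := fun r ↦ f r s) (h := h) first (fun r hr ↦ ?_) hr
  simp only [f, lie_add, lie_sub, leibniz_lie h, lie_mul_eq, h_i r hr, h_i (r + 1) (by lia),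
    h_j s hs, h_j (s + 1) (by lia), lie_zero, mul_zero, add_zero]

theorem serre_E {i j : Fin (n - 1)} (hij : |(i : ℤ) - (j : ℤ)| = 1) {r s t : ℕ}
    (hr : 1 ≤ r) (hs : 1 ≤ s) (ht : 1 ≤ t) :
    ⁅E i r, ⁅E i s, E j t⁆⁆ + ⁅E i s, ⁅E i r, E j t⁆⁆ = 0 := by
  have hne : i ≠ j := by rintro rfl; simp at hij
  obtain ⟨h, h', h_i, h'_i, h_j, h'_j⟩ := H.exists_lie_shift hne
  obtain ⟨k, -, k_j, -, k_i, -⟩ := H.exists_lie_shift hne.symm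
  have lowest : ⁅E i 1, ⁅E i 1, E j t⁆⁆ = 0 := by
    refine eq_zero_of_lie_shift (f := fun t ↦ ⁅E i 1, ⁅E i 1, E j t⁆⁆) (h := k) (H.serre i j hij)
      (fun t ht ↦ ?_) ht
    simp only [leibniz_lie k, k_i 1 le_rfl, k_j t ht, zero_lie, zero_add]
  have main := eq_zero_of_symm_of_lie_shift isSMulRegular_two (h := h) (k := h')
    (S := fun r s ↦ ⁅E i (r + 1), ⁅E i (s + 1), E j t⁆⁆ + ⁅E i (s + 1), ⁅E i (r + 1), E j t⁆⁆)
    (fun r s ↦ add_comm _ _) (by simp only [zero_add, lowest, add_zero])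
    (fun r s ↦ by
      simp only [lie_add, leibniz_lie h, h_i _ (Nat.le_add_left 1 _), h_j t ht, lie_zero, add_zero]
      abel)
    (fun r s ↦ by
      simp only [lie_add, leibniz_lie h', h'_i _ (Nat.le_add_left 1 _), h'_j t ht, lie_zero,
        add_zero, add_right_comm _ 1 2]
      abel)
    (r - 1) (s - 1)
  simpa only [Nat.sub_add_cancel hr, Nat.sub_add_cancel hs] using main

end IsHalfSeed

end HalfSeed

section DrinfeldFamily

attribute [local instance] LieRing.ofAssociativeRing

variable {A : Type*} [Ring A] {n : ℕ}

/-- Elements of a ring that satisfy Drinfeld's relations, with `E_j^{(0)} = F_j^{(0)} = 0`; the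
last condition matches the dummy values in `frE` and `frF`. -/
structure IsDrinfeld (D Dt : Fin n → ℕ → A) (E F : Fin (n - 1) → ℕ → A) : Prop where
  intro ::
  E_zero : ∀ j, E j 0 = 0
  F_zero : ∀ j, F j 0 = 0
  D_zero : ∀ i, D i 0 = 1
  D_Dt : ∀ i r, ∑ t ∈ Finset.Icc 0 r, D i t * Dt i (r - t) = -delta r 0 • 1
  D_D : ∀ i j r s, ⁅D i r, D j s⁆ = 0
  E_F : ∀ i j r s, 1 ≤ r → 1 ≤ s → ⁅E i r, F j s⁆ =
    delta i j • ∑ t ∈ Finset.Icc 0 (r + s - 1), Dt (lo i) t * D (hi i) (r + s - 1 - t)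
  D_E : ∀ i j r s, 1 ≤ s → ⁅D i r, E j s⁆ =
    (delta i (lo j) - delta i (hi j)) • ∑ t ∈ Finset.range r, D i t * E j (r + s - 1 - t)
  D_F : ∀ i j r s, 1 ≤ s → ⁅D i r, F j s⁆ =
    (delta i (hi j) - delta i (lo j)) • ∑ t ∈ Finset.range r, F j (r + s - 1 - t) * D i t
  E_E : ∀ j r s, 1 ≤ r → 1 ≤ s → ⁅E j r, E j s⁆ =
    ∑ t ∈ Finset.Icc 1 (s - 1), E j t * E j (r + s - 1 - t)
      - ∑ t ∈ Finset.Icc 1 (r - 1), E j t * E j (r + s - 1 - t)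
  F_F : ∀ j r s, 1 ≤ r → 1 ≤ s → ⁅F j r, F j s⁆ =
    ∑ t ∈ Finset.Icc 1 (r - 1), F j (r + s - 1 - t) * F j t
      - ∑ t ∈ Finset.Icc 1 (s - 1), F j (r + s - 1 - t) * F j t
  E_next : ∀ i j : Fin (n - 1), (j : ℕ) = i + 1 → ∀ r s, 1 ≤ r → 1 ≤ s →
    ⁅E i r, E j (s + 1)⁆ - ⁅E i (r + 1), E j s⁆ = -(E i r * E j s)
  F_next : ∀ i j : Fin (n - 1), (j : ℕ) = i + 1 → ∀ r s, 1 ≤ r → 1 ≤ s →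
    ⁅F i (r + 1), F j s⁆ - ⁅F i r, F j (s + 1)⁆ = -(F j s * F i r)
  E_far : ∀ i j : Fin (n - 1), 1 < |(i : ℤ) - (j : ℤ)| → ∀ r s, 1 ≤ r → 1 ≤ s → ⁅E i r, E j s⁆ = 0
  F_far : ∀ i j : Fin (n - 1), 1 < |(i : ℤ) - (j : ℤ)| → ∀ r s, 1 ≤ r → 1 ≤ s → ⁅F i r, F j s⁆ = 0
  E_serre : ∀ i j : Fin (n - 1), |(i : ℤ) - (j : ℤ)| = 1 → ∀ r s t, 1 ≤ r → 1 ≤ s → 1 ≤ t →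
    ⁅E i r, ⁅E i s, E j t⁆⁆ + ⁅E i s, ⁅E i r, E j t⁆⁆ = 0
  F_serre : ∀ i j : Fin (n - 1), |(i : ℤ) - (j : ℤ)| = 1 → ∀ r s t, 1 ≤ r → 1 ≤ s → 1 ≤ t →
    ⁅F i r, ⁅F i s, F j t⁆⁆ + ⁅F i s, ⁅F i r, F j t⁆⁆ = 0

section Presentation

variable [Algebra ℂ A]

theorem isDrinfeld_iff (θ : FreeDr n →ₐ[ℂ] A) :
    IsDrinfeld (fun i r ↦ θ (frD i r)) (fun i r ↦ θ (frDt i r)) (fun j r ↦ θ (frE j r))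
        (fun j r ↦ θ (frF j r)) ↔
      ∀ ⦃x y⦄, DrinfeldRel n x y → θ x = θ y := by
  have map_lie (x y : FreeDr n) : θ ⁅x, y⁆ = ⁅θ x, θ y⁆ := by
    simp only [Ring.lie_def, map_sub, map_mul]
  constructor
  · intro H x y rel
    induction rel with
    | r0 i => simpa using H.D_zero i
    | r1 i r => simpa using H.D_Dt i r
    | r2 i j r s => simpa [map_lie] using H.D_D i j r s
    | r3 i j r s hr hs => simpa [map_lie] using H.E_F i j r s hr hs
    | r4 i j r s hs => simpa [map_lie] using H.D_E i j r s hs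
    | r5 i j r s hs => simpa [map_lie] using H.D_F i j r s hs
    | r6 i r s hr hs => simpa [map_lie] using H.E_E i r s hr hs
    | r7 i r s hr hs => simpa [map_lie] using H.F_F i r s hr hs
    | r8 i j hij r s hr hs => simpa [map_lie] using H.E_next i j hij r s hr hs
    | r9 i j hij r s hr hs => simpa [map_lie] using H.F_next i j hij r s hr hs
    | r10 i j hij r s hr hs => simpa [map_lie] using H.E_far i j hij r s hr hs
    | r11 i j hij r s hr hs => simpa [map_lie] using H.F_far i j hij r s hr hs
    | r12 i j hij r s t hr hs ht =>
      simpa only [map_add, map_zero, map_lie] using H.E_serre i j hij r s t hr hs ht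
    | r13 i j hij r s t hr hs ht =>
      simpa only [map_add, map_zero, map_lie] using H.F_serre i j hij r s t hr hs ht
  · intro h
    exact {
      E_zero := fun _ ↦ map_zero θ
      F_zero := fun _ ↦ map_zero θ
      D_zero := fun i ↦ by simpa using h (.r0 i)
      D_Dt := fun i r ↦ by simpa using h (.r1 i r)
      D_D := fun i j r s ↦ by simpa [map_lie] using h (.r2 i j r s)
      E_F := fun i j r s hr hs ↦ by simpa [map_lie] using h (.r3 i j r s hr hs)
      D_E := fun i j r s hs ↦ by simpa [map_lie] using h (.r4 i j r s hs)
      D_F := fun i j r s hs ↦ by simpa [map_lie] using h (.r5 i j r s hs)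
      E_E := fun i r s hr hs ↦ by simpa [map_lie] using h (.r6 i r s hr hs)
      F_F := fun i r s hr hs ↦ by simpa [map_lie] using h (.r7 i r s hr hs)
      E_next := fun i j hij r s hr hs ↦ by simpa [map_lie] using h (.r8 i j hij r s hr hs)
      F_next := fun i j hij r s hr hs ↦ by simpa [map_lie] using h (.r9 i j hij r s hr hs)
      E_far := fun i j hij r s hr hs ↦ by simpa [map_lie] using h (.r10 i j hij r s hr hs)
      F_far := fun i j hij r s hr hs ↦ by simpa [map_lie] using h (.r11 i j hij r s hr hs)
      E_serre := fun i j hij r s t hr hs ht ↦ by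
        simpa only [map_add, map_zero, map_lie] using h (.r12 i j hij r s t hr hs ht)
      F_serre := fun i j hij r s t hr hs ht ↦ by
        simpa only [map_add, map_zero, map_lie] using h (.r13 i j hij r s t hr hs ht) }

theorem isDrinfeld_drMk (n : ℕ) :
    IsDrinfeld (fun i r ↦ drMk n (frD i r)) (fun i r ↦ drMk n (frDt i r))
      (fun j r ↦ drMk n (frE j r)) (fun j r ↦ drMk n (frF j r)) :=
  (isDrinfeld_iff (drMk n)).mpr fun _ _ rel ↦ RingQuot.mkAlgHom_rel ℂ rel

theorem IsDrinfeld.exists_lift {D Dt : Fin n → ℕ → A} {E F : Fin (n - 1) → ℕ → A}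
    (H : IsDrinfeld D Dt E F) : ∃ φ : DrinfeldYangian n →ₐ[ℂ] A,
      (∀ i r, φ (drMk n (frD i r)) = D i r) ∧ (∀ i r, φ (drMk n (frDt i r)) = Dt i r) ∧
      (∀ j r, φ (drMk n (frE j r)) = E j r) ∧ ∀ j r, φ (drMk n (frF j r)) = F j r := by
  let θ : FreeDr n →ₐ[ℂ] A := FreeAlgebra.lift ℂ fun
    | .D i r => D i r
    | .Dt i r => Dt i r
    | .E j r => E j (r + 1)
    | .F j r => F j (r + 1)
  have θ_D (i : Fin n) (r : ℕ) : θ (frD i r) = D i r := FreeAlgebra.lift_ι_apply _ _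
  have θ_Dt (i : Fin n) (r : ℕ) : θ (frDt i r) = Dt i r := FreeAlgebra.lift_ι_apply _ _
  have θ_E (j : Fin (n - 1)) : ∀ r, θ (frE j r) = E j r
    | 0 => (map_zero θ).trans (H.E_zero j).symm
    | _ + 1 => FreeAlgebra.lift_ι_apply _ _
  have θ_F (j : Fin (n - 1)) : ∀ r, θ (frF j r) = F j r
    | 0 => (map_zero θ).trans (H.F_zero j).symm
    | _ + 1 => FreeAlgebra.lift_ι_apply _ _
  have respects : ∀ ⦃x y⦄, DrinfeldRel n x y → θ x = θ y :=
    (isDrinfeld_iff θ).mp (by simpa only [θ_D, θ_Dt, θ_E, θ_F] using H)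
  have lift_drMk (x : FreeDr n) : RingQuot.liftAlgHom ℂ ⟨θ, respects⟩ (drMk n x) = θ x :=
    RingQuot.liftAlgHom_mkAlgHom_apply ℂ θ respects x
  exact ⟨RingQuot.liftAlgHom ℂ ⟨θ, respects⟩, fun i r ↦ (lift_drMk _).trans (θ_D i r),
    fun i r ↦ (lift_drMk _).trans (θ_Dt i r), fun j r ↦ (lift_drMk _).trans (θ_E j r),
    fun j r ↦ (lift_drMk _).trans (θ_F j r)⟩

end Presentation

section Halves

open MulOpposite

theorem op_lie (x y : A) : ⁅op x, op y⁆ = -op ⁅x, y⁆ := by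
  simp only [Ring.lie_def, op_sub, op_mul, neg_sub]

variable [Algebra ℂ A] {D Dt : Fin n → ℕ → A} {E F : Fin (n - 1) → ℕ → A}

theorem shiftOne_op (ε : ℂ) (D : ℕ → A) :
    shiftOne ε (fun r ↦ op (D r)) = op (shiftOne ε D) := by
  simp [shiftOne, op_smul]

namespace IsHalfSeed

section Opposite

variable (Hop : IsHalfSeed (fun i r ↦ op (D i r)) (fun j r ↦ op (F j r)))
include Hop

theorem lie_D_F (i : Fin n) (j : Fin (n - 1)) (r : ℕ) {s : ℕ} (hs : 1 ≤ s) :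
    ⁅D i r, F j s⁆ = (delta i (hi j) - delta i (lo j)) •
      ∑ t ∈ Finset.range r, F j (r + s - 1 - t) * D i t := by
  apply op_injective
  rw [← neg_inj, ← op_lie, Hop.lie_D_E i j r hs, op_smul, ← neg_smul, neg_sub]
  simp only [Finset.op_sum, op_mul]

theorem lie_F_F_self (j : Fin (n - 1)) {r s : ℕ} (hr : 1 ≤ r) (hs : 1 ≤ s) : ⁅F j r, F j s⁆ =
    ∑ t ∈ Finset.Icc 1 (r - 1), F j (r + s - 1 - t) * F j t
      - ∑ t ∈ Finset.Icc 1 (s - 1), F j (r + s - 1 - t) * F j t := by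
  apply op_injective
  rw [← neg_inj, ← op_lie, Hop.lie_E_E_self j hr hs]
  simp only [op_sub, Finset.op_sum, op_mul, neg_sub]

theorem lie_F_F_of_next {i j : Fin (n - 1)} (hij : (j : ℕ) = i + 1) {r s : ℕ} (hr : 1 ≤ r)
    (hs : 1 ≤ s) : ⁅F i (r + 1), F j s⁆ - ⁅F i r, F j (s + 1)⁆ = -(F j s * F i r) := by
  apply op_injective
  rw [op_neg, op_mul, ← Hop.lie_E_E_of_next hij hr hs, op_lie, op_lie, neg_sub_neg, op_sub]

theorem lie_F_F_of_far {i j : Fin (n - 1)} (hij : 1 < |(i : ℤ) - (j : ℤ)|) {r s : ℕ} (hr : 1 ≤ r)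
    (hs : 1 ≤ s) : ⁅F i r, F j s⁆ = 0 := by
  apply op_injective
  rw [← neg_inj, ← op_lie, Hop.lie_E_E_of_far hij hr hs, op_zero, neg_zero]

theorem serre_F {i j : Fin (n - 1)} (hij : |(i : ℤ) - (j : ℤ)| = 1) {r s t : ℕ}
    (hr : 1 ≤ r) (hs : 1 ≤ s) (ht : 1 ≤ t) :
    ⁅F i r, ⁅F i s, F j t⁆⁆ + ⁅F i s, ⁅F i r, F j t⁆⁆ = 0 := by
  apply op_injective
  simpa only [op_lie, lie_neg, neg_neg, op_add, op_zero] using Hop.serre_E hij hr hs ht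

theorem shiftOne_lie_F (j : Fin (n - 1)) {s : ℕ} (hs : 1 ≤ s) :
    ⁅shiftOne 1 (D (lo j)), F j s⁆ = -F j (s + 1) := by
  apply op_injective
  rw [op_neg, ← (Hop.isCartanAction_lo j).shiftOne_lie hs, shiftOne_op, op_lie, neg_neg]

end Opposite

variable (H : IsHalfSeed D E) (Hop : IsHalfSeed (fun i r ↦ op (D i r)) (fun j r ↦ op (F j r)))
include H Hop

theorem lie_E_F_of_ne {i j : Fin (n - 1)} (hij : i ≠ j) {r s : ℕ} (hr : 1 ≤ r) (hs : 1 ≤ s)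
    (lowest : ⁅E i 1, F j s⁆ = 0) : ⁅E i r, F j s⁆ = 0 := by
  obtain ⟨a, ε, ne_lo, ne_hi, act⟩ := H.exists_isCartanAction hij
  have lie_D_F : ∀ r, ⁅D a r, F j s⁆ = 0 := fun r ↦ by
    rw [Hop.lie_D_F a j r hs]
    simp [delta, ne_lo, ne_hi]
  exact eq_zero_of_lie_shift (f := fun r ↦ ⁅E i r, F j s⁆) (h := shiftOne ε (D a)) lowest
    (fun r hr ↦ by
      rw [leibniz_lie, act.shiftOne_lie hr, shiftOne_lie_eq_zero _ lie_D_F, lie_zero, add_zero]) hr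

/-- The shift element commutes with the right side, whence `⁅E (r + 1), F s⁆ = ⁅E r, F (s + 1)⁆`. -/
theorem lie_E_F_self (D_Dt : ∀ i j r s, ⁅D i r, Dt j s⁆ = 0) (j : Fin (n - 1))
    (lowest : ∀ s, 1 ≤ s → ⁅E j 1, F j s⁆ =
      ∑ t ∈ Finset.Icc 0 s, Dt (lo j) t * D (hi j) (s - t))
    {r s : ℕ} (hr : 1 ≤ r) (hs : 1 ≤ s) : ⁅E j r, F j s⁆ =
      ∑ t ∈ Finset.Icc 0 (r + s - 1), Dt (lo j) t * D (hi j) (r + s - 1 - t) := by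
  have lie_rhs (m : ℕ) : ⁅shiftOne 1 (D (lo j)),
      ∑ t ∈ Finset.Icc 0 m, Dt (lo j) t * D (hi j) (m - t)⁆ = 0 := by
    rw [lie_sum]
    refine Finset.sum_eq_zero fun t _ ↦ ?_
    rw [lie_mul_eq, shiftOne_lie_eq_zero _ fun r ↦ D_Dt _ _ _ _,
      shiftOne_lie_eq_zero _ fun r ↦ H.D_D _ _ _ _, zero_mul, mul_zero, add_zero]
  induction r, hr using Nat.le_induction generalizing s with
  | base => rw [lowest s hs, show 1 + s - 1 = s by lia]
  | succ r hr ih =>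
    have leibniz := leibniz_lie (shiftOne 1 (D (lo j))) (E j r) (F j s)
    rw [(H.isCartanAction_lo j).shiftOne_lie hr, Hop.shiftOne_lie_F j hs, ih hs, lie_rhs, lie_neg,
      ih (s := s + 1) (by lia), ← sub_eq_add_neg] at leibniz
    rw [sub_eq_zero.mp leibniz.symm, show r + (s + 1) - 1 = r + 1 + s - 1 by lia]

theorem isDrinfeld (E_zero : ∀ j, E j 0 = 0) (F_zero : ∀ j, F j 0 = 0)
    (D_mul_Dt : ∀ i r, ∑ t ∈ Finset.Icc 0 r, D i t * Dt i (r - t) = -delta r 0 • 1)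
    (D_Dt : ∀ i j r s, ⁅D i r, Dt j s⁆ = 0)
    (E_one_F_self : ∀ j s, 1 ≤ s → ⁅E j 1, F j s⁆ =
      ∑ t ∈ Finset.Icc 0 s, Dt (lo j) t * D (hi j) (s - t))
    (E_one_F_of_ne : ∀ i j s, i ≠ j → ⁅E i 1, F j s⁆ = 0) : IsDrinfeld D Dt E F where
  E_zero := E_zero
  F_zero := F_zero
  D_zero := H.D_zero
  D_Dt := D_mul_Dt
  D_D := H.D_D
  E_F i j r s hr hs := by
    rcases eq_or_ne i j with rfl | hij
    · rw [H.lie_E_F_self Hop D_Dt i (E_one_F_self i) hr hs, delta, if_pos rfl, one_smul]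
    · rw [H.lie_E_F_of_ne Hop hij hr hs (E_one_F_of_ne i j s hij), delta, if_neg hij, zero_smul]
  D_E i j r _ hs := H.lie_D_E i j r hs
  D_F i j r _ hs := Hop.lie_D_F i j r hs
  E_E j _ _ hr hs := H.lie_E_E_self j hr hs
  F_F j _ _ hr hs := Hop.lie_F_F_self j hr hs
  E_next _ _ hij _ _ hr hs := H.lie_E_E_of_next hij hr hs
  F_next _ _ hij _ _ hr hs := Hop.lie_F_F_of_next hij hr hs
  E_far _ _ hij _ _ hr hs := H.lie_E_E_of_far hij hr hs
  F_far _ _ hij _ _ hr hs := Hop.lie_F_F_of_far hij hr hs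
  E_serre _ _ hij _ _ _ hr hs ht := H.serre_E hij hr hs ht
  F_serre _ _ hij _ _ _ hr hs ht := Hop.serre_F hij hr hs ht

end IsHalfSeed

end Halves

end DrinfeldFamily

/-! ### Drinfeld's relations for Gauss factors -/

section GaussDrinfeld

attribute [local instance] LieRing.ofAssociativeRing

open PowerSeries MulOpposite

variable {A : Type*} [Ring A]

theorem IsRTT.lie_one {ι : Type*} [DecidableEq ι] {T : ι → ι → ℕ → A} (hT : IsRTT T) (a b : ι)
    (r : ℕ) : ActsAsUnit (T a b 1) a b (fun i j ↦ T i j r) := by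
  intro i j
  have rel := hT.rel a b i j 0 r
  have lie_zero : ⁅T a b 0, T i j (r + 1)⁆ = 0 := by
    rw [hT.zero]; split_ifs <;> simp [Ring.lie_def]
  rw [lie_zero, sub_zero] at rel
  rw [rel, hT.zero, hT.zero]
  simp only [ite_mul, mul_ite, one_mul, zero_mul, mul_one, mul_zero, eq_comm]

theorem coeff_mul_of_constantCoeff_eq_zero {f g : PowerSeries A} (hg : constantCoeff g = 0)
    (r : ℕ) : coeff r (f * g) = ∑ t ∈ Finset.range r, coeff t f * coeff (r - t) g := by
  rw [coeff_mul, Finset.Nat.sum_antidiagonal_eq_sum_range_succ_mk, Finset.sum_range_succ]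
  simp [hg]

theorem coeff_C_mul_sub_mul_C (c : A) (f : PowerSeries A) (r : ℕ) :
    coeff r (C c * f - f * C c) = ⁅c, coeff r f⁆ := by
  rw [map_sub, coeff_C_mul, coeff_mul_C, Ring.lie_def]

theorem lie_coeff_inverse {x : A} {f : PowerSeries A} (hf : IsUnit f) (h : ∀ s, ⁅x, coeff s f⁆ = 0)
    (s : ℕ) : ⁅x, coeff s (Ring.inverse f)⁆ = 0 := by
  obtain ⟨u, rfl⟩ := hf
  have comm : Commute (C x) (u : PowerSeries A) := by
    rw [commute_iff_eq, ← sub_eq_zero]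
    ext r
    rw [coeff_C_mul_sub_mul_C, h, map_zero]
  rw [Ring.inverse_unit, ← coeff_C_mul_sub_mul_C, comm.units_inv_right.eq, sub_self, map_zero]

section SimpleRoots

variable {n : ℕ} (i j : Fin (n - 1))

theorem lo_lt_hi : lo i < hi i := Fin.lt_def.mpr (Nat.lt_succ_self _)

theorem lo_eq_lo_iff : lo i = lo j ↔ (i : ℕ) = j := by simp [Fin.ext_iff, lo]

theorem lo_eq_hi_iff : lo i = hi j ↔ (i : ℕ) = j + 1 := by simp [Fin.ext_iff, lo, hi]

theorem hi_eq_lo_iff : hi i = lo j ↔ (j : ℕ) = i + 1 := by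
  rw [eq_comm, lo_eq_hi_iff]

theorem hi_eq_hi_iff : hi i = hi j ↔ (i : ℕ) = j := by simp [Fin.ext_iff, hi]

end SimpleRoots

variable {n : ℕ} {T : Fin n → Fin n → ℕ → A} {G : GaussFactors n (PowerSeries A)}

section Halves

variable (hT : IsRTT T) (hG : G.IsFactorizationOf (seriesMatrix T))
include hT hG

theorem T_lo_hi (j : Fin (n - 1)) : T (lo j) (hi j) 1 = G.coeffE j 1 := by
  have coeff_one := hG.coeff_one hT.constantCoeff (lo j) (hi j)
  rwa [coeff_seriesMatrix, if_neg (lo_ne_hi j), hG.F_upper _ _ (lo_lt_hi j), map_zero, zero_add,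
    zero_add] at coeff_one

theorem T_hi_lo (j : Fin (n - 1)) : T (hi j) (lo j) 1 = G.coeffF j 1 := by
  have coeff_one := hG.coeff_one hT.constantCoeff (hi j) (lo j)
  rwa [coeff_seriesMatrix, if_neg (lo_ne_hi j).symm, hG.E_lower _ _ (lo_lt_hi j), map_zero,
    add_zero, add_zero] at coeff_one

theorem C_coeffE_one_lie_seriesMatrix (j : Fin (n - 1)) (k l : Fin n) :
    C (G.coeffE j 1) * seriesMatrix T k l - seriesMatrix T k l * C (G.coeffE j 1) =
      (if hi j = k then seriesMatrix T (lo j) l else 0) -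
        (if l = lo j then seriesMatrix T k (hi j) else 0) := by
  ext r
  rw [← T_lo_hi hT hG, coeff_C_mul_sub_mul_C, coeff_seriesMatrix, hT.lie_one _ _ r, map_sub]
  congr 1 <;> split_ifs <;> simp

theorem coeffE_one_lie_D (j : Fin (n - 1)) (a : Fin n) (r : ℕ) :
    ⁅G.coeffE j 1, coeff r (G.D a)⁆ = coeff r ((if a = hi j then G.D a * G.E (lo j) (hi j) else 0) -
      (if a = lo j then G.D a * G.E (lo j) (hi j) else 0)) := by
  rw [← GaussFactors.simpleRoot_lie_D rfl hG (hG.isUnit_D hT)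
    (C_coeffE_one_lie_seriesMatrix hT hG j), coeff_C_mul_sub_mul_C]

theorem coeffE_one_lie_E (j : Fin (n - 1)) (a b : Fin n) (r : ℕ) :
    ⁅G.coeffE j 1, coeff r (G.E a b)⁆ =
      coeff r (((if a = lo j then G.E (lo j) (hi j) else 0) -
          (if a = hi j then G.E (lo j) (hi j) else 0)) * G.E a b +
        (if a = hi j then G.E (lo j) b else 0) - (if b = lo j then G.E a (hi j) else 0)) := by
  rw [← GaussFactors.simpleRoot_lie_E rfl hG (hG.isUnit_D hT)
    (C_coeffE_one_lie_seriesMatrix hT hG j), coeff_C_mul_sub_mul_C]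

theorem coeffE_one_lie_F (j : Fin (n - 1)) (a b : Fin n) (r : ℕ) :
    ⁅G.coeffE j 1, coeff r (G.F a b)⁆ = coeff r ((if a = hi j then G.F (lo j) b else 0) -
      (if b = lo j then G.F a (hi j) * G.D (hi j) * Ring.inverse (G.D (lo j)) else 0)) := by
  rw [← GaussFactors.simpleRoot_lie_F rfl hG (hG.isUnit_D hT)
    (C_coeffE_one_lie_seriesMatrix hT hG j), coeff_C_mul_sub_mul_C]

theorem constantCoeff_E {i j : Fin n} (hij : i ≠ j) : constantCoeff (G.E i j) = 0 := by
  rw [(hG.constantCoeff_eq_one hT.constantCoeff).2, if_neg hij]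

theorem constantCoeff_F {i j : Fin n} (hij : i ≠ j) : constantCoeff (G.F i j) = 0 := by
  rw [(hG.constantCoeff_eq_one hT.constantCoeff).1, if_neg hij]

theorem coeffD_zero (i : Fin n) : G.coeffD i 0 = 1 := by
  rw [GaussFactors.coeffD, coeff_zero_eq_constantCoeff_apply, hG.constantCoeff_D hT.constantCoeff]

theorem coeffE_zero (j : Fin (n - 1)) : G.coeffE j 0 = 0 := by
  rw [GaussFactors.coeffE, coeff_zero_eq_constantCoeff_apply, constantCoeff_E hT hG (lo_ne_hi j)]

theorem coeffF_zero (j : Fin (n - 1)) : G.coeffF j 0 = 0 := by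
  rw [GaussFactors.coeffF, coeff_zero_eq_constantCoeff_apply,
    constantCoeff_F hT hG (lo_ne_hi j).symm]

theorem coeffD_lie_coeffE_one (i : Fin n) (j : Fin (n - 1)) (r : ℕ) :
    ⁅G.coeffD i r, G.coeffE j 1⁆ = (delta i (lo j) - delta i (hi j)) •
      ∑ t ∈ Finset.range r, G.coeffD i t * G.coeffE j (r + 1 - 1 - t) := by
  have coeff_D_mul_E : coeff r (G.D i * G.E (lo j) (hi j)) =
      ∑ t ∈ Finset.range r, G.coeffD i t * G.coeffE j (r + 1 - 1 - t) :=
    coeff_mul_of_constantCoeff_eq_zero (constantCoeff_E hT hG (lo_ne_hi j)) r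
  rw [← lie_skew, GaussFactors.coeffD, coeffE_one_lie_D hT hG, ← coeff_D_mul_E, map_sub, neg_sub,
    sub_smul]
  simp only [delta, apply_ite (coeff r), map_zero, ite_smul, one_smul, zero_smul]

theorem coeffE_one_lie_coeffE (i j : Fin (n - 1)) (r : ℕ) : ⁅G.coeffE i 1, G.coeffE j r⁆ =
    coeff r (((if (j : ℕ) = i then G.E (lo i) (hi i) else 0) -
        (if (j : ℕ) = i + 1 then G.E (lo i) (hi i) else 0)) * G.E (lo j) (hi j) +
      (if (j : ℕ) = i + 1 then G.E (lo i) (hi j) else 0) -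
        (if (i : ℕ) = j + 1 then G.E (lo j) (hi i) else 0)) := by
  simp only [← lo_eq_lo_iff, ← lo_eq_hi_iff j, ← hi_eq_lo_iff j]
  exact coeffE_one_lie_E hT hG i (lo j) (hi j) r

theorem coeffE_one_lie_coeffE_self (j : Fin (n - 1)) {s : ℕ} (hs : 1 ≤ s) :
    ⁅G.coeffE j 1, G.coeffE j s⁆ =
      ∑ t ∈ Finset.Icc 1 (s - 1), G.coeffE j t * G.coeffE j (s - t) := by
  obtain ⟨s, rfl⟩ := Nat.exists_eq_add_of_le' hs
  have E_zero := constantCoeff_E hT hG (lo_ne_hi j)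
  rw [coeffE_one_lie_coeffE hT hG, if_pos rfl, if_neg (by omega), sub_zero,
    add_zero, sub_zero, coeff_mul_of_constantCoeff_eq_zero E_zero, sum_Icc_one,
    Nat.add_sub_cancel, Finset.sum_range_succ', coeff_zero_eq_constantCoeff_apply, E_zero,
    zero_mul, add_zero]
  rfl

theorem coeffE_one_lie_coeffE_of_far {i j : Fin (n - 1)} (hij : 1 < |(i : ℤ) - (j : ℤ)|) (r : ℕ) :
    ⁅G.coeffE i 1, G.coeffE j r⁆ = 0 := by
  rw [lt_abs] at hij
  rw [coeffE_one_lie_coeffE hT hG, if_neg (by omega), if_neg (by omega), if_neg (by omega),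
    if_neg (by omega)]
  simp

theorem coeffE_one_lie_coeffE_of_next {i j : Fin (n - 1)} (hij : (j : ℕ) = i + 1) (r : ℕ) :
    ⁅G.coeffE i 1, G.coeffE j r⁆ =
      coeff r (G.E (lo i) (hi j)) - coeff r (G.E (lo i) (hi i) * G.E (lo j) (hi j)) := by
  rw [coeffE_one_lie_coeffE hT hG, if_neg (by omega), if_pos hij, if_pos hij, if_neg (by omega)]
  simp only [zero_sub, neg_mul, map_add, map_neg, sub_zero]
  abel

theorem coeffE_one_lie_coeffE_of_prev {i j : Fin (n - 1)} (hij : (i : ℕ) = j + 1) (r : ℕ) :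
    ⁅G.coeffE i 1, G.coeffE j r⁆ = -coeff r (G.E (lo j) (hi i)) := by
  rw [coeffE_one_lie_coeffE hT hG, if_neg (by omega), if_neg (by omega), if_neg (by omega),
    if_pos hij]
  simp

theorem coeffE_next {i j : Fin (n - 1)} (hij : (j : ℕ) = i + 1) :
    ⁅G.coeffE i 1, G.coeffE j 2⁆ - ⁅G.coeffE i 2, G.coeffE j 1⁆ =
      -(G.coeffE i 1 * G.coeffE j 1) := by
  have E_zero := fun k : Fin (n - 1) ↦ constantCoeff_E hT hG (lo_ne_hi k)
  have coeff_two : coeff 2 (G.E (lo i) (hi i) * G.E (lo j) (hi j)) =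
      G.coeffE i 1 * G.coeffE j 1 := by
    rw [coeff_mul_of_constantCoeff_eq_zero (E_zero j)]
    simp [Finset.sum_range_succ, E_zero, GaussFactors.coeffE]
  rw [coeffE_one_lie_coeffE_of_next hT hG hij, ← lie_skew (G.coeffE i 2),
    coeffE_one_lie_coeffE_of_prev hT hG hij, coeff_two]
  abel

theorem coeffE_serre {i j : Fin (n - 1)} (hij : |(i : ℤ) - (j : ℤ)| = 1) :
    ⁅G.coeffE i 1, ⁅G.coeffE i 1, G.coeffE j 1⁆⁆ = 0 := by
  have coeff_one_mul {a b c d : Fin n} (hab : a ≠ b) (hcd : c ≠ d) :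
      coeff 1 (G.E a b * G.E c d) = 0 := by
    rw [coeff_one_mul_eq, constantCoeff_E hT hG hab, constantCoeff_E hT hG hcd, zero_mul, mul_zero,
      add_zero]
  obtain hij | hij : (j : ℕ) = i + 1 ∨ (i : ℕ) = j + 1 := by
    rw [abs_eq zero_le_one] at hij; omega
  · rw [coeffE_one_lie_coeffE_of_next hT hG hij, coeff_one_mul (lo_ne_hi i) (lo_ne_hi j), sub_zero,
      coeffE_one_lie_E hT hG, if_pos rfl, if_neg (lo_ne_hi i), if_neg (lo_ne_hi i),
      if_neg (by rw [hi_eq_lo_iff]; omega), sub_zero, add_zero, sub_zero,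
      coeff_one_mul (lo_ne_hi i) (by rw [Ne, lo_eq_hi_iff]; omega)]
  · rw [coeffE_one_lie_coeffE_of_prev hT hG hij, lie_neg, coeffE_one_lie_E hT hG,
      if_neg (by rw [lo_eq_lo_iff]; omega), if_neg (by rw [lo_eq_hi_iff]; omega),
      if_neg (lo_ne_hi i).symm]
    simp

theorem isHalfSeed_gauss : IsHalfSeed G.coeffD G.coeffE where
  D_zero := coeffD_zero hT hG
  D_D := coeff_D_comm hT hG
  D_lo_E j r _ hs := coeff_D_E hT hG (lo_lt_hi j) r hs
  D_E_one := coeffD_lie_coeffE_one hT hG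
  E_E_self j _ hs := coeffE_one_lie_coeffE_self hT hG j hs
  E_E_far _ _ hij := coeffE_one_lie_coeffE_of_far hT hG hij 1
  E_E_next _ _ hij := coeffE_next hT hG hij
  serre _ _ hij := coeffE_serre hT hG hij

theorem coeffD_lie_coeffDt (i j : Fin n) (r s : ℕ) : ⁅G.coeffD i r, G.coeffDt j s⁆ = 0 := by
  rw [GaussFactors.coeffD, GaussFactors.coeffDt, map_neg, lie_neg,
    lie_coeff_inverse (hG.isUnit_D hT j) fun s ↦ coeff_D_comm hT hG i j r s, neg_zero]

theorem sum_coeffD_mul_coeffDt (i : Fin n) (r : ℕ) :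
    ∑ t ∈ Finset.Icc 0 r, G.coeffD i t * G.coeffDt i (r - t) = -delta r 0 • (1 : A) := by
  have mul_eq : G.D i * -Ring.inverse (G.D i) = -1 := by
    rw [mul_neg, Ring.mul_inverse_cancel _ (hG.isUnit_D hT i)]
  have coeff_eq := congr_arg (coeff r) mul_eq
  rw [coeff_mul, Finset.Nat.sum_antidiagonal_eq_sum_range_succ_mk, Nat.range_succ_eq_Icc_zero]
    at coeff_eq
  refine coeff_eq.trans ?_
  rw [map_neg, coeff_one, delta]
  split_ifs <;> simp

theorem coeffE_one_lie_coeffF_of_ne {i j : Fin (n - 1)} (hij : i ≠ j) (s : ℕ) :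
    ⁅G.coeffE i 1, G.coeffF j s⁆ = 0 := by
  rw [ne_comm, Ne, Fin.ext_iff] at hij
  rw [GaussFactors.coeffF, coeffE_one_lie_F hT hG, if_neg (by rwa [hi_eq_hi_iff]),
    if_neg (by rwa [lo_eq_lo_iff]), sub_zero, map_zero]

theorem coeffE_one_lie_coeffF_self (i : Fin (n - 1)) {s : ℕ} (hs : 1 ≤ s) :
    ⁅G.coeffE i 1, G.coeffF i s⁆ =
      ∑ t ∈ Finset.Icc 0 s, G.coeffDt (lo i) t * G.coeffD (hi i) (s - t) := by
  have comm (t : ℕ) : G.coeffD (hi i) (s - t) * G.coeffDt (lo i) t =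
      G.coeffDt (lo i) t * G.coeffD (hi i) (s - t) :=
    sub_eq_zero.mp (coeffD_lie_coeffDt hT hG (hi i) (lo i) (s - t) t)
  rw [GaussFactors.coeffF, coeffE_one_lie_F hT hG, if_pos rfl, if_pos rfl, hG.F_diag, hG.F_diag,
    one_mul, map_sub, coeff_one, if_neg (Nat.one_le_iff_ne_zero.mp hs), zero_sub, ← map_neg,
    ← mul_neg, coeff_mul, ← Finset.Nat.sum_antidiagonal_swap,
    Finset.Nat.sum_antidiagonal_eq_sum_range_succ_mk, Nat.range_succ_eq_Icc_zero]
  exact Finset.sum_congr rfl fun t _ ↦ comm t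

end Halves

section Opposite

theorem IsRTT.op {ι : Type*} [DecidableEq ι] {T : ι → ι → ℕ → A} (hT : IsRTT T) :
    IsRTT (fun i j r ↦ op (T j i r)) where
  zero i j := by
    rw [hT.zero]
    by_cases hij : i = j
    · simp [hij]
    · simp [hij, Ne.symm hij]
  rel i j k l r s := by
    have op_rel := congr_arg MulOpposite.op (hT.rel j i l k r s)
    simp only [op_sub, op_mul] at op_rel
    simp only [op_lie]
    rw [← neg_inj, neg_sub (MulOpposite.op _ * _), ← op_rel]
    abel

/-- The coefficientwise image of a power series in the opposite ring. As the variable is central,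
this is an antihomomorphism. -/
def opSeries (f : PowerSeries A) : PowerSeries Aᵐᵒᵖ := PowerSeries.mk fun r ↦ op (coeff r f)

theorem coeff_opSeries (f : PowerSeries A) (r : ℕ) : coeff r (opSeries f) = op (coeff r f) :=
  coeff_mk r _

theorem opSeries_mul (f g : PowerSeries A) : opSeries (f * g) = opSeries g * opSeries f := by
  ext r
  rw [coeff_opSeries, coeff_mul, coeff_mul, ← Finset.Nat.sum_antidiagonal_swap, Finset.op_sum]
  simp only [coeff_opSeries, op_mul, Prod.swap]

theorem opSeries_sum {ι : Type*} (s : Finset ι) (f : ι → PowerSeries A) :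
    opSeries (∑ i ∈ s, f i) = ∑ i ∈ s, opSeries (f i) := by
  ext r; simp [coeff_opSeries]

theorem opSeries_one : opSeries (1 : PowerSeries A) = 1 := by
  ext r; rw [coeff_opSeries, coeff_one, coeff_one]; split_ifs <;> simp

theorem opSeries_zero : opSeries (0 : PowerSeries A) = 0 := by ext r; simp [coeff_opSeries]

/-- The transposed Gauss factors over the opposite ring: transposition exchanges the two
unitriangular factors. -/
def GaussFactors.op (G : GaussFactors n (PowerSeries A)) : GaussFactors n (PowerSeries Aᵐᵒᵖ) :=
  ⟨Matrix.of fun i j ↦ opSeries (G.E j i), fun i ↦ opSeries (G.D i),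
    Matrix.of fun i j ↦ opSeries (G.F j i)⟩

theorem GaussFactors.IsFactorizationOf.op (hG : G.IsFactorizationOf (seriesMatrix T)) :
    G.op.IsFactorizationOf (seriesMatrix fun i j r ↦ MulOpposite.op (T j i r)) where
  F_diag i := by simp [GaussFactors.op, hG.E_diag, opSeries_one]
  F_upper i j hij := by simp [GaussFactors.op, hG.E_lower j i hij, opSeries_zero]
  E_diag i := by simp [GaussFactors.op, hG.F_diag, opSeries_one]
  E_lower i j hij := by simp [GaussFactors.op, hG.F_upper j i hij, opSeries_zero]
  eq_mul := Matrix.ext fun i j ↦ by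
    have entry : seriesMatrix (fun i j r ↦ MulOpposite.op (T j i r)) i j =
        opSeries (seriesMatrix T j i) := by
      ext r; rw [coeff_seriesMatrix, coeff_opSeries, coeff_seriesMatrix]
    rw [entry, hG.eq_mul, GaussFactors.mul_apply, GaussFactors.mul_apply, opSeries_sum]
    simp [opSeries_mul, GaussFactors.op, mul_assoc]

theorem isHalfSeed_gauss_op (hT : IsRTT T) (hG : G.IsFactorizationOf (seriesMatrix T)) :
    IsHalfSeed (fun i r ↦ op (G.coeffD i r)) (fun j r ↦ op (G.coeffF j r)) := by
  have coeffD_op : G.op.coeffD = fun i r ↦ op (G.coeffD i r) :=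
    funext fun i ↦ funext fun r ↦ coeff_opSeries _ _
  have coeffE_op : G.op.coeffE = fun j r ↦ op (G.coeffF j r) :=
    funext fun j ↦ funext fun r ↦ coeff_opSeries _ _
  rw [← coeffD_op, ← coeffE_op]
  exact isHalfSeed_gauss hT.op hG.op

end Opposite

theorem isDrinfeld_gauss [Algebra ℂ A] (hT : IsRTT T)
    (hG : G.IsFactorizationOf (seriesMatrix T)) :
    IsDrinfeld G.coeffD G.coeffDt G.coeffE G.coeffF :=
  (isHalfSeed_gauss hT hG).isDrinfeld (isHalfSeed_gauss_op hT hG) (coeffE_zero hT hG)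
    (coeffF_zero hT hG) (sum_coeffD_mul_coeffDt hT hG) (coeffD_lie_coeffDt hT hG)
    (fun i _ hs ↦ coeffE_one_lie_coeffF_self hT hG i hs)
    fun _ _ s hij ↦ coeffE_one_lie_coeffF_of_ne hT hG hij s

end GaussDrinfeld

/-! ### The `gl_n` of Drinfeld's generators of degree one -/

section ExtendZero

variable {A : Type*} {m : ℕ}

/-- A family indexed by an initial segment of the natural numbers, extended by zero, so that the
recursions along simple roots need not carry bounds. -/
def extendZero [Zero A] (a : Fin m → A) (k : ℕ) : A := if hk : k < m then a ⟨k, hk⟩ else 0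

theorem extendZero_of_lt [Zero A] (a : Fin m → A) {k : ℕ} (hk : k < m) :
    extendZero a k = a ⟨k, hk⟩ := dif_pos hk

theorem extendZero_of_ge [Zero A] (a : Fin m → A) {k : ℕ} (hk : m ≤ k) :
    extendZero a k = 0 := dif_neg (by omega)

@[simp] theorem extendZero_val [Zero A] (a : Fin m → A) (k : Fin m) :
    extendZero a k = a k := extendZero_of_lt a k.2

variable [LieRing A] (a : Fin m → A)

theorem extendZero_lie_extendZero_eq_zero {m' : ℕ} {b : Fin m' → A} {i j : ℕ}
    (h : ∀ hi hj, ⁅a ⟨i, hi⟩, b ⟨j, hj⟩⁆ = 0) : ⁅extendZero a i, extendZero b j⁆ = 0 := by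
  rw [extendZero, extendZero]
  split_ifs with hi hj
  · exact h hi hj
  all_goals simp

theorem extendZero_lie_lie_eq_zero {i j : ℕ}
    (h : ∀ hi hj, ⁅a ⟨i, hi⟩, ⁅a ⟨i, hi⟩, a ⟨j, hj⟩⁆⁆ = 0) :
    ⁅extendZero a i, ⁅extendZero a i, extendZero a j⁆⁆ = 0 := by
  rw [extendZero, extendZero]
  split_ifs with hi hj
  · exact h hi hj
  all_goals simp

theorem posRoot_lie_eq_zero {e : ℕ → A} {y : A} {i : ℕ} (h : ∀ k, i ≤ k → ⁅e k, y⁆ = 0) (d : ℕ) :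
    ⁅posRoot e i d, y⁆ = 0 := by
  induction d with
  | zero => exact h i le_rfl
  | succ d ih => rw [posRoot_succ, lie_lie, ih, h _ (by omega), lie_zero, lie_zero, sub_zero]

end ExtendZero

section DrinfeldUnits

attribute [local instance] LieRing.ofAssociativeRing

variable {A : Type*} [Ring A] {n : ℕ}

namespace IsDrinfeld

variable {D Dt : Fin n → ℕ → A} {E F : Fin (n - 1) → ℕ → A} (H : IsDrinfeld D Dt E F)
include H

theorem Dt_zero (i : Fin n) : Dt i 0 = -1 := by
  simpa [H.D_zero, delta] using H.D_Dt i 0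

theorem Dt_one (i : Fin n) : Dt i 1 = D i 1 := by
  have degree_one := H.D_Dt i 1
  rw [← Nat.range_succ_eq_Icc_zero, Finset.sum_range_succ, Finset.sum_range_one, H.D_zero]
    at degree_one
  simp only [delta, H.Dt_zero, one_mul, Nat.sub_zero, Nat.sub_self, mul_neg, mul_one, one_ne_zero,
    if_false, neg_zero, zero_smul] at degree_one
  rwa [← sub_eq_add_neg, sub_eq_zero] at degree_one

theorem D_one_lie_E (i : Fin n) (j : Fin (n - 1)) {s : ℕ} (hs : 1 ≤ s) :
    ⁅D i 1, E j s⁆ = (delta i (lo j) - delta i (hi j)) • E j s := by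
  rw [H.D_E i j 1 s hs]; simp [H.D_zero]

theorem D_one_lie_F (i : Fin n) (j : Fin (n - 1)) {s : ℕ} (hs : 1 ≤ s) :
    ⁅D i 1, F j s⁆ = (delta i (hi j) - delta i (lo j)) • F j s := by
  rw [H.D_F i j 1 s hs]; simp [H.D_zero]

theorem E_one_lie_F_one (i : Fin (n - 1)) : ⁅E i 1, F i 1⁆ = D (lo i) 1 - D (hi i) 1 := by
  have terms : ∑ t ∈ Finset.range 2, Dt (lo i) t * D (hi i) (1 - t) =
      Dt (lo i) 0 * D (hi i) 1 + Dt (lo i) 1 * D (hi i) 0 := by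
    rw [Finset.sum_range_succ, Finset.sum_range_one]
  rw [H.E_F i i 1 1 le_rfl le_rfl, delta, if_pos rfl, one_smul, ← Nat.range_succ_eq_Icc_zero, terms,
    H.Dt_zero, H.Dt_one, H.D_zero, neg_one_mul, mul_one, neg_add_eq_sub]

theorem extendZero_D_lie_E (i j : ℕ) :
    ⁅extendZero (fun i ↦ D i 1) i, extendZero (fun j ↦ E j 1) j⁆ =
      (if i = j then extendZero (fun j ↦ E j 1) j else 0) -
        (if i = j + 1 then extendZero (fun j ↦ E j 1) j else 0) := by
  obtain hj | hj := le_or_gt (n - 1) j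
  · simp [extendZero_of_ge _ hj]
  obtain hi | hi := le_or_gt n i
  · rw [extendZero_of_ge _ hi, if_neg (by omega), if_neg (by omega)]; simp
  rw [extendZero_of_lt _ hj, extendZero_of_lt _ hi, H.D_one_lie_E _ _ le_rfl, sub_smul]
  simp only [delta, lo, YangianGL.hi, Fin.mk.injEq, ite_smul, one_smul, zero_smul]

theorem extendZero_D_lie_F (i j : ℕ) :
    ⁅extendZero (fun i ↦ D i 1) i, extendZero (fun j ↦ F j 1) j⁆ =
      (if i = j + 1 then extendZero (fun j ↦ F j 1) j else 0) -
        (if i = j then extendZero (fun j ↦ F j 1) j else 0) := by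
  obtain hj | hj := le_or_gt (n - 1) j
  · simp [extendZero_of_ge _ hj]
  obtain hi | hi := le_or_gt n i
  · rw [extendZero_of_ge _ hi, if_neg (by omega), if_neg (by omega)]; simp
  rw [extendZero_of_lt _ hj, extendZero_of_lt _ hi, H.D_one_lie_F _ _ le_rfl, sub_smul]
  simp only [delta, lo, YangianGL.hi, Fin.mk.injEq, ite_smul, one_smul, zero_smul]

theorem extendZero_E_lie_F_self {i : ℕ} (hi : i + 1 < n) :
    ⁅extendZero (fun j ↦ E j 1) i, extendZero (fun j ↦ F j 1) i⁆ =
      extendZero (fun i ↦ D i 1) i - extendZero (fun i ↦ D i 1) (i + 1) := by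
  rw [extendZero_of_lt _ (by omega : i < n - 1), extendZero_of_lt _ (by omega : i < n - 1),
    extendZero_of_lt _ hi, extendZero_of_lt _ (by omega : i < n), H.E_one_lie_F_one]
  rfl

variable [Algebra ℂ A]

theorem E_one_serre {i j : Fin (n - 1)} (hij : |(i : ℤ) - (j : ℤ)| = 1) :
    ⁅E i 1, ⁅E i 1, E j 1⁆⁆ = 0 :=
  isSMulRegular_two.right_eq_zero_of_smul <|
    (two_nsmul _).trans (H.E_serre i j hij 1 1 1 le_rfl le_rfl le_rfl)

theorem F_one_serre {i j : Fin (n - 1)} (hij : |(i : ℤ) - (j : ℤ)| = 1) :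
    ⁅F i 1, ⁅F i 1, F j 1⁆⁆ = 0 :=
  isSMulRegular_two.right_eq_zero_of_smul <|
    (two_nsmul _).trans (H.F_serre i j hij 1 1 1 le_rfl le_rfl le_rfl)

theorem isChevalleyFamily : IsChevalleyFamily n (extendZero fun j ↦ E j 1)
    (extendZero fun j ↦ F j 1) (extendZero fun i ↦ D i 1) where
  lie_h_h _ _ := extendZero_lie_extendZero_eq_zero _ fun _ _ ↦ H.D_D _ _ 1 1
  lie_h_e := H.extendZero_D_lie_E
  lie_h_f := H.extendZero_D_lie_F
  lie_e_f_of_ne i j hij := extendZero_lie_extendZero_eq_zero _ fun _ _ ↦ by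
    rw [H.E_F _ _ 1 1 le_rfl le_rfl, delta, if_neg (by simpa using hij), zero_smul]
  lie_e_f_self _ := H.extendZero_E_lie_F_self
  lie_e_e i j hij := extendZero_lie_extendZero_eq_zero _ fun _ _ ↦
    H.E_far _ _ (lt_abs.2 (Or.inr (by simp; omega))) 1 1 le_rfl le_rfl
  lie_f_f i j hij := extendZero_lie_extendZero_eq_zero _ fun _ _ ↦
    H.F_far _ _ (lt_abs.2 (Or.inr (by simp; omega))) 1 1 le_rfl le_rfl
  serre_e_succ _ := extendZero_lie_lie_eq_zero _ fun _ _ ↦ H.E_one_serre (by simp)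
  serre_e_pred _ := extendZero_lie_lie_eq_zero _ fun _ _ ↦ H.E_one_serre (by simp)
  serre_f_succ _ := extendZero_lie_lie_eq_zero _ fun _ _ ↦ H.F_one_serre (by simp)
  serre_f_pred _ := extendZero_lie_lie_eq_zero _ fun _ _ ↦ H.F_one_serre (by simp)

end IsDrinfeld

/-- The matrix units of `gl_n` built from Drinfeld's generators of degree one. -/
def drUnit (D : Fin n → ℕ → A) (E F : Fin (n - 1) → ℕ → A) (i j : Fin n) : A :=
  glRoot (extendZero fun j ↦ E j 1) (extendZero fun j ↦ F j 1) (extendZero fun i ↦ D i 1) i j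

section

variable (D : Fin n → ℕ → A) (E F : Fin (n - 1) → ℕ → A)

theorem drUnit_lo_hi (j : Fin (n - 1)) : drUnit D E F (lo j) (hi j) = E j 1 :=
  (glRoot_succ_right _ _ _ j).trans (extendZero_val _ j)

theorem drUnit_hi_lo (j : Fin (n - 1)) : drUnit D E F (hi j) (lo j) = F j 1 :=
  (glRoot_succ_left _ _ _ j).trans (extendZero_val _ j)

theorem drUnit_self (i : Fin n) : drUnit D E F i i = D i 1 :=
  (glRoot_self _ _ _ i).trans (extendZero_val _ i)

end

namespace IsDrinfeld

variable {D Dt : Fin n → ℕ → A} {E F : Fin (n - 1) → ℕ → A} (H : IsDrinfeld D Dt E F)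
include H

theorem drUnit_lie_D_first {o : Fin n} (ho : (o : ℕ) = 0) {a b : Fin n} (ha : a ≠ o) (hb : b ≠ o)
    (r : ℕ) : ⁅drUnit D E F a b, D o r⁆ = 0 := by
  rw [Ne, Fin.ext_iff, ho] at ha hb
  have o_ne {k : ℕ} (hk : k < n - 1) (hk_pos : 1 ≤ k) : o ≠ lo ⟨k, hk⟩ ∧ o ≠ hi ⟨k, hk⟩ := by
    simp only [Ne, Fin.ext_iff, lo, hi]; omega
  have E_lie_D (k : ℕ) (hk_pos : 1 ≤ k) : ⁅extendZero (fun j ↦ E j 1) k, D o r⁆ = 0 := by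
    rw [extendZero]
    split_ifs with hk
    · rw [← lie_skew, H.D_E _ _ _ _ le_rfl]; simp [delta, o_ne hk hk_pos]
    · rw [zero_lie]
  have F_lie_D (k : ℕ) (hk_pos : 1 ≤ k) : ⁅-extendZero (fun j ↦ F j 1) k, D o r⁆ = 0 := by
    rw [extendZero]
    split_ifs with hk
    · rw [neg_lie, ← lie_skew, H.D_F _ _ _ _ le_rfl]; simp [delta, o_ne hk hk_pos]
    · rw [neg_zero, zero_lie]
  rw [drUnit, glRoot]
  split_ifs
  · exact posRoot_lie_eq_zero (fun k hk ↦ E_lie_D k (by omega)) _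
  · rw [extendZero_val, H.D_D]
  · rw [neg_lie, posRoot_lie_eq_zero (fun k hk ↦ F_lie_D k (by omega)), neg_zero]

theorem isLeviInvariant_D_first {o : Fin n} (ho : (o : ℕ) = 0) (r : ℕ) :
    IsLeviInvariant (drUnit D E F) o (D o r) where
  corner := by rw [drUnit_self, H.D_D]
  block _ _ ha hb := H.drUnit_lie_D_first ho ha hb r

end IsDrinfeld

end DrinfeldUnits

/-! ### Drinfeld's relations imply the RTT relations -/

section DrinfeldSeries

attribute [local instance] LieRing.ofAssociativeRing

open PowerSeries

variable {A : Type*} [Ring A] {n : ℕ}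

theorem coeff_mul_of_constantCoeff_eq_zero_left {f g : PowerSeries A} (hf : constantCoeff f = 0)
    (r : ℕ) : coeff r (f * g) = ∑ t ∈ Finset.range r, coeff (r - t) f * coeff t g := by
  rw [coeff_mul, ← Finset.Nat.sum_antidiagonal_swap,
    Finset.Nat.sum_antidiagonal_eq_sum_range_succ_mk, Finset.sum_range_succ]
  simp [hf]

theorem coeff_mul_self_of_constantCoeff_eq_zero {f : PowerSeries A} (hf : constantCoeff f = 0)
    (r : ℕ) : coeff r (f * f) = ∑ t ∈ Finset.Icc 1 (r - 1), coeff t f * coeff (r - t) f := by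
  rw [coeff_mul_of_constantCoeff_eq_zero hf, sum_Icc_one]
  rcases r with _ | r
  · simp
  · rw [Finset.sum_range_succ', coeff_zero_eq_constantCoeff_apply, hf, zero_mul, add_zero,
      Nat.add_sub_cancel]

theorem mul_mul_sub_mul_mul_self (c x y : A) :
    c * (x * y) - x * y * c = (c * x - x * c) * y + x * (c * y - y * c) := by noncomm_ring

theorem rttDefect_eq_zero_of_series {ι : Type*} {T : ι → ι → ℕ → A} {i j k l : ι}
    (h : (vInv A - uInv A) * (inU (seriesMatrix T i j) * inV (seriesMatrix T k l) -
        inV (seriesMatrix T k l) * inU (seriesMatrix T i j)) =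
      uInv A * vInv A * (inU (seriesMatrix T k j) * inV (seriesMatrix T i l) -
        inV (seriesMatrix T k j) * inU (seriesMatrix T i l))) (r s : ℕ) :
    rttDefect T r s i j k l = 0 := by
  have coeff_eq := ((vInv_sub_uInv_mul_eq_iff _ _).mp h).2.2 r s
  simp only [coeff₂_sub, coeff₂_inU_mul_inV, coeff₂_inV_mul_inU, coeff_seriesMatrix] at coeff_eq
  rw [rttDefect, Ring.lie_def, Ring.lie_def, coeff_eq, sub_self]

/-- The coefficients of the matrix `T(u)` built from Drinfeld's generators: the `gl_n`-equivariant
extension of the entry `D_o(u)`, where `o` is meant to be the first index. -/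
def drT (D : Fin n → ℕ → A) (E F : Fin (n - 1) → ℕ → A) (o i j : Fin n) (r : ℕ) : A :=
  adjFamily (drUnit D E F) o (D o r) i j

namespace IsDrinfeld

variable {D Dt : Fin n → ℕ → A} {E F : Fin (n - 1) → ℕ → A} (H : IsDrinfeld D Dt E F)
  (j : Fin (n - 1))
include H

theorem constantCoeff_E : constantCoeff (mk (E j)) = 0 := by
  rw [← coeff_zero_eq_constantCoeff_apply, coeff_mk, H.E_zero]

theorem constantCoeff_F : constantCoeff (mk (F j)) = 0 := by
  rw [← coeff_zero_eq_constantCoeff_apply, coeff_mk, H.F_zero]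

theorem D_lo_lie_E {s : ℕ} (hs : 1 ≤ s) (r : ℕ) :
    ⁅D (lo j) r, E j s⁆ = ∑ t ∈ Finset.range r, D (lo j) t * E j (r + s - 1 - t) := by
  rw [H.D_E _ _ _ _ hs]; simp [delta, lo_ne_hi]

theorem D_lo_lie_F {s : ℕ} (hs : 1 ≤ s) (r : ℕ) :
    ⁅D (lo j) r, F j s⁆ = -∑ t ∈ Finset.range r, F j (r + s - 1 - t) * D (lo j) t := by
  rw [H.D_F _ _ _ _ hs]; simp [delta, lo_ne_hi]

theorem D_lo_lie_E_one (r : ℕ) : ⁅D (lo j) r, E j 1⁆ = coeff r (mk (D (lo j)) * mk (E j)) := by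
  rw [coeff_mul_of_constantCoeff_eq_zero (H.constantCoeff_E j), H.D_lo_lie_E j le_rfl]
  simp

theorem F_one_lie_D_lo (r : ℕ) : ⁅F j 1, D (lo j) r⁆ = coeff r (mk (F j) * mk (D (lo j))) := by
  rw [coeff_mul_of_constantCoeff_eq_zero_left (H.constantCoeff_F j), ← lie_skew,
    H.D_lo_lie_F j le_rfl]
  simp

theorem commutator_E_D : C (E j 1) * mk (D (lo j)) - mk (D (lo j)) * C (E j 1) =
    -(mk (D (lo j)) * mk (E j)) := by
  ext r
  rw [coeff_C_mul_sub_mul_C, coeff_mk, ← lie_skew, H.D_lo_lie_E_one, map_neg]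

theorem commutator_F_D : C (F j 1) * mk (D (lo j)) - mk (D (lo j)) * C (F j 1) =
    mk (F j) * mk (D (lo j)) := by
  ext r
  rw [coeff_C_mul_sub_mul_C, coeff_mk, H.F_one_lie_D_lo]

theorem commutator_E_E : C (E j 1) * mk (E j) - mk (E j) * C (E j 1) = mk (E j) * mk (E j) := by
  ext r
  rw [coeff_C_mul_sub_mul_C, coeff_mk,
    coeff_mul_self_of_constantCoeff_eq_zero (H.constantCoeff_E j)]
  rcases r with _ | r
  · simp [H.E_zero]
  · rw [H.E_E j 1 (r + 1) le_rfl (by omega)]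
    simp [Nat.add_comm 1]

theorem commutator_F_F : C (F j 1) * mk (F j) - mk (F j) * C (F j 1) = -(mk (F j) * mk (F j)) := by
  ext r
  rw [coeff_C_mul_sub_mul_C, coeff_mk, map_neg,
    coeff_mul_of_constantCoeff_eq_zero_left (H.constantCoeff_F j)]
  rcases r with _ | r
  · simp [H.F_zero]
  · rw [H.F_F j 1 (r + 1) le_rfl (by omega), Finset.sum_range_succ', sum_Icc_one, sum_Icc_one]
    simp [Nat.add_comm 1, H.F_zero]

theorem commutator_F_E : C (F j 1) * mk (E j) - mk (E j) * C (F j 1) =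
    -(mk (Dt (lo j)) * mk (D (hi j))) - 1 := by
  ext r
  rw [coeff_C_mul_sub_mul_C, coeff_mk, map_sub, map_neg, coeff_mul,
    Finset.Nat.sum_antidiagonal_eq_sum_range_succ_mk, coeff_one, Nat.range_succ_eq_Icc_zero]
  rcases r with _ | r
  · simp [H.E_zero, H.Dt_zero, H.D_zero]
  · rw [← lie_skew, H.E_F j j (r + 1) 1 (by omega) le_rfl]
    simp [delta]

theorem D_mul_Dt (i : Fin n) : mk (D i) * mk (Dt i) = -1 := by
  ext r
  rw [coeff_mul, Finset.Nat.sum_antidiagonal_eq_sum_range_succ_mk, Nat.range_succ_eq_Icc_zero,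
    map_neg, coeff_one]
  simp only [coeff_mk]
  rw [H.D_Dt, delta]
  split_ifs <;> simp

theorem commutator_F_D_mul_E : C (F j 1) * (mk (D (lo j)) * mk (E j)) -
    mk (D (lo j)) * mk (E j) * C (F j 1) =
      mk (F j) * mk (D (lo j)) * mk (E j) + mk (D (hi j)) - mk (D (lo j)) := by
  rw [mul_mul_sub_mul_mul_self, H.commutator_F_D, H.commutator_F_E, mul_sub, mul_neg,
    ← mul_assoc _ (mk (Dt _)), H.D_mul_Dt, mul_one, neg_mul, one_mul, neg_neg, ← add_sub_assoc]

theorem E_lie_D_lie_E (r : ℕ) : ⁅E j 1, ⁅D (lo j) r, E j 1⁆⁆ = 0 := by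
  rw [H.D_lo_lie_E_one, ← coeff_C_mul_sub_mul_C, mul_mul_sub_mul_mul_self, H.commutator_E_D,
    H.commutator_E_E, neg_mul, mul_assoc, neg_add_cancel, map_zero]

theorem F_lie_F_lie_D (r : ℕ) : ⁅F j 1, ⁅F j 1, D (lo j) r⁆⁆ = 0 := by
  rw [H.F_one_lie_D_lo, ← coeff_C_mul_sub_mul_C, mul_mul_sub_mul_mul_self, H.commutator_F_D,
    H.commutator_F_F, neg_mul, mul_assoc, neg_add_cancel, map_zero]

theorem inU_D_mul_inV_D (i k : Fin n) :
    inU (mk (D i)) * inV (mk (D k)) = inV (mk (D k)) * inU (mk (D i)) :=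
  inU_mul_inV_comm fun r s ↦ by
    simpa only [coeff_mk] using sub_eq_zero.mp ((Ring.lie_def _ _).symm.trans (H.D_D i k r s))

theorem D_E_series : (vInv A - uInv A) * (inU (mk (D (lo j))) * inV (mk (E j)) -
    inV (mk (E j)) * inU (mk (D (lo j)))) = uInv A * vInv A *
      (inU (mk (D (lo j))) * inV (mk (E j)) - inU (mk (D (lo j))) * inU (mk (E j))) := by
  rw [vInv_sub_uInv_mul_eq_iff, ← map_mul]
  simp only [coeff₂_sub, coeff₂_inU_mul_inV, coeff₂_inV_mul_inU, coeff₂_inU, coeff_mk]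
  simp only [← Ring.lie_def]
  refine ⟨fun s ↦ ?_, fun r ↦ ?_, fun r s ↦ ?_⟩
  · rw [H.D_zero, Ring.lie_def, one_mul, mul_one, sub_self]
  · rw [H.E_zero, lie_zero]
  · rcases s with _ | s
    · rw [H.E_zero, lie_zero, if_pos rfl, mul_zero, H.D_lo_lie_E_one]
    · rw [H.D_lo_lie_E j (by omega), H.D_lo_lie_E j (by omega), if_neg (by omega), sub_zero,
        Finset.sum_range_succ, show r + 1 + (s + 1) - 1 - r = s + 1 by omega]
      simp only [show r + (s + 1 + 1) - 1 = r + 1 + (s + 1) - 1 by omega, add_sub_cancel_left]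

theorem D_F_series : (vInv A - uInv A) * (inU (mk (D (lo j))) * inV (mk (F j)) -
    inV (mk (F j)) * inU (mk (D (lo j)))) = uInv A * vInv A *
      (inU (mk (F j)) * inU (mk (D (lo j))) - inV (mk (F j)) * inU (mk (D (lo j)))) := by
  rw [vInv_sub_uInv_mul_eq_iff, ← map_mul]
  simp only [coeff₂_sub, coeff₂_inU_mul_inV, coeff₂_inV_mul_inU, coeff₂_inU, coeff_mk]
  simp only [← Ring.lie_def]
  refine ⟨fun s ↦ ?_, fun r ↦ ?_, fun r s ↦ ?_⟩
  · rw [H.D_zero, Ring.lie_def, one_mul, mul_one, sub_self]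
  · rw [H.F_zero, lie_zero]
  · rcases s with _ | s
    · rw [H.F_zero, lie_zero, if_pos rfl, zero_mul, zero_sub, lie_skew, H.F_one_lie_D_lo, sub_zero]
    · rw [H.D_lo_lie_F j (by omega), H.D_lo_lie_F j (by omega), if_neg (by omega), zero_sub,
        Finset.sum_range_succ, show r + 1 + (s + 1) - 1 - r = s + 1 by omega]
      simp only [show r + (s + 1 + 1) - 1 = r + 1 + (s + 1) - 1 by omega]
      abel

omit H in
theorem seriesMatrix_drT_lo_lo :
    seriesMatrix (drT D E F (lo j)) (lo j) (lo j) = mk (D (lo j)) := by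
  ext r
  rw [coeff_seriesMatrix, drT, adjFamily_self_self, coeff_mk]

theorem seriesMatrix_drT_lo_hi :
    seriesMatrix (drT D E F (lo j)) (lo j) (hi j) = mk (D (lo j)) * mk (E j) := by
  ext r
  rw [coeff_seriesMatrix, drT, adjFamily_self_left _ _ _ (lo_ne_hi j).symm, drUnit_lo_hi,
    H.D_lo_lie_E_one]

theorem seriesMatrix_drT_hi_lo :
    seriesMatrix (drT D E F (lo j)) (hi j) (lo j) = mk (F j) * mk (D (lo j)) := by
  ext r
  rw [coeff_seriesMatrix, drT, adjFamily_self_right _ _ _ (lo_ne_hi j).symm, drUnit_hi_lo,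
    H.F_one_lie_D_lo]

theorem seriesMatrix_drT_hi_hi : seriesMatrix (drT D E F (lo j)) (hi j) (hi j) =
    mk (F j) * mk (D (lo j)) * mk (E j) + mk (D (hi j)) := by
  ext r
  rw [coeff_seriesMatrix, drT, adjFamily_of_ne _ _ _ (lo_ne_hi j).symm (lo_ne_hi j).symm,
    if_pos rfl, drUnit_lo_hi, drUnit_hi_lo, H.D_lo_lie_E_one, ← coeff_C_mul_sub_mul_C,
    H.commutator_F_D_mul_E, map_sub, coeff_mk, sub_add_cancel]

theorem rttDefect_drT_lo_lo (r s : ℕ) :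
    rttDefect (drT D E F (lo j)) r s (lo j) (lo j) (lo j) (lo j) = 0 := by
  apply rttDefect_eq_zero_of_series
  rw [seriesMatrix_drT_lo_lo, H.inU_D_mul_inV_D, sub_self, mul_zero, mul_zero]

theorem rttDefect_drT_lo_hi (r s : ℕ) :
    rttDefect (drT D E F (lo j)) r s (lo j) (lo j) (lo j) (hi j) = 0 := by
  apply rttDefect_eq_zero_of_series
  rw [seriesMatrix_drT_lo_lo, H.seriesMatrix_drT_lo_hi]
  simp only [map_mul]
  rw [← mul_assoc, H.inU_D_mul_inV_D, mul_assoc, mul_assoc, ← mul_sub, ← mul_sub, ← mul_assoc,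
    vInv_sub_uInv_mul_comm, mul_assoc, H.D_E_series, ← mul_assoc, ← uInv_mul_vInv_mul_comm,
    mul_assoc]

theorem rttDefect_drT_hi_lo (r s : ℕ) :
    rttDefect (drT D E F (lo j)) r s (lo j) (lo j) (hi j) (lo j) = 0 := by
  apply rttDefect_eq_zero_of_series
  rw [seriesMatrix_drT_lo_lo, H.seriesMatrix_drT_hi_lo]
  simp only [map_mul]
  rw [mul_assoc (inV (mk (F j))), ← H.inU_D_mul_inV_D, ← mul_assoc, ← mul_assoc, ← sub_mul,
    ← sub_mul, ← mul_assoc, H.D_F_series, mul_assoc]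

theorem rttDefect_drT_hi_hi (r s : ℕ) :
    rttDefect (drT D E F (lo j)) r s (lo j) (lo j) (hi j) (hi j) = 0 := by
  apply rttDefect_eq_zero_of_series
  rw [seriesMatrix_drT_lo_lo, H.seriesMatrix_drT_lo_hi, H.seriesMatrix_drT_hi_lo,
    H.seriesMatrix_drT_hi_hi]
  simp only [map_mul, map_add]
  have D_D := H.inU_D_mul_inV_D (lo j) (lo j)
  have D_D' := H.inU_D_mul_inV_D (lo j) (hi j)
  have D_E := H.D_E_series j
  have D_F := H.D_F_series j
  set d := inU (mk (D (lo j)))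
  set d' := inV (mk (D (lo j)))
  set e := inU (mk (E j))
  set e' := inV (mk (E j))
  set f := inU (mk (F j))
  set f' := inV (mk (F j))
  have left : d * (f' * d' * e' + inV (mk (D (hi j)))) -
      (f' * d' * e' + inV (mk (D (hi j)))) * d =
        (d * f' - f' * d) * (d' * e') + f' * d' * (d * e' - e' * d) := by
    rw [mul_add, add_mul, D_D', mul_sub, sub_mul, ← mul_assoc (f' * d'), mul_assoc f' d' d, ← D_D]
    noncomm_ring
  have right : f * d * (d' * e') - f' * d' * (d * e) =
      (f * d - f' * d) * (d' * e') + f' * d' * (d * e' - d * e) := by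
    rw [mul_sub, sub_mul, ← mul_assoc (f' * d') d e', mul_assoc f' d' d, ← D_D]
    noncomm_ring
  have D_E_mul : (vInv A - uInv A) * (f' * d' * (d * e' - e' * d)) =
      uInv A * vInv A * (f' * d' * (d * e' - d * e)) := by
    rw [← mul_assoc, vInv_sub_uInv_mul_comm, mul_assoc, D_E, ← mul_assoc,
      ← uInv_mul_vInv_mul_comm, mul_assoc]
  rw [left, right, mul_add, mul_add, D_E_mul, ← mul_assoc, D_F, mul_assoc]

variable [Algebra ℂ A]

theorem actsAsUnit_drUnit_drUnit (a b : Fin n) :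
    ActsAsUnit (drUnit D E F a b) a b (drUnit D E F) :=
  H.isChevalleyFamily.actsAsUnit_glRoot isSMulRegular_two a b

theorem actsAsUnit_drUnit_drT {o : Fin n} (ho : (o : ℕ) = 0) (a b : Fin n) (r : ℕ) :
    ActsAsUnit (drUnit D E F a b) a b (fun i k ↦ drT D E F o i k r) := by
  have invariant : IsLeviInvariant (drUnit D E F) o (D o r) := H.isLeviInvariant_D_first ho r
  obtain hn | hn : n = 1 ∨ 0 < n - 1 := by have := o.2; omega
  · subst hn
    exact invariant.actsAsUnit_adjFamily H.actsAsUnit_drUnit_drUnit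
      (fun b _ hb ↦ absurd (Subsingleton.elim b o) hb)
      (fun b _ hb ↦ absurd (Subsingleton.elim b o) hb) a b
  · obtain rfl : lo ⟨0, hn⟩ = o := Fin.ext ho.symm
    refine invariant.actsAsUnit_adjFamily_of_serre H.actsAsUnit_drUnit_drUnit isSMulRegular_two
      (lo_ne_hi _).symm ?_ ?_ a b
    · rw [drUnit_lo_hi]; exact H.E_lie_D_lie_E _ r
    · rw [drUnit_hi_lo]; exact H.F_lie_F_lie_D _ r

theorem rttDefect_drT {o : Fin n} (ho : (o : ℕ) = 0) (r s : ℕ) (i k l m : Fin n) :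
    rttDefect (drT D E F o) r s i k l m = 0 := by
  obtain hn | hn : n = 1 ∨ 0 < n - 1 := by have := o.2; omega
  · subst hn
    have D_D := sub_eq_zero.mp ((Ring.lie_def _ _).symm.trans (H.D_D o o r s))
    obtain ⟨rfl, rfl, rfl, rfl⟩ : i = o ∧ k = o ∧ l = o ∧ m = o :=
      ⟨Subsingleton.elim _ _, Subsingleton.elim _ _, Subsingleton.elim _ _, Subsingleton.elim _ _⟩
    simp only [rttDefect, drT, adjFamily_self_self, H.D_D, D_D, sub_self]
  · obtain rfl : lo ⟨0, hn⟩ = o := Fin.ext ho.symm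
    exact (isUnitStable_rttDefect (fun a b r ↦ H.actsAsUnit_drUnit_drT ho a b r) r s).eq_zero
      (lo_ne_hi _).symm (H.rttDefect_drT_lo_lo _ r s) (H.rttDefect_drT_lo_hi _ r s)
      (H.rttDefect_drT_hi_lo _ r s) (H.rttDefect_drT_hi_hi _ r s) i k l m

theorem isRTT_drT {o : Fin n} (ho : (o : ℕ) = 0) : IsRTT (drT D E F o) where
  zero i k := by
    have lie_one_eq (x : A) : ⁅x, (1 : A)⁆ = 0 := by simp [Ring.lie_def]
    have one_lie_eq (x : A) : ⁅(1 : A), x⁆ = 0 := by simp [Ring.lie_def]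
    rw [drT, H.D_zero, adjFamily]
    simp only [lie_one_eq, one_lie_eq, lie_zero, zero_add]
    split_ifs <;> simp_all
  rel i k l m r s := sub_eq_zero.mp (H.rttDefect_drT ho r s i k l m)

end IsDrinfeld

end DrinfeldSeries

/-! ### Generation in low degree, and the isomorphism -/

section Generation

attribute [local instance] LieRing.ofAssociativeRing

variable {A : Type*} [Ring A] {n : ℕ}

theorem lie_mem {S : Subring A} {x y : A} (hx : x ∈ S) (hy : y ∈ S) : ⁅x, y⁆ ∈ S :=
  S.sub_mem (S.mul_mem hx hy) (S.mul_mem hy hx)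

namespace IsRTT

variable {T : Fin n → Fin n → ℕ → A} {S : Subring A}

theorem first_row_mem (hT : IsRTT T) {o : Fin n} (ho : (o : ℕ) = 0) (hD : ∀ r, T o o r ∈ S)
    (hE : ∀ j, T (lo j) (hi j) 1 ∈ S) (r k : ℕ) (hk : k < n) : T o ⟨k, hk⟩ r ∈ S := by
  induction k with
  | zero => simpa only [← ho] using hD r
  | succ k ih =>
    let j : Fin (n - 1) := ⟨k, by omega⟩
    have hi_ne : hi j ≠ o := fun h ↦ by simp [← h, hi] at ho
    have raise : ⁅T (lo j) (hi j) 1, T o (lo j) r⁆ = -T o (hi j) r := by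
      rw [hT.lie_one, if_neg hi_ne, if_pos rfl, zero_sub]
    exact neg_mem_iff.mp (raise ▸ lie_mem (hE j) (ih (by omega)))

theorem mem (hT : IsRTT T) (hD : ∀ o : Fin n, (o : ℕ) = 0 → ∀ r, T o o r ∈ S)
    (hE : ∀ j, T (lo j) (hi j) 1 ∈ S) (hF : ∀ j, T (hi j) (lo j) 1 ∈ S) (i k : Fin n) (r : ℕ) :
    T i k r ∈ S := by
  obtain ⟨i, i_lt⟩ := i
  induction i generalizing k with
  | zero => exact hT.first_row_mem rfl (hD _ rfl) hE r k k.2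
  | succ i ih =>
    let j : Fin (n - 1) := ⟨i, by omega⟩
    have lower : ⁅T (hi j) (lo j) 1, T (lo j) k r⁆ =
        T (hi j) k r - if k = hi j then T (lo j) (lo j) r else 0 := by
      rw [hT.lie_one, if_pos rfl]
    have row_mem (k : Fin n) : T (lo j) k r ∈ S := ih k (by omega)
    have correction_mem : (if k = hi j then T (lo j) (lo j) r else 0) ∈ S := by
      split_ifs
      exacts [row_mem _, S.zero_mem]
    exact (eq_sub_iff_add_eq.mp lower) ▸ S.add_mem (lie_mem (hF j) (row_mem k)) correction_mem

end IsRTT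

namespace IsDrinfeld

variable {D Dt : Fin n → ℕ → A} {E F : Fin (n - 1) → ℕ → A} {S : Subring A}
  (H : IsDrinfeld D Dt E F)
include H

theorem E_mem {j : Fin (n - 1)} (hD : ∀ r, D (lo j) r ∈ S) (hE : E j 1 ∈ S) {s : ℕ} (hs : 1 ≤ s) :
    E j s ∈ S := by
  induction s, hs using Nat.le_induction with
  | base => exact hE
  | succ s hs ih =>
    have raise : ⁅D (lo j) 2, E j s⁆ = E j (s + 1) + D (lo j) 1 * E j s := by
      rw [H.D_lo_lie_E j hs, Finset.sum_range_succ, Finset.sum_range_one, H.D_zero, one_mul,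
        show 2 + s - 1 - 0 = s + 1 by omega, show 2 + s - 1 - 1 = s by omega]
    exact (sub_eq_iff_eq_add.mpr raise) ▸ S.sub_mem (lie_mem (hD 2) ih) (S.mul_mem (hD 1) ih)

theorem F_mem {j : Fin (n - 1)} (hD : ∀ r, D (lo j) r ∈ S) (hF : F j 1 ∈ S) {s : ℕ} (hs : 1 ≤ s) :
    F j s ∈ S := by
  induction s, hs using Nat.le_induction with
  | base => exact hF
  | succ s hs ih =>
    have raise : -⁅D (lo j) 2, F j s⁆ = F j (s + 1) + F j s * D (lo j) 1 := by
      rw [H.D_lo_lie_F j hs, Finset.sum_range_succ, Finset.sum_range_one, H.D_zero, mul_one,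
        neg_neg, show 2 + s - 1 - 0 = s + 1 by omega, show 2 + s - 1 - 1 = s by omega]
    exact (sub_eq_iff_eq_add.mpr raise) ▸
      S.sub_mem (S.neg_mem (lie_mem (hD 2) ih)) (S.mul_mem ih (hD 1))

theorem Dt_mem {i : Fin n} (hD : ∀ r, D i r ∈ S) (r : ℕ) : Dt i r ∈ S := by
  induction r using Nat.strong_induction_on with
  | _ r ih =>
    have recursion := H.D_Dt i r
    rw [← Nat.range_succ_eq_Icc_zero, Finset.sum_range_succ', H.D_zero, one_mul, Nat.sub_zero,
      ← eq_sub_iff_add_eq'] at recursion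
    rw [recursion]
    refine S.sub_mem (S.zsmul_mem S.one_mem _) (S.sum_mem fun t ht ↦ ?_)
    exact S.mul_mem (hD _) (ih _ (by have := Finset.mem_range.mp ht; omega))

theorem D_hi_mem {j : Fin (n - 1)} (hD : ∀ r, D (lo j) r ∈ S) (hE : E j 1 ∈ S) (hF : F j 1 ∈ S)
    (r : ℕ) : D (hi j) r ∈ S := by
  induction r using Nat.strong_induction_on with
  | _ r ih =>
    rcases r with _ | r
    · exact H.D_zero (hi j) ▸ S.one_mem
    have recursion := H.E_F j j (r + 1) 1 (by omega) le_rfl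
    rw [← Nat.range_succ_eq_Icc_zero, Finset.sum_range_succ', H.Dt_zero, delta, if_pos rfl,
      one_smul, neg_mul, one_mul, Nat.add_sub_cancel, Nat.sub_zero, ← sub_eq_add_neg,
      eq_sub_iff_add_eq', ← eq_sub_iff_add_eq] at recursion
    rw [recursion]
    refine S.sub_mem (S.sum_mem fun t ht ↦ ?_) (lie_mem (H.E_mem hD hE (by omega)) hF)
    exact S.mul_mem (H.Dt_mem hD _) (ih _ (by have := Finset.mem_range.mp ht; omega))

theorem D_mem (hD : ∀ o : Fin n, (o : ℕ) = 0 → ∀ r, D o r ∈ S) (hE : ∀ j, E j 1 ∈ S)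
    (hF : ∀ j, F j 1 ∈ S) (i : Fin n) (r : ℕ) : D i r ∈ S := by
  obtain ⟨i, i_lt⟩ := i
  induction i generalizing r with
  | zero => exact hD _ rfl r
  | succ i ih =>
    let j : Fin (n - 1) := ⟨i, by omega⟩
    exact H.D_hi_mem (j := j) (fun r ↦ ih r (by omega)) (hE j) (hF j) r

end IsDrinfeld

theorem adjFamily_apply_unit {L ι : Type*} [LieRing L] [DecidableEq ι] {g : ι → ι → L}
    (hg : ∀ a b, ActsAsUnit (g a b) a b g) (o i k : ι) : adjFamily g o (g o o) i k = g i k := by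
  have corner_lie {k : ι} (hk : k ≠ o) : ⁅g o o, g o k⁆ = g o k := by
    rw [hg, if_pos rfl, if_neg hk, sub_zero]
  by_cases hi : i = o <;> by_cases hk : k = o
  · rw [hi, hk, adjFamily_self_self]
  · rw [hi, adjFamily_self_left _ _ _ hk, corner_lie hk]
  · rw [hk, adjFamily_self_right _ _ _ hi, hg, if_pos rfl, if_neg (Ne.symm hi), sub_zero]
  · rw [adjFamily_of_ne _ _ _ hi hk, corner_lie hk, hg, if_pos rfl]
    simp only [eq_comm, sub_add_cancel]

variable [Algebra ℂ A]

theorem IsDrinfeld.drT_one {D Dt : Fin n → ℕ → A} {E F : Fin (n - 1) → ℕ → A}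
    (H : IsDrinfeld D Dt E F) (o i k : Fin n) : drT D E F o i k 1 = drUnit D E F i k := by
  rw [drT, ← drUnit_self D E F o, adjFamily_apply_unit H.actsAsUnit_drUnit_drUnit]

theorem yangian_algHom_ext {f g : Yangian n →ₐ[ℂ] A}
    (hD : ∀ o : Fin n, (o : ℕ) = 0 → ∀ r, f (genT o o r) = g (genT o o r))
    (hE : ∀ j, f (genT (lo j) (hi j) 1) = g (genT (lo j) (hi j) 1))
    (hF : ∀ j, f (genT (hi j) (lo j) 1) = g (genT (hi j) (lo j) 1)) : f = g := by
  have agree : ∀ i k r, genT i k r ∈ (AlgHom.equalizer f g).toSubring :=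
    (isRTT_genT n).mem hD hE hF
  refine RingQuot.ringQuot_ext' ℂ f _ (FreeAlgebra.hom_ext (funext ?_))
  rintro ⟨i, k, r⟩
  exact agree i k (r + 1)

theorem drinfeldYangian_algHom_ext {f g : DrinfeldYangian n →ₐ[ℂ] A}
    (hD : ∀ o : Fin n, (o : ℕ) = 0 → ∀ r, f (drMk n (frD o r)) = g (drMk n (frD o r)))
    (hE : ∀ j, f (drMk n (frE j 1)) = g (drMk n (frE j 1)))
    (hF : ∀ j, f (drMk n (frF j 1)) = g (drMk n (frF j 1))) : f = g := by
  have H := isDrinfeld_drMk n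
  have agree_D : ∀ i r, drMk n (frD i r) ∈ (AlgHom.equalizer f g).toSubring := H.D_mem hD hE hF
  refine RingQuot.ringQuot_ext' ℂ f _ (FreeAlgebra.hom_ext (funext ?_))
  rintro (⟨i, r⟩ | ⟨i, r⟩ | ⟨j, r⟩ | ⟨j, r⟩)
  · exact agree_D i r
  · exact H.Dt_mem (agree_D i) r
  · exact H.E_mem (agree_D (lo j)) (hE j) (Nat.le_add_left 1 r)
  · exact H.F_mem (agree_D (lo j)) (hF j) (Nat.le_add_left 1 r)

theorem drinfeldYangian_range_le {φ : DrinfeldYangian n →ₐ[ℂ] A} {S : Subalgebra ℂ A}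
    (hD : ∀ i r, φ (drMk n (frD i r)) ∈ S) (hDt : ∀ i r, φ (drMk n (frDt i r)) ∈ S)
    (hE : ∀ j r, 1 ≤ r → φ (drMk n (frE j r)) ∈ S)
    (hF : ∀ j r, 1 ≤ r → φ (drMk n (frF j r)) ∈ S) : φ.range ≤ S := by
  have free_le : (⊤ : Subalgebra ℂ (FreeDr n)) ≤ S.comap (φ.comp (drMk n)) := by
    rw [← FreeAlgebra.adjoin_range_ι, Algebra.adjoin_le_iff]
    rintro _ ⟨⟨i, r⟩ | ⟨i, r⟩ | ⟨j, r⟩ | ⟨j, r⟩, rfl⟩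
    exacts [hD i r, hDt i r, hE j (r + 1) (Nat.le_add_left 1 r), hF j (r + 1) (Nat.le_add_left 1 r)]
  rintro _ ⟨x, rfl⟩
  obtain ⟨x, rfl⟩ := RingQuot.mkAlgHom_surjective ℂ (DrinfeldRel n) x
  exact free_le trivial

theorem exists_yangian_to_drinfeldYangian (n : ℕ) : ∃ ψ : Yangian n →ₐ[ℂ] DrinfeldYangian n,
    (∀ o : Fin n, (o : ℕ) = 0 → ∀ r, ψ (genT o o r) = drMk n (frD o r)) ∧
    (∀ j, ψ (genT (lo j) (hi j) 1) = drMk n (frE j 1)) ∧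
    ∀ j, ψ (genT (hi j) (lo j) 1) = drMk n (frF j 1) := by
  rcases Nat.eq_zero_or_pos n with rfl | hn
  · obtain ⟨ψ, -⟩ := exists_yangian_lift (A := DrinfeldYangian 0) (T := finZeroElim)
      ⟨finZeroElim, finZeroElim⟩
    exact ⟨ψ, finZeroElim, finZeroElim, finZeroElim⟩
  · have H := isDrinfeld_drMk n
    obtain ⟨ψ, hψ⟩ := exists_yangian_lift (H.isRTT_drT (o := ⟨0, hn⟩) rfl)
    refine ⟨ψ, fun o ho r ↦ ?_, fun j ↦ ?_, fun j ↦ ?_⟩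
    · rw [show o = ⟨0, hn⟩ from Fin.ext ho, hψ, drT, adjFamily_self_self]
    · rw [hψ, H.drT_one, drUnit_lo_hi]
    · rw [hψ, H.drT_one, drUnit_hi_lo]

omit [Algebra ℂ A] in
theorem T_first_first {T : Fin n → Fin n → ℕ → A} {G : GaussFactors n (PowerSeries A)}
    (hG : G.IsFactorizationOf (seriesMatrix T)) {o : Fin n} (ho : (o : ℕ) = 0) (r : ℕ) :
    T o o r = G.coeffD o r := by
  have series_eq : seriesMatrix T o o = G.D o := by
    rw [hG.eq_mul, GaussFactors.mul_apply, Fintype.sum_eq_single o, hG.F_diag, hG.E_diag, one_mul,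
      mul_one]
    intro m hm
    rw [hG.F_upper o m (by rw [Fin.lt_def]; omega), zero_mul, zero_mul]
  rw [GaussFactors.coeffD, ← series_eq, coeff_seriesMatrix]

end Generation

end YangianGL

end

open YangianGL

theorem theorem5p2 (n : ℕ) :
    (∃! G : YangianGL.GaussFactors n (PowerSeries (YangianGL.Yangian n)),
      G.IsFactorizationOf (YangianGL.tMatrix n)) ∧
    ∀ G : YangianGL.GaussFactors n (PowerSeries (YangianGL.Yangian n)),
      G.IsFactorizationOf (YangianGL.tMatrix n) →
      (Algebra.adjoin ℂ
          ({x | ∃ (i : Fin n) (r : ℕ), x = G.coeffD i r ∨ x = G.coeffDt i r} ∪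
            {x | ∃ (i : Fin (n - 1)) (r : ℕ), 1 ≤ r ∧ (x = G.coeffE i r ∨ x = G.coeffF i r)}) =
        ⊤) ∧
      ∃ φ : YangianGL.DrinfeldYangian n ≃ₐ[ℂ] YangianGL.Yangian n,
        (∀ (i : Fin n) (r : ℕ), φ (YangianGL.drMk n (YangianGL.frD i r)) = G.coeffD i r) ∧
        (∀ (i : Fin n) (r : ℕ), φ (YangianGL.drMk n (YangianGL.frDt i r)) = G.coeffDt i r) ∧
        (∀ (i : Fin (n - 1)) (r : ℕ), 1 ≤ r →
          φ (YangianGL.drMk n (YangianGL.frE i r)) = G.coeffE i r) ∧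
        (∀ (i : Fin (n - 1)) (r : ℕ), 1 ≤ r →
          φ (YangianGL.drMk n (YangianGL.frF i r)) = G.coeffF i r) := by
  have hT := isRTT_genT n
  refine ⟨existsUnique_gauss _ hT.constantCoeff, fun G hG ↦ ?_⟩
  obtain ⟨φ, φD, φDt, φE, φF⟩ := (isDrinfeld_gauss hT hG).exists_lift
  obtain ⟨ψ, ψD, ψE, ψF⟩ := exists_yangian_to_drinfeldYangian n
  have φD_first (o : Fin n) (ho : (o : ℕ) = 0) (r : ℕ) : φ (drMk n (frD o r)) = genT o o r :=
    (φD o r).trans (T_first_first hG ho r).symm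
  have φE_one (j) : φ (drMk n (frE j 1)) = genT (lo j) (hi j) 1 :=
    (φE j 1).trans (T_lo_hi hT hG j).symm
  have φF_one (j) : φ (drMk n (frF j 1)) = genT (hi j) (lo j) 1 :=
    (φF j 1).trans (T_hi_lo hT hG j).symm
  have φψ : φ.comp ψ = AlgHom.id ℂ (Yangian n) := yangian_algHom_ext
    (fun o ho r ↦ by simp [ψD o ho, φD_first o ho]) (by simp [ψE, φE_one]) (by simp [ψF, φF_one])
  have ψφ : ψ.comp φ = AlgHom.id ℂ (DrinfeldYangian n) := drinfeldYangian_algHom_ext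
    (fun o ho r ↦ by simp [ψD o ho, φD_first o ho]) (by simp [ψE, φE_one]) (by simp [ψF, φF_one])
  have φ_range : φ.range = ⊤ := φ.range_eq_top.mpr fun y ↦ ⟨ψ y, DFunLike.congr_fun φψ y⟩
  refine ⟨?_, AlgEquiv.ofAlgHom φ ψ φψ ψφ, φD, φDt, fun j r _ ↦ φE j r, fun j r _ ↦ φF j r⟩
  rw [← top_le_iff, ← φ_range]
  exact drinfeldYangian_range_le
    (fun i r ↦ Algebra.subset_adjoin (.inl ⟨i, r, .inl (φD i r)⟩))
    (fun i r ↦ Algebra.subset_adjoin (.inl ⟨i, r, .inr (φDt i r)⟩))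
    (fun j r hr ↦ Algebra.subset_adjoin (.inr ⟨j, r, hr, .inl (φE j r)⟩))
    fun j r hr ↦ Algebra.subset_adjoin (.inr ⟨j, r, hr, .inr (φF j r)⟩)
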